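/- Let $d_A\ge d_C\ge 1$ be integers and $\varepsilon>0$. For a probability distribution $P_{AC}$ on $\{1,\dots,d_A\}\times\{1,\dots,d_C\}$ with marginals $P_A,P_C$ let $$I(A:C)_P = D(P_{AC}\,\|\,P_AP_C)=\sum_{a,c}P_{AC}(a,c)\log\frac{P_{AC}(a,c)}{P_A(a)P_C(c)}$$ (natural logarithm, $0\log 0=0$). Let $\mathrm{SC}_{\mathrm{MI}}(\varepsilon,d_A,d_C)$ be the least $N$ for which there is a (possibly randomized) tester that, given $N$ i.i.d. samples from an unknown $P_{AC}$, answers "independent" with probability at least $2/3$ whenever $I(A:C)_P=0$, and answers "dependent" with probability at least $2/3$ whenever $I(A:C)_P\ge\varepsilon$. Put $$F(\varepsilon,d_A,d_C)=\min\left\{\frac{d_A^{3/4}d_C^{1/4}}{\varepsilon},\ \frac{d_A^{2/3}d_C^{1/3}}{\varepsilon^{4/3}}\right\},\qquad L=\log\left(2+\frac{d_Ad_C}{\varepsilon}\right).$$ Then there are absolute constants $\varepsilon_0>0$, $K>0$ and $k\in\mathbb N$ such that the following hold. 1. (Upper bound) For all $d_A\ge d_C\ge1$ and all $\varepsilon>0$,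 such an $N$ exists and $\mathrm{SC}_{\mathrm{MI}}(\varepsilon,d_A,d_C)\le K\,L^k\,F(\varepsilon,d_A,d_C)$. 2. (Lower bound) For all $d_A\ge d_C\ge2$ and all $0<\varepsilon\le\varepsilon_0$, $F(\varepsilon,d_A,d_C)\le K\,L^k\,\mathrm{SC}_{\mathrm{MI}}(\varepsilon,d_A,d_C)$. That is, $\mathrm{SC}_{\mathrm{MI}}(\varepsilon,d_A,d_C)=\widetilde\Theta\left(F(\varepsilon,d_A,d_C)\right)$, where $\widetilde\Theta$ hides factors polylogarithmic in $d_A,d_C,1/\varepsilon$. -/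

import Mathlib

noncomputable section

namespace MITesting

/-- The Kullback-Leibler divergence `D(P‖Q) = ∑ x, P(x) log (P(x) / Q(x))` on a finite alphabet,
with the natural logarithm and `0 log 0 = 0`. As usual it is only meant for `supp P ⊆ supp Q`;
below it is only evaluated at `Q = P_A P_C`, whose support contains that of `P = P_AC`. -/
def klDivergence {α : Type} [Fintype α] (P Q : PMF α) : ℝ :=
  ∑ x, (P x).toReal * Real.log ((P x).toReal / (Q x).toReal)

/-- The product `P_A P_C` of the two marginals of a joint distribution `P_AC`. -/
def marginalProduct {α γ : Type} (P : PMF (α × γ)) : PMF (α × γ) :=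
  (P.map Prod.fst).bind fun a => (P.map Prod.snd).map fun c => (a, c)

/-- A (possibly randomized) tester using `N` samples from `α`: given the samples, it outputs
`true` (class (i)) or `false` (class (ii)) at random, with a law depending on the samples. -/
abbrev Tester (α : Type) (N : ℕ) : Type := (Fin N → α) → PMF Bool

/-- The probability that the tester `T` outputs `b` when it is fed with `N` i.i.d. samples
from `P`. -/
def outputProb {α : Type} [Fintype α] {N : ℕ} (P : PMF α) (T : Tester α N) (b : Bool) : ℝ :=
  ∑ s : Fin N → α, (∏ i, (P (s i)).toReal) * (T s b).toReal

/-- `N` samples suffice for independence testing with respect to the distance measure `Δ` and the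
threshold `ε` on alphabets of sizes `dA` and `dC`: some tester with `N` samples identifies, for
every unknown `P_AC`, each of the classes
(i) `Δ(P_AC‖P_A P_C) = 0` and (ii) `Δ(P_AC‖P_A P_C) ≥ ε` with probability at least `2/3`. -/
def IndepTestable (dA dC : ℕ)
    (Δ : PMF (Fin dA × Fin dC) → PMF (Fin dA × Fin dC) → ℝ) (ε : ℝ) (N : ℕ) : Prop :=
  ∃ T : Tester (Fin dA × Fin dC) N, ∀ P : PMF (Fin dA × Fin dC),
    (Δ P (marginalProduct P) = 0 → 2 / 3 ≤ outputProb P T true) ∧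
    (ε ≤ Δ P (marginalProduct P) → 2 / 3 ≤ outputProb P T false)

/-- `N` samples suffice for mutual information testing: independence testing with `Δ = D`, so
that `Δ(P_AC‖P_A P_C) = I(A:C)`. -/
def MITestable (ε : ℝ) (dA dC N : ℕ) : Prop :=
  IndepTestable dA dC klDivergence ε N

/-- The sample complexity of mutual information testing: the least sufficient number of samples
(meaningful when some number of samples suffices). -/
def miSampleComplexity (ε : ℝ) (dA dC : ℕ) : ℕ :=
  sInf {N | MITestable ε dA dC N}

/-- `min {dA^(3/4) dC^(1/4) / ε, dA^(2/3) dC^(1/3) / ε^(4/3)}`. -/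
def miRate (ε : ℝ) (dA dC : ℕ) : ℝ :=
  min ((dA : ℝ) ^ (3 / 4 : ℝ) * (dC : ℝ) ^ (1 / 4 : ℝ) / ε)
    ((dA : ℝ) ^ (2 / 3 : ℝ) * (dC : ℝ) ^ (1 / 3 : ℝ) / ε ^ (4 / 3 : ℝ))

end MITesting

end

/-!
Lower bound: hide a dependent law behind the uniform one. One reference row has nearly all the
mass. Each other row is, at random, *heavy* (mass about `1 / N`, uniform columns) or *light* (mass
about `ε / n`, columns perturbed by random signs in pairs). The light rows carry mutual
information of order `ε`, but only a row seen twice reveals its signs, and such a row is typically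
heavy. Tilting the prior of each row by `exp (-t μ)`, with `μ` the mass of the row, nearly cancels
the normalisation of the masses, so the rows are almost independent given how often they are seen.
The law of the columns is then compared with the uniform one row by row through the second moment
of the likelihood ratio.

Upper bound: if the mutual information is at least `ε`, then, up to a logarithm, so is the
triangular discrimination `∑ (p - q)² / (p + q)` between the law `p` and the product `q` of its
marginals. To detect it, a first part of the samples estimates `q` cell by cell and the cells are
sorted into dyadic levels by this estimate. On some level the discrimination forces `∑ (p - q)²` to
be large, and it is estimated by an inner product of two independent batches of vectors of mean
`p - q`. Cells in light columns are negligible. Cells in heavy rows and those in light rows lead to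
two conditions on the number of samples, and together with the noise of the estimate these are met
above the rate `F`.
-/

noncomputable section

namespace MITesting

/-! ### Finite probability -/

/-- The expectation `∑ ω, w ω f ω` of `f` under the weights `w`. Real weights, rather
than a `PMF` or a `Measure`, make every expectation a finite sum of real numbers. -/
def expect {Ω : Type*} [Fintype Ω] (w f : Ω → ℝ) : ℝ := ∑ ω, w ω * f ω

open Classical in
/-- The mass of the event `A` under the weights `w`. -/
def prob {Ω : Type*} [Fintype Ω] (w : Ω → ℝ) (A : Ω → Prop) : ℝ :=
  expect w fun ω => if A ω then 1 else 0

/-- Probability weights: nonnegative of total mass one. -/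
structure IsProb {Ω : Type*} [Fintype Ω] (w : Ω → ℝ) : Prop where
  nonneg : ∀ ω, 0 ≤ w ω
  sum_eq : ∑ ω, w ω = 1

/-- The joint weight of independent samples from `p`, indexed by `ι`. -/
def iid {α : Type*} (ι : Type*) [Fintype ι] (p : α → ℝ) (s : ι → α) : ℝ := ∏ i, p (s i)

/-- The joint weight of two independent variables with weights `w` and `w'`. -/
def prodWeight {Ω Ω' : Type*} (w : Ω → ℝ) (w' : Ω' → ℝ) (x : Ω × Ω') : ℝ := w x.1 * w' x.2

section Expectation

variable {Ω Ω' : Type*} [Fintype Ω] [Fintype Ω'] {w : Ω → ℝ} {w' : Ω' → ℝ}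

lemma expect_add (f g : Ω → ℝ) : expect w (fun ω => f ω + g ω) = expect w f + expect w g := by
  simp only [expect, mul_add, Finset.sum_add_distrib]

lemma expect_sub (f g : Ω → ℝ) : expect w (fun ω => f ω - g ω) = expect w f - expect w g := by
  simp only [expect, mul_sub, Finset.sum_sub_distrib]

lemma expect_const_mul (c : ℝ) (f : Ω → ℝ) : expect w (fun ω => c * f ω) = c * expect w f := by
  simp only [expect, Finset.mul_sum, mul_left_comm]

lemma expect_mul_const (c : ℝ) (f : Ω → ℝ) : expect w (fun ω => f ω * c) = expect w f * c := by
  simp only [expect, Finset.sum_mul, mul_assoc]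

lemma expect_sum {ι : Type*} (t : Finset ι) (f : ι → Ω → ℝ) :
    expect w (fun ω => ∑ i ∈ t, f i ω) = ∑ i ∈ t, expect w (f i) := by
  simp only [expect, Finset.mul_sum]
  exact Finset.sum_comm

lemma expect_comm (f : Ω → Ω' → ℝ) :
    expect w (fun ω => expect w' (f ω)) = expect w' fun ω' => expect w fun ω => f ω ω' := by
  simp only [expect, Finset.mul_sum]
  rw [Finset.sum_comm]
  simp only [mul_left_comm]

lemma expect_comp_equiv (e : Ω ≃ Ω') (f : Ω' → ℝ) :
    expect (fun ω => w' (e ω)) (fun ω => f (e ω)) = expect w' f :=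
  e.sum_comp fun ω => w' ω * f ω

lemma IsProb.expect_const (hw : IsProb w) (c : ℝ) : expect w (fun _ => c) = c := by
  rw [expect, ← Finset.sum_mul, hw.sum_eq, one_mul]

lemma IsProb.le_one (hw : IsProb w) (ω : Ω) : w ω ≤ 1 :=
  hw.sum_eq ▸ Finset.single_le_sum (f := w) (fun _ _ => hw.nonneg _) (Finset.mem_univ ω)

lemma IsProb.comp_equiv (hw' : IsProb w') (e : Ω ≃ Ω') : IsProb fun ω => w' (e ω) where
  nonneg _ := hw'.nonneg _
  sum_eq := (e.sum_comp w').trans hw'.sum_eq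

lemma expect_mono (hw : ∀ ω, 0 ≤ w ω) {f g : Ω → ℝ} (h : ∀ ω, f ω ≤ g ω) :
    expect w f ≤ expect w g :=
  Finset.sum_le_sum fun ω _ => mul_le_mul_of_nonneg_left (h ω) (hw ω)

lemma expect_nonneg (hw : ∀ ω, 0 ≤ w ω) {f : Ω → ℝ} (h : ∀ ω, 0 ≤ f ω) : 0 ≤ expect w f :=
  Finset.sum_nonneg fun ω _ => mul_nonneg (hw ω) (h ω)

lemma prob_nonneg (hw : ∀ ω, 0 ≤ w ω) (A : Ω → Prop) : 0 ≤ prob w A :=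
  expect_nonneg hw fun ω => by split_ifs <;> norm_num

lemma prob_mono (hw : ∀ ω, 0 ≤ w ω) {A B : Ω → Prop} (h : ∀ ω, A ω → B ω) :
    prob w A ≤ prob w B := by
  classical
  refine expect_mono hw fun ω => ?_
  by_cases hA : A ω
  · simp [hA, h ω hA]
  · by_cases hB : B ω <;> simp [hA, hB]

lemma prob_or_le (hw : ∀ ω, 0 ≤ w ω) (A B : Ω → Prop) :
    prob w (fun ω => A ω ∨ B ω) ≤ prob w A + prob w B := by
  classical
  rw [prob, prob, prob, ← expect_add]
  refine expect_mono hw fun ω => ?_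
  by_cases hA : A ω <;> by_cases hB : B ω <;> simp [hA, hB]

lemma prob_exists_le (hw : ∀ ω, 0 ≤ w ω) {ι : Type*} (t : Finset ι) (A : ι → Ω → Prop) :
    prob w (fun ω => ∃ i ∈ t, A i ω) ≤ ∑ i ∈ t, prob w (A i) := by
  classical
  simp only [prob]
  rw [← expect_sum]
  refine expect_mono hw fun ω => ?_
  have h0 : ∀ i ∈ t, (0 : ℝ) ≤ if A i ω then 1 else 0 := fun i _ => by split_ifs <;> norm_num
  split_ifs with h
  · obtain ⟨i, hi, hA⟩ := h
    exact (if_pos hA).ge.trans (Finset.single_le_sum h0 hi)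
  · exact Finset.sum_nonneg h0

lemma IsProb.prob_not (hw : IsProb w) (A : Ω → Prop) :
    prob w (fun ω => ¬ A ω) = 1 - prob w A := by
  classical
  rw [eq_sub_iff_add_eq, prob, prob, ← expect_add]
  refine Eq.trans ?_ (hw.expect_const 1)
  congr 1
  funext ω
  by_cases hA : A ω <;> simp [hA]

lemma IsProb.prob_le_one (hw : IsProb w) (A : Ω → Prop) : prob w A ≤ 1 := by
  rw [← hw.expect_const 1]
  exact expect_mono hw.nonneg fun ω => by split_ifs <;> norm_num

lemma prob_ge_le_expect_div (hw : ∀ ω, 0 ≤ w ω) {f : Ω → ℝ} (hf : ∀ ω, 0 ≤ f ω) {t : ℝ}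
    (ht : 0 < t) : prob w (fun ω => t ≤ f ω) ≤ expect w f / t := by
  classical
  rw [le_div_iff₀ ht, prob, ← expect_mul_const]
  refine expect_mono hw fun ω => ?_
  split_ifs with h
  · simpa using h
  · simpa using hf ω

lemma prob_mul_lt_le_one_div (hw : ∀ ω, 0 ≤ w ω) {f : Ω → ℝ} (hf : ∀ ω, 0 ≤ f ω) {t c : ℝ}
    (ht : 0 ≤ t) (hc : 0 < c) (h : expect w f ≤ t) :
    prob w (fun ω => c * t < f ω) ≤ 1 / c := by
  classical
  rw [le_div_iff₀ hc]
  rcases ht.eq_or_lt with rfl | ht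
  · have hzero := (Finset.sum_eq_zero_iff_of_nonneg fun ω _ => mul_nonneg (hw ω) (hf ω)).1
      (h.antisymm (expect_nonneg hw hf))
    have hprob : prob w (fun ω => c * 0 < f ω) = 0 := Finset.sum_eq_zero fun ω hω => by
      rcases mul_eq_zero.1 (hzero ω hω) with h | h <;> simp [h]
    rw [hprob, zero_mul]
    exact zero_le_one
  · have hmarkov := (prob_mono hw fun ω hω => le_of_lt hω).trans
      (prob_ge_le_expect_div hw hf (mul_pos hc ht))
    rw [le_div_iff₀ (mul_pos hc ht), ← mul_assoc] at hmarkov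
    exact le_of_mul_le_mul_right (hmarkov.trans (by linarith)) ht

lemma prob_abs_sub_ge_le (hw : ∀ ω, 0 ≤ w ω) (f : Ω → ℝ) (e : ℝ) {t : ℝ} (ht : 0 < t) :
    prob w (fun ω => t ≤ |f ω - e|) ≤ expect w (fun ω => (f ω - e) ^ 2) / t ^ 2 := by
  refine (prob_mono hw fun ω hω => ?_).trans
    (prob_ge_le_expect_div hw (fun ω => sq_nonneg (f ω - e)) (by positivity))
  rw [← sq_abs (f ω - e)]
  exact pow_le_pow_left₀ ht.le hω 2

lemma expect_prodWeight (f : Ω × Ω' → ℝ) :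
    expect (prodWeight w w') f = expect w fun ω => expect w' fun ω' => f (ω, ω') := by
  simp only [expect, prodWeight, Fintype.sum_prod_type, Finset.mul_sum, mul_assoc]

protected lemma IsProb.prodWeight (hw : IsProb w) (hw' : IsProb w') :
    IsProb (prodWeight w w') where
  nonneg x := mul_nonneg (hw.nonneg _) (hw'.nonneg _)
  sum_eq := by
    simpa [expect, hw.sum_eq, hw'.sum_eq] using
      expect_prodWeight (w := w) (w' := w') fun _ => 1

lemma prob_prodWeight_le (hw : IsProb w) (hw' : IsProb w') {A : Ω × Ω' → Prop} (B : Ω → Prop)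
    {δ : ℝ} (hδ : 0 ≤ δ) (h : ∀ ω, ¬ B ω → prob w' (fun ω' => A (ω, ω')) ≤ δ) :
    prob (prodWeight w w') A ≤ prob w B + δ := by
  classical
  rw [prob, expect_prodWeight, ← hw.expect_const δ, prob, ← expect_add]
  refine expect_mono hw.nonneg fun ω => ?_
  by_cases hB : B ω
  · simp only [hB, if_true]
    exact (hw'.prob_le_one fun ω' => A (ω, ω')).trans (by linarith)
  · simpa [hB, prob] using h ω hB

end Expectation

section Iid

variable {α ι : Type*} [Fintype α] [Fintype ι] [DecidableEq ι] {p : α → ℝ}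

lemma expect_iid_prod (f : ι → α → ℝ) :
    expect (iid ι p) (fun s => ∏ i, f i (s i)) = ∏ i, expect p (f i) := by
  simp only [expect, iid, ← Finset.prod_mul_distrib]
  rw [Finset.prod_univ_sum, Fintype.piFinset_univ]

protected lemma IsProb.iid (hp : IsProb p) : IsProb (iid ι p) where
  nonneg s := Finset.prod_nonneg fun i _ => hp.nonneg _
  sum_eq := by simpa [expect, hp.sum_eq] using expect_iid_prod (ι := ι) (p := p) fun _ _ => 1

lemma IsProb.expect_iid_eval (hp : IsProb p) (i : ι) (f : α → ℝ) :
    expect (iid ι p) (fun s => f (s i)) = expect p f := by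
  have hfactor : ∀ j, expect p (fun x => if j = i then f x else 1) =
      if j = i then expect p f else 1 := fun j => by
    by_cases h : j = i <;> simp [h, hp.expect_const]
  simpa [hfactor] using expect_iid_prod (ι := ι) (p := p) fun j x => if j = i then f x else 1

lemma IsProb.expect_iid_eval_mul (hp : IsProb p) {i j : ι} (hij : i ≠ j) (f g : α → ℝ) :
    expect (iid ι p) (fun s => f (s i) * g (s j)) = expect p f * expect p g := by
  have hfactor : ∀ l, expect p (fun x => (if l = i then f x else 1) * (if l = j then g x else 1)) =
      (if l = i then expect p f else 1) * (if l = j then expect p g else 1) := fun l => by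
    by_cases h : l = i
    · subst h; simp [hij]
    · by_cases h' : l = j <;> simp [h, h', hp.expect_const, hij.symm]
  have hprod := expect_iid_prod (ι := ι) (p := p)
    fun l x => (if l = i then f x else 1) * (if l = j then g x else 1)
  simp only [hfactor, Finset.prod_mul_distrib] at hprod
  simpa using hprod

lemma IsProb.expect_iid_sum (hp : IsProb p) (f : α → ℝ) :
    expect (iid ι p) (fun s => ∑ i, f (s i)) = Fintype.card ι * expect p f := by
  rw [expect_sum]
  simp [hp.expect_iid_eval]

lemma IsProb.expect_sub_sq (hp : IsProb p) (f : α → ℝ) (c : ℝ) :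
    expect p (fun x => (f x - c) ^ 2) =
      expect p (fun x => f x ^ 2) - 2 * c * expect p f + c ^ 2 := by
  simp only [sub_sq', expect_add, expect_sub, expect_const_mul, expect_mul_const,
    hp.expect_const]
  ring

lemma IsProb.expect_iid_sum_sub_sq_le (hp : IsProb p) (f : α → ℝ) :
    expect (iid ι p) (fun s => (∑ i, f (s i) - Fintype.card ι * expect p f) ^ 2) ≤
      Fintype.card ι * expect p (fun x => f x ^ 2) := by
  set e := expect p f with he
  have hsq : ∀ s : ι → α, (∑ i, f (s i) - Fintype.card ι * e) ^ 2 =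
      ∑ i, ∑ j, (f (s i) - e) * (f (s j) - e) := fun s => by
    rw [← Finset.sum_mul_sum, ← sq, Finset.sum_sub_distrib]
    simp
  have hcentred : expect p (fun x => f x - e) = 0 := by
    rw [expect_sub, hp.expect_const, he, sub_self]
  have hcov : ∀ i j : ι, expect (iid ι p) (fun s => (f (s i) - e) * (f (s j) - e)) =
      if i = j then expect p (fun x => (f x - e) ^ 2) else 0 := fun i j => by
    split_ifs with h
    · subst h
      rw [← hp.expect_iid_eval i]
      simp only [sq]
    · rw [hp.expect_iid_eval_mul h (fun x => f x - e) (fun x => f x - e), hcentred, zero_mul]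
  simp only [hsq, expect_sum, hcov, Finset.sum_ite_eq, Finset.mem_univ, if_true, Finset.sum_const,
    Finset.card_univ, nsmul_eq_mul, hp.expect_sub_sq, ← he]
  exact mul_le_mul_of_nonneg_left (by nlinarith [sq_nonneg e]) (Nat.cast_nonneg _)

lemma IsProb.expect_iid_sum_sq_le (hp : IsProb p) (f : α → ℝ) :
    expect (iid ι p) (fun s => (∑ i, f (s i)) ^ 2) ≤
      Fintype.card ι * expect p (fun x => f x ^ 2) + (Fintype.card ι * expect p f) ^ 2 := by
  have hvar := hp.expect_iid_sum_sub_sq_le (ι := ι) f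
  rw [hp.iid.expect_sub_sq, hp.expect_iid_sum] at hvar
  linarith

end Iid

/-! ### Mutual information -/

section MutualInfo

variable {α γ : Type*}

/-- The first marginal of a weight on a product. -/
def margA [Fintype γ] (p : α × γ → ℝ) (a : α) : ℝ := ∑ c, p (a, c)

/-- The second marginal of a weight on a product. -/
def margC [Fintype α] (p : α × γ → ℝ) (c : γ) : ℝ := ∑ a, p (a, c)

variable [Fintype α] [Fintype γ]

/-- The product of the two marginals of a weight; the counterpart of `marginalProduct` for real
weights. -/
def margProd (p : α × γ → ℝ) : α × γ → ℝ := prodWeight (margA p) (margC p)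

/-- The mutual information of a weight on a product. -/
def mutualInfo (p : α × γ → ℝ) : ℝ := ∑ x, p x * Real.log (p x / margProd p x)

/-- The contribution `x log (x / y) - x + y` to a divergence `D(P‖Q)`: unlike `x log (x / y)` it is
nonnegative, and for probability weights the correction `y - x` sums to zero. -/
def klTerm (x y : ℝ) : ℝ := x * Real.log (x / y) - x + y

lemma klTerm_eq_mul_klFun (x : ℝ) {y : ℝ} (hy : y ≠ 0) :
    klTerm x y = y * InformationTheory.klFun (x / y) := by
  rw [klTerm, InformationTheory.klFun]
  field_simp
  ring

lemma klTerm_nonneg {x y : ℝ} (hx : 0 ≤ x) (hy : 0 ≤ y) (h : y = 0 → x = 0) :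
    0 ≤ klTerm x y := by
  rcases hy.eq_or_lt with rfl | hy
  · simp [klTerm, h rfl]
  · rw [klTerm_eq_mul_klFun x hy.ne']
    exact mul_nonneg hy.le (InformationTheory.klFun_nonneg (by positivity))

lemma eq_of_klTerm_eq_zero {x y : ℝ} (hx : 0 ≤ x) (hy : 0 ≤ y) (h : y = 0 → x = 0)
    (h0 : klTerm x y = 0) : x = y := by
  rcases hy.eq_or_lt with rfl | hy
  · exact h rfl
  · rw [klTerm_eq_mul_klFun x hy.ne', mul_eq_zero, or_iff_right hy.ne',
      InformationTheory.klFun_eq_zero_iff (by positivity)] at h0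
    exact eq_of_div_eq_one h0

variable {p : α × γ → ℝ}

protected lemma IsProb.margA (hp : IsProb p) : IsProb (margA p) where
  nonneg _ := Finset.sum_nonneg fun _ _ => hp.nonneg _
  sum_eq := (Fintype.sum_prod_type p).symm.trans hp.sum_eq

protected lemma IsProb.margC (hp : IsProb p) : IsProb (margC p) where
  nonneg _ := Finset.sum_nonneg fun _ _ => hp.nonneg _
  sum_eq := (Fintype.sum_prod_type_right p).symm.trans hp.sum_eq

protected lemma IsProb.margProd (hp : IsProb p) : IsProb (margProd p) :=
  hp.margA.prodWeight hp.margC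

lemma IsProb.le_margA (hp : IsProb p) (x : α × γ) : p x ≤ margA p x.1 :=
  Finset.single_le_sum (f := fun c => p (x.1, c)) (fun _ _ => hp.nonneg _) (Finset.mem_univ x.2)

lemma IsProb.le_margC (hp : IsProb p) (x : α × γ) : p x ≤ margC p x.2 :=
  Finset.single_le_sum (f := fun a => p (a, x.2)) (fun _ _ => hp.nonneg _) (Finset.mem_univ x.1)

lemma IsProb.eq_zero_of_margProd_eq_zero (hp : IsProb p) {x : α × γ} (h : margProd p x = 0) :
    p x = 0 := by
  refine le_antisymm ?_ (hp.nonneg x)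
  rcases mul_eq_zero.1 h with h | h
  · exact h ▸ hp.le_margA x
  · exact h ▸ hp.le_margC x

lemma IsProb.mutualInfo_eq_sum_klTerm (hp : IsProb p) :
    mutualInfo p = ∑ x, klTerm (p x) (margProd p x) := by
  simp only [klTerm, Finset.sum_add_distrib, Finset.sum_sub_distrib, hp.sum_eq, hp.margProd.sum_eq,
    mutualInfo, sub_add_cancel]

lemma IsProb.eq_margProd_of_mutualInfo_eq_zero (hp : IsProb p) (h : mutualInfo p = 0) (x : α × γ) :
    p x = margProd p x := by
  rw [hp.mutualInfo_eq_sum_klTerm, Finset.sum_eq_zero_iff_of_nonneg fun x _ =>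
    klTerm_nonneg (hp.nonneg x) (hp.margProd.nonneg x) hp.eq_zero_of_margProd_eq_zero] at h
  exact eq_of_klTerm_eq_zero (hp.nonneg x) (hp.margProd.nonneg x) hp.eq_zero_of_margProd_eq_zero
    (h x (Finset.mem_univ x))

lemma mutualInfo_eq_zero (h : ∀ x, p x = margProd p x) : mutualInfo p = 0 := by
  refine Finset.sum_eq_zero fun x _ => ?_
  rw [← h x]
  rcases eq_or_ne (p x) 0 with h | h <;> simp [h]

lemma IsProb.sum_negMulLog_le_log_card {Ω : Type*} [Fintype Ω] {w : Ω → ℝ} (hw : IsProb w) :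
    ∑ ω, Real.negMulLog (w ω) ≤ Real.log (Fintype.card Ω) := by
  have hΩ : Nonempty Ω := by
    by_contra h
    rw [not_nonempty_iff] at h
    simpa using hw.sum_eq
  have hcard : (0 : ℝ) < Fintype.card Ω := by exact_mod_cast Fintype.card_pos
  have hjensen := Real.concaveOn_negMulLog.le_map_sum (t := Finset.univ)
    (w := fun _ : Ω => 1 / (Fintype.card Ω : ℝ)) (p := w) (fun _ _ => by positivity)
    (by simp [hcard.ne']) fun ω _ => hw.nonneg ω
  simp only [smul_eq_mul, ← Finset.mul_sum, hw.sum_eq, mul_one] at hjensen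
  rw [Real.negMulLog, one_div, Real.log_inv, neg_mul_neg] at hjensen
  exact le_of_mul_le_mul_left hjensen (by positivity)

lemma IsProb.mutualInfo_le_log_card (hp : IsProb p) : mutualInfo p ≤ Real.log (Fintype.card γ) := by
  refine le_trans ?_ hp.margC.sum_negMulLog_le_log_card
  have hterm : ∀ x, p x * Real.log (p x / margProd p x) ≤ p x * -Real.log (margC p x.2) := by
    intro x
    rcases (hp.nonneg x).eq_or_lt with hx | hx
    · simp [← hx]
    have hA := hx.trans_le (hp.le_margA x)
    have hC := hx.trans_le (hp.le_margC x)
    rw [← Real.log_inv]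
    gcongr
    · exact div_pos hx (mul_pos hA hC)
    · rw [margProd, prodWeight, div_mul_eq_div_div, div_eq_mul_inv _ (margC p x.2)]
      exact mul_le_of_le_one_left (by positivity) (div_le_one_of_le₀ (hp.le_margA x) hA.le)
  calc mutualInfo p ≤ ∑ x, p x * -Real.log (margC p x.2) := Finset.sum_le_sum fun x _ => hterm x
    _ = ∑ c, Real.negMulLog (margC p c) := by
      simp only [Fintype.sum_prod_type_right, ← Finset.sum_mul]
      simp only [Real.negMulLog, margC, neg_mul, mul_neg]

variable {α' γ' : Type*} [Fintype α'] [Fintype γ']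

lemma margProd_comp_equiv (e : α ≃ α') (e' : γ ≃ γ') (p : α' × γ' → ℝ) (x : α × γ) :
    margProd (fun x => p (e.prodCongr e' x)) x = margProd p (e.prodCongr e' x) :=
  congrArg₂ (· * ·) (e'.sum_comp fun c => p (e x.1, c)) (e.sum_comp fun a => p (a, e' x.2))

lemma mutualInfo_comp_equiv (e : α ≃ α') (e' : γ ≃ γ') (p : α' × γ' → ℝ) :
    mutualInfo (fun x => p (e.prodCongr e' x)) = mutualInfo p := by
  simp only [mutualInfo, margProd_comp_equiv]
  exact (e.prodCongr e').sum_comp fun x => p x * Real.log (p x / margProd p x)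

end MutualInfo

section Testers

lemma isProb_toReal {Ω : Type*} [Fintype Ω] (P : PMF Ω) : IsProb fun x => (P x).toReal where
  nonneg _ := ENNReal.toReal_nonneg
  sum_eq := by
    rw [← ENNReal.toReal_sum fun x _ => P.apply_ne_top x, ← tsum_fintype (L := .unconditional _),
      P.tsum_coe, ENNReal.toReal_one]

lemma IsProb.exists_pmf {Ω : Type*} [Fintype Ω] {w : Ω → ℝ} (hw : IsProb w) :
    ∃ P : PMF Ω, (fun ω => (P ω).toReal) = w := by
  refine ⟨PMF.ofFintype (fun ω => ENNReal.ofReal (w ω)) ?_, funext fun ω => ?_⟩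
  · rw [← ENNReal.ofReal_sum_of_nonneg fun x _ => hw.nonneg x, hw.sum_eq, ENNReal.ofReal_one]
  · rw [PMF.ofFintype_apply, ENNReal.toReal_ofReal (hw.nonneg ω)]

lemma marginalProduct_apply {α γ : Type} (P : PMF (α × γ)) (a : α) (c : γ) :
    marginalProduct P (a, c) = P.map Prod.fst a * P.map Prod.snd c := by
  classical
  have hinner : ∀ b, ((P.map Prod.snd).map fun c => (b, c)) (a, c) =
      if b = a then P.map Prod.snd c else 0 := by
    intro b
    rw [PMF.map_apply]
    split_ifs with h
    · simp [h, Prod.ext_iff]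
    · simp [Prod.ext_iff, Ne.symm h]
  rw [marginalProduct, PMF.bind_apply]
  simp only [hinner, mul_ite, mul_zero, tsum_ite_eq]

variable {α γ : Type} [Fintype α] [Fintype γ]

lemma marginalProduct_toReal (P : PMF (α × γ)) (x : α × γ) :
    (marginalProduct P x).toReal = margProd (fun x => (P x).toReal) x := by
  classical
  obtain ⟨a, c⟩ := x
  have hfst : P.map Prod.fst a = ∑ c, P (a, c) := by
    rw [PMF.map_apply, tsum_fintype, Fintype.sum_prod_type_right]
    simp
  have hsnd : P.map Prod.snd c = ∑ a, P (a, c) := by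
    rw [PMF.map_apply, tsum_fintype, Fintype.sum_prod_type]
    simp
  rw [marginalProduct_apply, hfst, hsnd, ENNReal.toReal_mul,
    ENNReal.toReal_sum fun _ _ => P.apply_ne_top _, ENNReal.toReal_sum fun _ _ => P.apply_ne_top _]
  rfl

lemma klDivergence_marginalProduct (P : PMF (α × γ)) :
    klDivergence P (marginalProduct P) = mutualInfo fun x => (P x).toReal := by
  simp only [klDivergence, mutualInfo, marginalProduct_toReal]

lemma outputProb_pure_decide {Ω ι : Type} [Fintype Ω] [Fintype ι] [DecidableEq ι]
    {N : ℕ} (e : ι ≃ Fin N) (P : PMF Ω) (A : (ι → Ω) → Prop) [DecidablePred A] (b : Bool) :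
    outputProb P (fun s => PMF.pure (decide (A (s ∘ e)))) b =
      prob (iid ι fun x => (P x).toReal) fun s => decide (A s) = b := by
  rw [outputProb, prob, ← expect_comp_equiv (e.arrowCongr (Equiv.refl Ω)).symm]
  refine Finset.sum_congr rfl fun s _ => ?_
  have hs : (e.arrowCongr (Equiv.refl Ω)).symm s = s ∘ e := rfl
  congr 1
  · exact (e.prod_comp fun i => (P (s i)).toReal).symm
  · beta_reduce
    rw [hs, PMF.pure_apply]
    rcases eq_or_ne b (decide (A (s ∘ e))) with hb | hb
    · rw [if_pos hb, if_pos hb.symm, ENNReal.toReal_one]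
    · rw [if_neg hb, if_neg hb.symm, ENNReal.toReal_zero]

lemma mitestable_card {dA dC : ℕ} {ε : ℝ} (ι : Type) [Fintype ι] [DecidableEq ι]
    (A : (ι → Fin dA × Fin dC) → Prop)
    (hindep : ∀ p : Fin dA × Fin dC → ℝ, IsProb p → (∀ x, p x = margProd p x) →
      2 / 3 ≤ prob (iid ι p) A)
    (hdep : ∀ p : Fin dA × Fin dC → ℝ, IsProb p → ε ≤ mutualInfo p →
      prob (iid ι p) A ≤ 1 / 3) :
    MITestable ε dA dC (Fintype.card ι) := by
  classical
  refine ⟨fun s => PMF.pure (decide (A (s ∘ Fintype.equivFin ι))), fun P => ?_⟩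
  have hp := isProb_toReal P
  rw [klDivergence_marginalProduct, outputProb_pure_decide, outputProb_pure_decide]
  simp only [decide_eq_true_eq, decide_eq_false_iff_not]
  refine ⟨fun h => hindep _ hp (hp.eq_margProd_of_mutualInfo_eq_zero h), fun h => ?_⟩
  linarith [hdep _ hp h, hp.iid.prob_not A]

lemma outputProb_true {Ω : Type} [Fintype Ω] {N : ℕ} (P : PMF Ω) (T : Tester Ω N) :
    outputProb P T true =
      expect (iid (Fin N) fun x => (P x).toReal) fun s => (T s true).toReal := rfl

lemma outputProb_false {Ω : Type} [Fintype Ω] {N : ℕ} (P : PMF Ω) (T : Tester Ω N) :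
    outputProb P T false = 1 - outputProb P T true := by
  rw [outputProb_true, ← (isProb_toReal P).iid.expect_const (Ω := Fin N → Ω) 1, ← expect_sub]
  refine Finset.sum_congr rfl fun s _ => congrArg _ ?_
  have hsum := (isProb_toReal (T s)).sum_eq
  rw [Fintype.sum_bool] at hsum
  linarith

lemma MITestable.exists_test {dA dC N : ℕ} {ε : ℝ} (h : MITestable ε dA dC N)
    (e : α ≃ Fin dA) (e' : γ ≃ Fin dC) :
    ∃ β : (Fin N → α × γ) → ℝ, (∀ s, 0 ≤ β s) ∧ (∀ s, β s ≤ 1) ∧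
      ∀ p : α × γ → ℝ, IsProb p →
        ((∀ x, p x = margProd p x) → 2 / 3 ≤ expect (iid (Fin N) p) β) ∧
        (ε ≤ mutualInfo p → expect (iid (Fin N) p) β ≤ 1 / 3) := by
  obtain ⟨T, hT⟩ := h
  refine ⟨fun s => (T (fun t => e.prodCongr e' (s t)) true).toReal,
    fun s => ENNReal.toReal_nonneg, fun s => (isProb_toReal (T _)).le_one true, fun p hp => ?_⟩
  obtain ⟨P, hP⟩ := (hp.comp_equiv (e.prodCongr e').symm).exists_pmf
  have hpP : p = fun x => (P (e.prodCongr e' x)).toReal := by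
    funext x
    exact (congrArg p ((e.prodCongr e').symm_apply_apply x).symm).trans (congrFun hP _).symm
  have hout : expect (iid (Fin N) p) (fun s => (T (fun t => e.prodCongr e' (s t)) true).toReal) =
      outputProb P T true := by
    rw [outputProb_true, hpP]
    exact expect_comp_equiv (w' := iid (Fin N) fun x => (P x).toReal)
      ((Equiv.refl (Fin N)).arrowCongr (e.prodCongr e')) fun s => (T s true).toReal
  have hmi : mutualInfo p = klDivergence P (marginalProduct P) := by
    rw [hpP, klDivergence_marginalProduct]
    exact mutualInfo_comp_equiv e e' fun x => (P x).toReal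
  rw [hout, hmi]
  refine ⟨fun h => (hT P).1 (hmi ▸ mutualInfo_eq_zero h), fun h => ?_⟩
  linarith [(hT P).2 h, outputProb_false P T]

end Testers

/-! ### Lower bound -/

section SecondMoment

variable {Ω Ω' : Type*} [Fintype Ω] [Fintype Ω'] {w : Ω → ℝ} {q : Ω' → ℝ} {L : Ω → Ω' → ℝ}

lemma IsProb.expect_sq_expect_sub_one (hq : IsProb q) (hL : ∀ ω, expect q (L ω) = 1) :
    expect q (fun c => expect w (fun ω => L ω c - 1) ^ 2) =
      expect w (fun ω => expect w fun ω' => expect q fun c => L ω c * L ω' c) -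
        (∑ ω, w ω) ^ 2 := by
  have hsq : ∀ c, expect w (fun ω => L ω c - 1) ^ 2 =
      expect w fun ω => expect w fun ω' => (L ω c - 1) * (L ω' c - 1) := fun c => by
    simp only [expect_const_mul, expect_mul_const, sq]
  have hpair : ∀ ω ω', expect q (fun c => (L ω c - 1) * (L ω' c - 1)) =
      expect q (fun c => L ω c * L ω' c) - 1 := fun ω ω' => by
    have hexpand : (fun c => (L ω c - 1) * (L ω' c - 1)) =
        fun c => L ω c * L ω' c - L ω c - (L ω' c - 1) := funext fun c => by ring
    rw [hexpand, expect_sub, expect_sub, expect_sub, hL, hL, hq.expect_const]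
    ring
  have hmass : expect w (fun _ => expect w fun _ => (1 : ℝ)) = (∑ ω, w ω) ^ 2 := by
    simp only [expect, mul_one, sq, Finset.sum_mul]
  simp only [hsq]
  rw [expect_comm]
  simp only [expect_comm (w := q), hpair, expect_sub, hmass]

lemma IsProb.expect_abs_expect_sub_one_le_two_mul (hq : IsProb q) (hw : ∀ ω, 0 ≤ w ω)
    (hL0 : ∀ ω c, 0 ≤ L ω c) (hL : ∀ ω, expect q (L ω) = 1) :
    expect q (fun c => |expect w fun ω => L ω c - 1|) ≤ 2 * ∑ ω, w ω := by
  calc expect q (fun c => |expect w fun ω => L ω c - 1|)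
      ≤ expect q (fun c => expect w fun ω => L ω c + 1) := by
        refine expect_mono hq.nonneg fun c => (Finset.abs_sum_le_sum_abs _ _).trans
          (Finset.sum_le_sum fun ω _ => ?_)
        rw [abs_mul, abs_of_nonneg (hw ω)]
        exact mul_le_mul_of_nonneg_left (abs_le.2 (by constructor <;> linarith [hL0 ω c])) (hw ω)
    _ = 2 * ∑ ω, w ω := by
        rw [expect_comm]
        simp only [expect_add, hL, hq.expect_const]
        simp only [expect, ← Finset.sum_mul]
        ring

lemma IsProb.expect_abs_le_of_sq (hq : IsProb q) (f : Ω' → ℝ) {W : ℝ} (hW : 0 < W) :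
    expect q (fun c => |f c|) ≤ 5 / (2 * W) * expect q (fun c => f c ^ 2) + W / 10 := by
  rw [← expect_const_mul, ← hq.expect_const (W / 10), ← expect_add]
  refine expect_mono hq.nonneg fun c => ?_
  have hamgm : 5 / (2 * W) * f c ^ 2 + W / 10 - |f c| = 5 / (2 * W) * (|f c| - W / 5) ^ 2 := by
    rw [← sq_abs (f c)]
    field_simp
    ring
  rw [← sub_nonneg, hamgm]
  positivity

lemma IsProb.expect_abs_expect_sub_one_le (hq : IsProb q) (hw : ∀ ω, 0 ≤ w ω)
    (hL0 : ∀ ω c, 0 ≤ L ω c) (hL : ∀ ω, expect q (L ω) = 1) {V : ℝ}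
    (h : V ≤ 1 → expect w (fun ω => expect w fun ω' => expect q fun c => L ω c * L ω' c) ≤
      (∑ ω, w ω) ^ 2 * (1 + 2 * V)) :
    expect q (fun c => |expect w fun ω => L ω c - 1|) ≤ (∑ ω, w ω) * (1 / 10 + 5 * V) := by
  have htriv := hq.expect_abs_expect_sub_one_le_two_mul hw hL0 hL
  have hsecond := hq.expect_sq_expect_sub_one (w := w) hL
  have hW : 0 ≤ ∑ ω, w ω := Finset.sum_nonneg fun ω _ => hw ω
  set W := ∑ ω, w ω
  rcases hW.eq_or_lt with hW0 | hWpos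
  · rw [← hW0] at htriv ⊢
    linarith
  rcases le_or_gt V 1 with hV1 | hV1
  · calc expect q (fun c => |expect w fun ω => L ω c - 1|)
        ≤ 5 / (2 * W) * (2 * W ^ 2 * V) + W / 10 :=
          (hq.expect_abs_le_of_sq _ hWpos).trans (by gcongr; linarith [h hV1])
      _ = W * (1 / 10 + 5 * V) := by field_simp; ring
  · nlinarith

lemma prod_one_add_le_one_add_two_mul_sum {ι : Type*} (t : Finset ι) {v : ι → ℝ}
    (hv : ∀ i ∈ t, 0 ≤ v i) (h : ∑ i ∈ t, v i ≤ 1) :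
    ∏ i ∈ t, (1 + v i) ≤ 1 + 2 * ∑ i ∈ t, v i := by
  have hV : 0 ≤ ∑ i ∈ t, v i := Finset.sum_nonneg hv
  have hexp := (abs_le.1 (Real.abs_exp_sub_one_sub_id_le ((abs_of_nonneg hV).trans_le h))).2
  have hprod : ∏ i ∈ t, (1 + v i) ≤ Real.exp (∑ i ∈ t, v i) := by
    rw [Real.exp_sum]
    exact Finset.prod_le_prod (fun i hi => by linarith [hv i hi])
      fun i _ => by linarith [Real.add_one_le_exp (v i)]
  nlinarith

end SecondMoment

section RowSequences

lemma natCast_mul_sub_one_nonneg (s : ℕ) : (0 : ℝ) ≤ s * (s - 1) := by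
  rcases Nat.eq_zero_or_pos s with rfl | h
  · simp
  · exact mul_nonneg (Nat.cast_nonneg _) (sub_nonneg.2 (by exact_mod_cast h))

variable {ρ Θ γ : Type*} {N : ℕ}

section Counts

variable [DecidableEq ρ]

/-- The number of occurrences of the row `r` in a sequence of rows. The row `none` is not counted:
it is the reference row, whose law does not depend on any parameter. -/
def rowCount (a : Fin N → Option ρ) (r : ρ) : ℕ := (Finset.univ.filter fun t => a t = some r).card

lemma prod_elim_one_eq_prod_pow_rowCount [Fintype ρ] (a : Fin N → Option ρ) (g : ρ → ℝ) :
    ∏ t, (a t).elim 1 g = ∏ r, g r ^ rowCount a r := by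
  rw [← Finset.prod_fiberwise' Finset.univ a fun b => b.elim 1 g, Fintype.prod_option]
  simp [rowCount]

variable [Fintype ρ]

lemma IsProb.expect_rowCount_mul_sub_one_le {p : Option ρ → ℝ} (hp : IsProb p) (r : ρ) :
    expect (iid (Fin N) p) (fun a => (rowCount a r : ℝ) * (rowCount a r - 1)) ≤
      N ^ 2 * p (some r) ^ 2 := by
  let f : Option ρ → ℝ := fun b => if b = some r then 1 else 0
  have hcount : ∀ a : Fin N → Option ρ, (rowCount a r : ℝ) = ∑ t, f (a t) := fun a => by
    simp [rowCount, f]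
  have hf : expect p f = p (some r) := by simp [expect, f]
  have hf2 : expect p (fun b => f b ^ 2) = p (some r) := by simp [expect, f]
  have hsq := hp.expect_iid_sum_sq_le (ι := Fin N) f
  have hmean := hp.expect_iid_sum (ι := Fin N) f
  rw [hf2, hf, Fintype.card_fin] at hsq
  rw [hf, Fintype.card_fin] at hmean
  simp only [hcount, mul_sub, mul_one, ← sq, expect_sub, hmean]
  linarith

lemma expect_iid_rowCount_mul_sub_one_le {ν : Option ρ → ℝ} (hν : ∀ b, 0 ≤ ν b)
    (h1 : 1 ≤ ∑ b, ν b) (r : ρ) :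
    expect (iid (Fin N) ν) (fun a => (rowCount a r : ℝ) * (rowCount a r - 1)) ≤
      N ^ 2 * ν (some r) ^ 2 * (∑ b, ν b) ^ N := by
  set S := ∑ b, ν b
  have hS0 : 0 < S := by linarith
  have hp : IsProb fun b => ν b / S := ⟨fun b => div_nonneg (hν b) hS0.le, by
    rw [← Finset.sum_div, div_self hS0.ne']⟩
  have hscale : ∀ f, expect (iid (Fin N) ν) f = S ^ N * expect (iid (Fin N) fun b => ν b / S) f :=
    fun f => by
      rw [← expect_const_mul, expect, expect]
      refine Finset.sum_congr rfl fun a _ => ?_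
      simp only [iid, Finset.prod_div_distrib, Finset.prod_const, Finset.card_univ,
        Fintype.card_fin]
      field_simp
  have hle : (ν (some r) / S) ^ 2 ≤ ν (some r) ^ 2 :=
    pow_le_pow_left₀ (div_nonneg (hν _) hS0.le) (div_le_self (hν _) h1) 2
  rw [hscale, mul_comm]
  gcongr
  exact (hp.expect_rowCount_mul_sub_one_le r).trans (by gcongr)

end Counts

/-- Unnormalised row masses: the reference row has mass one, the mass of any other row is a function
of its parameter. -/
def rowMass (μ : Θ → ℝ) (ϑ : ρ → Θ) (b : Option ρ) : ℝ := b.elim 1 fun r => μ (ϑ r)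

/-- Densities of the rows with respect to a reference law on the columns: one in the reference row,
a function of the parameter in any other row. -/
def rowDens (κ : Θ → γ → ℝ) (ϑ : ρ → Θ) (b : Option ρ) (c : γ) : ℝ := b.elim 1 fun r => κ (ϑ r) c

/-- The weight that a row seen `s` times gives to its parameter. -/
def rowWeight (ω μ : Θ → ℝ) (s : ℕ) (x : Θ) : ℝ := ω x * μ x ^ s

lemma rowMass_nonneg {μ : Θ → ℝ} (hμ : ∀ x, 0 ≤ μ x) (ϑ : ρ → Θ) (b : Option ρ) :
    0 ≤ rowMass μ ϑ b := by
  cases b with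
  | none => exact zero_le_one
  | some r => exact hμ _

lemma rowDens_nonneg {κ : Θ → γ → ℝ} (hκ : ∀ x c, 0 ≤ κ x c) (ϑ : ρ → Θ) (b : Option ρ) (c : γ) :
    0 ≤ rowDens κ ϑ b c := by
  cases b with
  | none => exact zero_le_one
  | some r => exact hκ _ c

lemma rowWeight_nonneg {ω μ : Θ → ℝ} (hω : ∀ x, 0 ≤ ω x) (hμ : ∀ x, 0 ≤ μ x) (s : ℕ) (x : Θ) :
    0 ≤ rowWeight ω μ s x :=
  mul_nonneg (hω x) (pow_nonneg (hμ x) s)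

/-- The likelihood ratio of the columns `c` in the rows `a`. -/
def likelihood (κ : Θ → γ → ℝ) (a : Fin N → Option ρ) (ϑ : ρ → Θ) (c : Fin N → γ) : ℝ :=
  ∏ t, rowDens κ ϑ (a t) (c t)

section Likelihood

lemma likelihood_nonneg {κ : Θ → γ → ℝ} (hκ : ∀ x c, 0 ≤ κ x c) (a : Fin N → Option ρ) (ϑ : ρ → Θ)
    (c : Fin N → γ) : 0 ≤ likelihood κ a ϑ c :=
  Finset.prod_nonneg fun _ _ => rowDens_nonneg hκ ϑ _ _

variable [Fintype γ] {κ : Θ → γ → ℝ} {q : γ → ℝ}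

lemma IsProb.expect_rowDens (hq : IsProb q)
    (hκ : ∀ x, expect q (κ x) = 1) (ϑ : ρ → Θ) (b : Option ρ) : expect q (rowDens κ ϑ b) = 1 := by
  cases b with
  | none => exact hq.expect_const 1
  | some r => exact hκ _

lemma IsProb.expect_likelihood (hq : IsProb q) (hκ : ∀ x, expect q (κ x) = 1)
    (a : Fin N → Option ρ) (ϑ : ρ → Θ) : expect (iid (Fin N) q) (likelihood κ a ϑ) = 1 := by
  refine (expect_iid_prod fun t => rowDens κ ϑ (a t)).trans ?_
  simp [hq.expect_rowDens hκ]

lemma IsProb.expect_likelihood_mul [Fintype ρ] [DecidableEq ρ] (hq : IsProb q)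
    (a : Fin N → Option ρ) (ϑ ϑ' : ρ → Θ) :
    expect (iid (Fin N) q) (fun c => likelihood κ a ϑ c * likelihood κ a ϑ' c) =
      ∏ r, (expect q fun c => κ (ϑ r) c * κ (ϑ' r) c) ^ rowCount a r := by
  simp only [likelihood, ← Finset.prod_mul_distrib]
  rw [expect_iid_prod fun t c => rowDens κ ϑ (a t) c * rowDens κ ϑ' (a t) c,
    ← prod_elim_one_eq_prod_pow_rowCount]
  refine Finset.prod_congr rfl fun t _ => ?_
  cases a t with
  | none => simpa [rowDens] using hq.expect_const 1
  | some r => rfl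

end Likelihood

variable [Fintype ρ]

lemma sum_rowMass (μ : Θ → ℝ) (ϑ : ρ → Θ) : ∑ b, rowMass μ ϑ b = 1 + ∑ r, μ (ϑ r) :=
  Fintype.sum_option _

/-- The joint weight of independent parameters of the rows and of a sequence of rows. -/
def seqWeight (ω μ : Θ → ℝ) (a : Fin N → Option ρ) (ϑ : ρ → Θ) : ℝ :=
  iid ρ ω ϑ * iid (Fin N) (rowMass μ ϑ) a

/-- The weight of the parameters of the rows in `seqWeight`, for sequences of length `N`. -/
def paramWeight (N : ℕ) (ω μ : Θ → ℝ) (ϑ : ρ → Θ) : ℝ := iid ρ ω ϑ * (1 + ∑ r, μ (ϑ r)) ^ N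

lemma seqWeight_nonneg {ω μ : Θ → ℝ} (hω : ∀ x, 0 ≤ ω x) (hμ : ∀ x, 0 ≤ μ x)
    (a : Fin N → Option ρ) (ϑ : ρ → Θ) : 0 ≤ seqWeight ω μ a ϑ :=
  mul_nonneg (Finset.prod_nonneg fun _ _ => hω _)
    (Finset.prod_nonneg fun _ _ => rowMass_nonneg hμ ϑ _)

lemma paramWeight_nonneg {ω μ : Θ → ℝ} (hω : ∀ x, 0 ≤ ω x) (hμ : ∀ x, 0 ≤ μ x) (ϑ : ρ → Θ) :
    0 ≤ paramWeight N ω μ ϑ :=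
  mul_nonneg (Finset.prod_nonneg fun _ _ => hω _)
    (pow_nonneg (add_nonneg zero_le_one (Finset.sum_nonneg fun _ _ => hμ _)) N)

lemma sum_seqWeight (ω μ : Θ → ℝ) (ϑ : ρ → Θ) :
    ∑ a : Fin N → Option ρ, seqWeight ω μ a ϑ = paramWeight N ω μ ϑ := by
  simp only [seqWeight, paramWeight, ← Finset.mul_sum, iid]
  rw [← sum_rowMass, ← Fintype.piFinset_univ, ← Finset.prod_univ_sum]
  simp

variable [DecidableEq ρ]

lemma seqWeight_eq_prod_rowWeight (ω μ : Θ → ℝ) (a : Fin N → Option ρ) (ϑ : ρ → Θ) :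
    seqWeight ω μ a ϑ = ∏ r, rowWeight ω μ (rowCount a r) (ϑ r) := by
  simp only [seqWeight, iid, rowMass, rowWeight, Finset.prod_mul_distrib,
    prod_elim_one_eq_prod_pow_rowCount]

variable [Fintype Θ]

lemma expect_seqWeight_prod (ω μ : Θ → ℝ) (a : Fin N → Option ρ) (f : ρ → Θ → ℝ) :
    expect (seqWeight ω μ a) (fun ϑ => ∏ r, f r (ϑ r)) =
      ∏ r, expect (rowWeight ω μ (rowCount a r)) (f r) := by
  simp only [expect, seqWeight_eq_prod_rowWeight, ← Finset.prod_mul_distrib]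
  rw [Finset.prod_univ_sum, Fintype.piFinset_univ]

lemma sum_seqWeight_param (ω μ : Θ → ℝ) (a : Fin N → Option ρ) :
    ∑ ϑ, seqWeight ω μ a ϑ = ∏ r, ∑ x, rowWeight ω μ (rowCount a r) x := by
  simpa [expect] using expect_seqWeight_prod ω μ a fun _ _ => 1

lemma expect_seqWeight_eval_mul (ω μ ζ : Θ → ℝ) (a : Fin N → Option ρ) (r : ρ) :
    expect (seqWeight ω μ a) (fun ϑ => ζ (ϑ r)) * ∑ x, rowWeight ω μ (rowCount a r) x =
      expect (rowWeight ω μ (rowCount a r)) ζ * ∑ ϑ, seqWeight ω μ a ϑ := by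
  have hfactor : ∀ r', expect (rowWeight ω μ (rowCount a r')) (fun x => if r' = r then ζ x else 1) =
      if r' = r then expect (rowWeight ω μ (rowCount a r)) ζ
        else ∑ x, rowWeight ω μ (rowCount a r') x := fun r' => by
    split_ifs with h
    · rw [h]
    · simp [expect]
  have hprod := expect_seqWeight_prod ω μ a fun r' x => if r' = r then ζ x else 1
  simp only [hfactor, Finset.prod_ite_eq', Finset.mem_univ, if_true] at hprod
  rw [hprod, sum_seqWeight_param, ← Finset.mul_prod_erase _ _ (Finset.mem_univ r),
    ← Finset.mul_prod_erase _ _ (Finset.mem_univ r), if_pos rfl,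
    Finset.prod_congr rfl fun r' hr' => if_neg (Finset.ne_of_mem_erase hr')]
  ring

variable [Fintype γ] {ω μ ζ : Θ → ℝ} {κ : Θ → γ → ℝ} {q : γ → ℝ}

/-- The second moment of the likelihood ratio that a row seen `s` times contributes. -/
def rowMoment (ω μ : Θ → ℝ) (κ : Θ → γ → ℝ) (q : γ → ℝ) (s : ℕ) : ℝ :=
  expect (rowWeight ω μ s) fun x => expect (rowWeight ω μ s) fun y =>
    (expect q fun c => κ x c * κ y c) ^ s

lemma IsProb.expect_seqWeight_likelihood_mul (hq : IsProb q) (a : Fin N → Option ρ) :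
    expect (seqWeight ω μ a) (fun ϑ => expect (seqWeight ω μ a) fun ϑ' =>
      expect (iid (Fin N) q) fun c => likelihood κ a ϑ c * likelihood κ a ϑ' c) =
        ∏ r, rowMoment ω μ κ q (rowCount a r) := by
  simp only [hq.expect_likelihood_mul]
  have hinner : ∀ ϑ : ρ → Θ, expect (seqWeight ω μ a)
      (fun ϑ' => ∏ r, (expect q fun c => κ (ϑ r) c * κ (ϑ' r) c) ^ rowCount a r) =
      ∏ r, expect (rowWeight ω μ (rowCount a r))
        fun y => (expect q fun c => κ (ϑ r) c * κ y c) ^ rowCount a r := fun ϑ =>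
    expect_seqWeight_prod ω μ a fun r y => (expect q fun c => κ (ϑ r) c * κ y c) ^ rowCount a r
  simp only [hinner]
  exact expect_seqWeight_prod ω μ a fun r x => expect (rowWeight ω μ (rowCount a r))
    fun y => (expect q fun c => κ x c * κ y c) ^ rowCount a r

lemma rowMoment_nonneg (hq : ∀ c, 0 ≤ q c) (hω : ∀ x, 0 ≤ ω x) (hμ : ∀ x, 0 ≤ μ x)
    (hκ : ∀ x c, 0 ≤ κ x c) (s : ℕ) : 0 ≤ rowMoment ω μ κ q s :=
  expect_nonneg (rowWeight_nonneg hω hμ s) fun x => expect_nonneg (rowWeight_nonneg hω hμ s)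
    fun y => pow_nonneg (expect_nonneg hq fun c => mul_nonneg (hκ x c) (hκ y c)) s

lemma expect_abs_likelihood_sub_one_le (hq : IsProb q) (hκ : ∀ x, expect q (κ x) = 1)
    (hκ0 : ∀ x c, 0 ≤ κ x c) (hω : ∀ x, 0 ≤ ω x) (hμ : ∀ x, 0 ≤ μ x) {v : ℕ → ℝ}
    (hv : ∀ s, 0 ≤ v s)
    (h : ∀ s, rowMoment ω μ κ q s ≤ (∑ x, rowWeight ω μ s x) ^ 2 * (1 + v s))
    (a : Fin N → Option ρ) :
    expect (iid (Fin N) q) (fun c => |expect (seqWeight ω μ a) fun ϑ => likelihood κ a ϑ c - 1|) ≤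
      (∑ ϑ, seqWeight ω μ a ϑ) * (1 / 10 + 5 * ∑ r, v (rowCount a r)) := by
  refine hq.iid.expect_abs_expect_sub_one_le (seqWeight_nonneg hω hμ a)
    (likelihood_nonneg hκ0 a) (hq.expect_likelihood hκ a) fun hV => ?_
  rw [hq.expect_seqWeight_likelihood_mul]
  calc ∏ r, rowMoment ω μ κ q (rowCount a r)
      ≤ ∏ r, ((∑ x, rowWeight ω μ (rowCount a r) x) ^ 2 * (1 + v (rowCount a r))) :=
        Finset.prod_le_prod (fun r _ => rowMoment_nonneg hq.nonneg hω hμ hκ0 _) fun r _ => h _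
    _ = (∑ ϑ, seqWeight ω μ a ϑ) ^ 2 * ∏ r, (1 + v (rowCount a r)) := by
        rw [Finset.prod_mul_distrib, Finset.prod_pow, sum_seqWeight_param]
    _ ≤ (∑ ϑ, seqWeight ω μ a ϑ) ^ 2 * (1 + 2 * ∑ r, v (rowCount a r)) := by
        gcongr
        exact prod_one_add_le_one_add_two_mul_sum _ (fun r _ => hv _) hV

/-- A bound on the excess over one of the normalised second moment of a row seen `s` times: it grows
with the number of pairs of occurrences and with the conditional expectation of `ζ`. -/
def rowExcess (ω μ ζ : Θ → ℝ) (B : ℝ) (s : ℕ) : ℝ :=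
  B * ((s : ℝ) * (s - 1)) * expect (rowWeight ω μ s) ζ / ∑ x, rowWeight ω μ s x

lemma rowExcess_nonneg (hω : ∀ x, 0 ≤ ω x) (hμ : ∀ x, 0 ≤ μ x) (hζ : ∀ x, 0 ≤ ζ x) {B : ℝ}
    (hB : 0 ≤ B) (s : ℕ) : 0 ≤ rowExcess ω μ ζ B s :=
  div_nonneg (mul_nonneg (mul_nonneg hB (natCast_mul_sub_one_nonneg s))
    (expect_nonneg (rowWeight_nonneg hω hμ s) hζ))
    (Finset.sum_nonneg fun x _ => rowWeight_nonneg hω hμ s x)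

lemma le_mul_one_add_rowExcess {B M : ℝ} {s : ℕ}
    (h : M ≤ (∑ x, rowWeight ω μ s x) * (∑ x, rowWeight ω μ s x +
      B * ((s : ℝ) * (s - 1)) * expect (rowWeight ω μ s) ζ)) :
    M ≤ (∑ x, rowWeight ω μ s x) ^ 2 * (1 + rowExcess ω μ ζ B s) := by
  refine h.trans_eq ?_
  rcases eq_or_ne (∑ x, rowWeight ω μ s x) 0 with h0 | h0
  · simp [h0]
  · rw [rowExcess]
    field_simp

lemma sum_seqWeight_mul_rowExcess_le (hω : ∀ x, 0 ≤ ω x) (hμ : ∀ x, 0 ≤ μ x) (hζ : ∀ x, 0 ≤ ζ x)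
    {B : ℝ} (hB : 0 ≤ B) (a : Fin N → Option ρ) (r : ρ) :
    (∑ ϑ, seqWeight ω μ a ϑ) * rowExcess ω μ ζ B (rowCount a r) ≤
      B * (expect (seqWeight ω μ a) (fun ϑ => ζ (ϑ r)) *
        ((rowCount a r : ℝ) * (rowCount a r - 1))) := by
  have hE : 0 ≤ expect (seqWeight ω μ a) fun ϑ => ζ (ϑ r) :=
    expect_nonneg (seqWeight_nonneg hω hμ a) fun ϑ => hζ _
  have hpairs := natCast_mul_sub_one_nonneg (rowCount a r)
  rcases eq_or_ne (∑ x, rowWeight ω μ (rowCount a r) x) 0 with h0 | h0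
  · rw [rowExcess, h0, div_zero, mul_zero]
    positivity
  · rw [rowExcess, mul_div_assoc', mul_left_comm, mul_comm (∑ ϑ, seqWeight ω μ a ϑ),
      ← expect_seqWeight_eval_mul]
    field_simp
    exact le_rfl

lemma sum_expect_seqWeight_mul_rowCount_le (hω : ∀ x, 0 ≤ ω x) (hμ : ∀ x, 0 ≤ μ x)
    (hζ : ∀ x, 0 ≤ ζ x) {l : ℝ} (hl : ∀ x, ζ x * μ x ^ 2 ≤ l ^ 2) (r : ρ) :
    ∑ a : Fin N → Option ρ, expect (seqWeight ω μ a) (fun ϑ => ζ (ϑ r)) *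
        ((rowCount a r : ℝ) * (rowCount a r - 1)) ≤
      N ^ 2 * l ^ 2 * ∑ ϑ : ρ → Θ, paramWeight N ω μ ϑ := by
  simp only [expect, Finset.sum_mul, Finset.mul_sum]
  rw [Finset.sum_comm]
  refine Finset.sum_le_sum fun ϑ _ => ?_
  have hiid : 0 ≤ iid ρ ω ϑ := Finset.prod_nonneg fun _ _ => hω _
  have hcount := expect_iid_rowCount_mul_sub_one_le (N := N) (rowMass_nonneg hμ ϑ)
    (by rw [sum_rowMass]; linarith [Finset.sum_nonneg fun r (_ : r ∈ Finset.univ) => hμ (ϑ r)]) r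
  rw [sum_rowMass] at hcount
  calc ∑ a : Fin N → Option ρ, seqWeight ω μ a ϑ * ζ (ϑ r) *
        ((rowCount a r : ℝ) * (rowCount a r - 1))
      = iid ρ ω ϑ * ζ (ϑ r) * expect (iid (Fin N) (rowMass μ ϑ))
          (fun a => (rowCount a r : ℝ) * (rowCount a r - 1)) := by
        rw [← expect_const_mul, expect]
        exact Finset.sum_congr rfl fun a _ => by rw [seqWeight]; ring
    _ ≤ iid ρ ω ϑ * ζ (ϑ r) * (N ^ 2 * μ (ϑ r) ^ 2 * (1 + ∑ r, μ (ϑ r)) ^ N) :=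
        mul_le_mul_of_nonneg_left hcount (mul_nonneg hiid (hζ _))
    _ = N ^ 2 * (ζ (ϑ r) * μ (ϑ r) ^ 2) * paramWeight N ω μ ϑ := by rw [paramWeight]; ring
    _ ≤ N ^ 2 * l ^ 2 * paramWeight N ω μ ϑ := by
        gcongr
        · exact paramWeight_nonneg hω hμ ϑ
        · exact hl _

lemma sum_expect_abs_likelihood_sub_one_le (hq : IsProb q) (hκ : ∀ x, expect q (κ x) = 1)
    (hκ0 : ∀ x c, 0 ≤ κ x c) (hω : ∀ x, 0 ≤ ω x) (hμ : ∀ x, 0 ≤ μ x) (hζ : ∀ x, 0 ≤ ζ x)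
    {B l : ℝ} (hB : 0 ≤ B) (hl : ∀ x, ζ x * μ x ^ 2 ≤ l ^ 2)
    (h : ∀ s, rowMoment ω μ κ q s ≤ (∑ x, rowWeight ω μ s x) * (∑ x, rowWeight ω μ s x +
      B * ((s : ℝ) * (s - 1)) * expect (rowWeight ω μ s) ζ)) :
    ∑ a : Fin N → Option ρ, expect (iid (Fin N) q)
        (fun c => |expect (seqWeight ω μ a) fun ϑ => likelihood κ a ϑ c - 1|) ≤
      (1 / 10 + 5 * (Fintype.card ρ * (B * (N ^ 2 * l ^ 2)))) *
        ∑ ϑ : ρ → Θ, paramWeight N ω μ ϑ := by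
  set Z := ∑ ϑ : ρ → Θ, paramWeight N ω μ ϑ with hZ
  have hmass : ∑ a : Fin N → Option ρ, ∑ ϑ, seqWeight ω μ a ϑ = Z := by
    rw [Finset.sum_comm]
    simp only [sum_seqWeight, hZ]
  have hrow : ∀ r : ρ, ∑ a : Fin N → Option ρ, (∑ ϑ, seqWeight ω μ a ϑ) *
      rowExcess ω μ ζ B (rowCount a r) ≤ B * (N ^ 2 * l ^ 2) * Z := fun r => by
    refine (Finset.sum_le_sum fun a _ => sum_seqWeight_mul_rowExcess_le hω hμ hζ hB a r).trans ?_
    rw [← Finset.mul_sum, mul_assoc B]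
    exact mul_le_mul_of_nonneg_left (sum_expect_seqWeight_mul_rowCount_le hω hμ hζ hl r) hB
  calc _ ≤ ∑ a : Fin N → Option ρ, (∑ ϑ, seqWeight ω μ a ϑ) *
          (1 / 10 + 5 * ∑ r, rowExcess ω μ ζ B (rowCount a r)) :=
        Finset.sum_le_sum fun a _ => expect_abs_likelihood_sub_one_le hq hκ hκ0 hω hμ
          (rowExcess_nonneg hω hμ hζ hB) (fun s => le_mul_one_add_rowExcess (h s)) a
    _ = 1 / 10 * Z + 5 * ∑ r, ∑ a : Fin N → Option ρ, (∑ ϑ, seqWeight ω μ a ϑ) *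
          rowExcess ω μ ζ B (rowCount a r) := by
        rw [Finset.sum_comm (s := Finset.univ (α := ρ)), ← hmass, Finset.mul_sum, Finset.mul_sum,
          ← Finset.sum_add_distrib]
        refine Finset.sum_congr rfl fun a _ => ?_
        rw [← Finset.mul_sum]
        ring
    _ ≤ 1 / 10 * Z + 5 * ∑ _r : ρ, B * (N ^ 2 * l ^ 2) * Z := by
        gcongr with r
        exact hrow r
    _ = _ := by
        rw [Finset.sum_const, Finset.card_univ, nsmul_eq_mul]
        ring

end RowSequences

section RowMix

variable {α γ : Type*}

/-- The joint weight with row law `r` and with densities `D` of the rows with respect to `q`. -/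
def rowMix (r : α → ℝ) (q : γ → ℝ) (D : α → γ → ℝ) (x : α × γ) : ℝ := prodWeight r q x * D x.1 x.2

variable {r : α → ℝ} {q : γ → ℝ} {D : α → γ → ℝ}

lemma margC_rowMix [Fintype α] (c : γ) :
    margC (rowMix r q D) c = q c * expect r fun a => D a c := by
  rw [expect, Finset.mul_sum]
  exact Finset.sum_congr rfl fun a _ => by rw [rowMix, prodWeight]; ring

variable [Fintype γ]

lemma margA_rowMix {a : α} (hD : expect q (D a) = 1) : margA (rowMix r q D) a = r a := by
  rw [← mul_one (r a), ← hD, expect, Finset.mul_sum]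
  exact Finset.sum_congr rfl fun c _ => mul_assoc _ _ _

variable [Fintype α]

lemma isProb_rowMix (hr : IsProb r) (hq : ∀ c, 0 ≤ q c) (hD : ∀ a, expect q (D a) = 1)
    (hD0 : ∀ a c, 0 ≤ D a c) : IsProb (rowMix r q D) where
  nonneg x := mul_nonneg (mul_nonneg (hr.nonneg _) (hq _)) (hD0 _ _)
  sum_eq := by
    rw [Fintype.sum_prod_type, ← hr.sum_eq]
    exact Finset.sum_congr rfl fun a _ => margA_rowMix (hD a)

lemma margProd_rowMix_one (hr : IsProb r) (hq : IsProb q) (x : α × γ) :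
    margProd (rowMix r q fun _ _ => 1) x = rowMix r q (fun _ _ => 1) x := by
  rw [margProd, prodWeight, margA_rowMix (hq.expect_const 1), margC_rowMix, hr.expect_const, rowMix,
    prodWeight, mul_one, mul_one]

lemma mul_log_div_ge {d m : ℝ} (hm : 0 < m) (hd : d = 0 ∨ d = 1 ∨ d = 2) :
    Real.log 2 * (d ^ 2 - d) - (d * m - d) ≤ d * Real.log (d / m) := by
  have hlog := Real.log_le_sub_one_of_pos hm
  rcases hd with rfl | rfl | rfl
  · norm_num
  · rw [Real.log_div one_ne_zero hm.ne', Real.log_one]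
    linarith
  · rw [Real.log_div two_ne_zero hm.ne']
    linarith

lemma IsProb.rowMix_mul_log_ge (hr : IsProb r) (hq : ∀ c, 0 ≤ q c) (hD : ∀ a, expect q (D a) = 1)
    (hD2 : ∀ a c, D a c = 0 ∨ D a c = 1 ∨ D a c = 2) (x : α × γ) :
    prodWeight r q x * (Real.log 2 * (D x.1 x.2 ^ 2 - D x.1 x.2) -
        (D x.1 x.2 * expect r (fun a => D a x.2) - D x.1 x.2)) ≤
      rowMix r q D x * Real.log (rowMix r q D x / margProd (rowMix r q D) x) := by
  obtain ⟨a, c⟩ := x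
  have hD0 : ∀ a, 0 ≤ D a c := fun a => by rcases hD2 a c with h | h | h <;> norm_num [h]
  have hw : 0 ≤ prodWeight r q (a, c) := mul_nonneg (hr.nonneg a) (hq c)
  have hmarg : margProd (rowMix r q D) (a, c) =
      prodWeight r q (a, c) * expect r fun a => D a c := by
    rw [margProd, prodWeight, margA_rowMix (hD a), margC_rowMix, prodWeight, mul_assoc]
  rw [hmarg, rowMix]
  rcases hw.eq_or_lt with hw | hw
  · simp [← hw]
  rw [mul_div_mul_left _ _ hw.ne', mul_assoc]
  refine mul_le_mul_of_nonneg_left ?_ hw.le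
  rcases (hD0 a).eq_or_lt with h | h
  · simp [← h]
  have hle : r a * D a c ≤ expect r fun a => D a c :=
    Finset.single_le_sum (f := fun a => r a * D a c)
      (fun a _ => mul_nonneg (hr.nonneg a) (hD0 a)) (Finset.mem_univ a)
  exact mul_log_div_ge ((mul_pos (pos_of_mul_pos_left hw (hq c)) h).trans_le hle) (hD2 a c)

lemma IsProb.sub_le_mutualInfo_rowMix (hr : IsProb r) (hq : ∀ c, 0 ≤ q c)
    (hD : ∀ a, expect q (D a) = 1) (hD2 : ∀ a c, D a c = 0 ∨ D a c = 1 ∨ D a c = 2) :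
    Real.log 2 * (expect r (fun a => expect q fun c => D a c ^ 2) - 1) -
        (expect q (fun c => expect r (fun a => D a c) ^ 2) - 1) ≤
      mutualInfo (rowMix r q D) := by
  refine le_trans (le_of_eq ?_) (Finset.sum_le_sum fun x _ => hr.rowMix_mul_log_ge hq hD hD2 x)
  have hcross : expect r (fun a => expect q fun c => D a c * expect r fun a => D a c) =
      expect q fun c => expect r (fun a => D a c) ^ 2 := by
    simp only [expect_comm (w := r) (w' := q), expect_mul_const, sq]
  change _ = expect (prodWeight r q) _
  simp only [expect_prodWeight, expect_sub, expect_const_mul, hcross, hD, hr.expect_const]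

lemma IsProb.le_mutualInfo_rowMix (hr : IsProb r) (hq : IsProb q) (hD : ∀ a, expect q (D a) = 1)
    (hD2 : ∀ a c, D a c = 0 ∨ D a c = 1 ∨ D a c = 2) {ζ : α → ℝ} (hζ : ∀ a c, |D a c - 1| ≤ ζ a)
    (hζ2 : ∀ a, 1 + ζ a / 2 ≤ expect q fun c => D a c ^ 2) :
    Real.log 2 / 2 * expect r ζ - expect r ζ ^ 2 ≤ mutualInfo (rowMix r q D) := by
  refine le_trans ?_ (hr.sub_le_mutualInfo_rowMix hq.nonneg hD hD2)
  have hrow : 1 + expect r ζ / 2 ≤ expect r fun a => expect q fun c => D a c ^ 2 := by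
    rw [← hr.expect_const 1, div_eq_mul_inv, ← expect_mul_const, ← expect_add]
    exact expect_mono hr.nonneg hζ2
  have hcol : expect q (fun c => expect r (fun a => D a c) ^ 2) - 1 ≤ expect r ζ ^ 2 := by
    have hmean : expect q (fun c => expect r fun a => D a c) = 1 := by
      rw [← expect_comm, show expect r (fun a => expect q (D a)) = expect r fun _ => 1 from
        congrArg _ (funext hD), hr.expect_const]
    have hdev : ∀ c, (expect r (fun a => D a c) - 1) ^ 2 ≤ expect r ζ ^ 2 := fun c => by
      refine sq_le_sq.2 ?_
      rw [← hr.expect_const 1, ← expect_sub]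
      refine (Finset.abs_sum_le_sum_abs _ _).trans (le_trans ?_ (le_abs_self _))
      refine Finset.sum_le_sum fun a _ => ?_
      rw [abs_mul, abs_of_nonneg (hr.nonneg a)]
      exact mul_le_mul_of_nonneg_left (hζ a c) (hr.nonneg a)
    have hvar := expect_mono hq.nonneg hdev
    rw [hq.expect_sub_sq, hmean, hq.expect_const] at hvar
    linarith
  nlinarith [Real.log_pos one_lt_two]

end RowMix

section Tilt

lemma one_add_mul_exp_neg_le_one (u : ℝ) : (1 + u) * Real.exp (-u) ≤ 1 := by
  rw [Real.exp_neg, ← div_eq_mul_inv, div_le_one (Real.exp_pos u), add_comm]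
  exact Real.add_one_le_exp u

lemma one_sub_sq_le_one_add_mul_exp_neg {u : ℝ} (hu : -1 ≤ u) :
    1 - u ^ 2 ≤ (1 + u) * Real.exp (-u) := by
  nlinarith [Real.add_one_le_exp (-u)]

variable {N : ℕ} {y Y : ℝ}

lemma one_add_pow_mul_exp_eq (hy : 0 ≤ y) :
    (1 + Y) ^ N * Real.exp (-(N / (1 + y) * Y)) =
      (1 + y) ^ N * Real.exp (-(N / (1 + y) * y)) *
        ((1 + (Y - y) / (1 + y)) * Real.exp (-((Y - y) / (1 + y)))) ^ N := by
  have hratio : 1 + (Y - y) / (1 + y) = (1 + Y) / (1 + y) := by field_simp; ring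
  have hexp : -(N / (1 + y) * Y) = -(N / (1 + y) * y) + N * -((Y - y) / (1 + y)) := by
    field_simp
    ring
  rw [hratio, hexp, Real.exp_add, Real.exp_nat_mul, mul_pow, div_pow]
  field_simp

lemma one_add_pow_mul_exp_le (hy : 0 ≤ y) (hY : 0 ≤ Y) :
    (1 + Y) ^ N * Real.exp (-(N / (1 + y) * Y)) ≤ (1 + y) ^ N * Real.exp (-(N / (1 + y) * y)) := by
  rw [one_add_pow_mul_exp_eq hy]
  have hu : 0 ≤ 1 + (Y - y) / (1 + y) := by
    rw [show 1 + (Y - y) / (1 + y) = (1 + Y) / (1 + y) by field_simp; ring]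
    positivity
  exact mul_le_of_le_one_right (by positivity)
    (pow_le_one₀ (mul_nonneg hu (Real.exp_pos _).le) (one_add_mul_exp_neg_le_one _))

lemma le_one_add_pow_mul_exp (hy : 0 ≤ y) (hY : 0 ≤ Y) :
    (1 + y) ^ N * Real.exp (-(N / (1 + y) * y)) * (1 - N * (Y - y) ^ 2) ≤
      (1 + Y) ^ N * Real.exp (-(N / (1 + y) * Y)) := by
  rw [one_add_pow_mul_exp_eq (Y := Y) hy]
  refine mul_le_mul_of_nonneg_left ?_ (by positivity)
  set u := (Y - y) / (1 + y) with hu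
  have hu1 : -1 ≤ u := by rw [hu, le_div_iff₀ (by positivity)]; linarith
  have husq : u ^ 2 ≤ (Y - y) ^ 2 := by
    rw [hu, div_pow]
    exact div_le_self (sq_nonneg _) (by nlinarith)
  have hbase : 0 ≤ (1 + u) * Real.exp (-u) := mul_nonneg (by linarith) (Real.exp_pos (-u)).le
  have hbernoulli :=
    one_add_mul_le_pow (show (-2 : ℝ) ≤ (1 + u) * Real.exp (-u) - 1 by linarith) N
  rw [add_sub_cancel] at hbernoulli
  refine le_trans ?_ hbernoulli
  have := one_sub_sq_le_one_add_mul_exp_neg hu1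
  nlinarith [(Nat.cast_nonneg N : (0 : ℝ) ≤ N)]

end Tilt

section Mixtures

variable {ρ Θ γ : Type*} [Fintype ρ] {N : ℕ}

/-- The normalised law of the rows, with `rowMass` as masses. -/
def rowLaw (μ : Θ → ℝ) (ϑ : ρ → Θ) (b : Option ρ) : ℝ := rowMass μ ϑ b / (1 + ∑ r, μ (ϑ r))

lemma one_add_sum_pos {μ : Θ → ℝ} (hμ : ∀ x, 0 ≤ μ x) (ϑ : ρ → Θ) : 0 < 1 + ∑ r, μ (ϑ r) :=
  add_pos_of_pos_of_nonneg one_pos (Finset.sum_nonneg fun _ _ => hμ _)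

lemma isProb_rowLaw {μ : Θ → ℝ} (hμ : ∀ x, 0 ≤ μ x) (ϑ : ρ → Θ) : IsProb (rowLaw μ ϑ) where
  nonneg b := div_nonneg (rowMass_nonneg hμ ϑ b) (one_add_sum_pos hμ ϑ).le
  sum_eq := by
    simp only [rowLaw, ← Finset.sum_div]
    rw [sum_rowMass, div_self (one_add_sum_pos hμ ϑ).ne']

lemma paramWeight_mul_iid_rowLaw (ω : Θ → ℝ) {μ : Θ → ℝ} (hμ : ∀ x, 0 ≤ μ x) (ϑ : ρ → Θ)
    (a : Fin N → Option ρ) :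
    paramWeight N ω μ ϑ * iid (Fin N) (rowLaw μ ϑ) a = seqWeight ω μ a ϑ := by
  have hS := (one_add_sum_pos hμ ϑ).ne'
  simp only [paramWeight, seqWeight, iid, rowLaw, Finset.prod_div_distrib, Finset.prod_const,
    Finset.card_univ, Fintype.card_fin]
  field_simp

section Comparison

variable [Fintype γ] {q : γ → ℝ}

lemma expect_iid_rowMix {α : Type*} [Fintype α] (r : α → ℝ) (D : α → γ → ℝ)
    (β : (Fin N → α × γ) → ℝ) :
    expect (iid (Fin N) (rowMix r q D)) β = expect (iid (Fin N) r) fun a =>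
      expect (iid (Fin N) q) fun c => (∏ t, D (a t) (c t)) * β fun t => (a t, c t) := by
  rw [← expect_prodWeight fun x : (Fin N → α) × (Fin N → γ) =>
      (∏ t, D (x.1 t) (x.2 t)) * β fun t => (x.1 t, x.2 t),
    ← expect_comp_equiv (Equiv.arrowProdEquivProdArrow (Fin N) (fun _ => α) fun _ => γ)]
  refine Finset.sum_congr rfl fun s _ => ?_
  simp only [iid, rowMix, prodWeight, Finset.prod_mul_distrib, Equiv.arrowProdEquivProdArrow]
  exact mul_assoc _ _ _

variable {ω μ : Θ → ℝ} {κ : Θ → γ → ℝ}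

lemma sum_paramWeight_mul_expect_sub_le [DecidableEq ρ] [Fintype Θ] (hq : ∀ c, 0 ≤ q c)
    (hμ : ∀ x, 0 ≤ μ x) {β : (Fin N → Option ρ × γ) → ℝ} (hβ0 : ∀ s, 0 ≤ β s) (hβ1 : ∀ s, β s ≤ 1) :
    ∑ ϑ, paramWeight N ω μ ϑ *
        (expect (iid (Fin N) (rowMix (rowLaw μ ϑ) q fun _ _ => 1)) β -
          expect (iid (Fin N) (rowMix (rowLaw μ ϑ) q (rowDens κ ϑ))) β) ≤
      ∑ a : Fin N → Option ρ, expect (iid (Fin N) q)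
        (fun c => |expect (seqWeight ω μ a) fun ϑ => likelihood κ a ϑ c - 1|) := by
  have hterm : ∀ ϑ : ρ → Θ, paramWeight N ω μ ϑ *
        (expect (iid (Fin N) (rowMix (rowLaw μ ϑ) q fun _ _ => 1)) β -
          expect (iid (Fin N) (rowMix (rowLaw μ ϑ) q (rowDens κ ϑ))) β) =
      ∑ a : Fin N → Option ρ, seqWeight ω μ a ϑ * expect (iid (Fin N) q)
        fun c => -((likelihood κ a ϑ c - 1) * β fun t => (a t, c t)) := fun ϑ => by
    rw [expect_iid_rowMix, expect_iid_rowMix, ← expect_sub, expect, Finset.mul_sum]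
    refine Finset.sum_congr rfl fun a _ => ?_
    rw [← mul_assoc, paramWeight_mul_iid_rowLaw ω hμ, ← expect_sub]
    refine congrArg _ (congrArg _ (funext fun c => ?_))
    simp only [Finset.prod_const_one, likelihood]
    ring
  simp only [hterm]
  rw [Finset.sum_comm]
  refine Finset.sum_le_sum fun a _ => ?_
  change expect (seqWeight ω μ a) _ ≤ _
  rw [expect_comm]
  refine expect_mono (fun c => Finset.prod_nonneg fun _ _ => hq _) fun c => ?_
  simp only [← neg_mul, expect_mul_const]
  refine (le_abs_self _).trans ?_
  rw [abs_mul, abs_of_nonneg (hβ0 _), expect, expect, ← abs_neg]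
  simp only [mul_neg, Finset.sum_neg_distrib, neg_neg]
  exact mul_le_of_le_one_right (abs_nonneg _) (hβ1 _)

open Classical in
lemma mul_sum_paramWeight_le_of_test [DecidableEq ρ] [Fintype Θ] (hq : IsProb q)
    (hω : ∀ x, 0 ≤ ω x) (hμ : ∀ x, 0 ≤ μ x) {β : (Fin N → Option ρ × γ) → ℝ} (hβ0 : ∀ s, 0 ≤ β s)
    (hβ1 : ∀ s, β s ≤ 1) (hκ : ∀ x, expect q (κ x) = 1) (hκ0 : ∀ x c, 0 ≤ κ x c)
    {bad : (ρ → Θ) → Prop}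
    (hnull : ∀ ϑ, 2 / 3 ≤ expect (iid (Fin N) (rowMix (rowLaw μ ϑ) q fun _ _ => 1)) β)
    (halt : ∀ ϑ, ¬ bad ϑ →
      expect (iid (Fin N) (rowMix (rowLaw μ ϑ) q (rowDens κ ϑ))) β ≤ 1 / 3) :
    1 / 3 * ∑ ϑ : ρ → Θ, paramWeight N ω μ ϑ ≤
      ∑ a : Fin N → Option ρ, expect (iid (Fin N) q)
        (fun c => |expect (seqWeight ω μ a) fun ϑ => likelihood κ a ϑ c - 1|) +
      ∑ ϑ, if bad ϑ then paramWeight N ω μ ϑ else 0 := by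
  refine le_trans ?_ (add_le_add_left 
    (sum_paramWeight_mul_expect_sub_le (ω := ω) (κ := κ) hq.nonneg hμ hβ0 hβ1) _)
  rw [Finset.mul_sum, ← Finset.sum_add_distrib]
  refine Finset.sum_le_sum fun ϑ _ => ?_
  have hw := paramWeight_nonneg (N := N) hω hμ ϑ
  have halt1 : expect (iid (Fin N) (rowMix (rowLaw μ ϑ) q (rowDens κ ϑ))) β ≤ 1 := by
    have hp := (isProb_rowMix (isProb_rowLaw hμ ϑ) hq.nonneg (hq.expect_rowDens hκ ϑ)
      (rowDens_nonneg hκ0 ϑ)).iid (ι := Fin N)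
    exact (expect_mono hp.nonneg hβ1).trans_eq (hp.expect_const 1)
  split_ifs with hbad
  · nlinarith [hnull ϑ]
  · nlinarith [hnull ϑ, halt ϑ hbad]

end Comparison

section TiltedPrior

variable {π μ : Θ → ℝ}

/-- The weight `π` tilted by `exp (-t μ)`. For the `t` of `paramWeight_tilted_le` this almost
cancels the factor `(1 + ∑ r, μ (ϑ r)) ^ N` of `paramWeight`. -/
def tilted (π μ : Θ → ℝ) (t : ℝ) (x : Θ) : ℝ := π x * Real.exp (-(t * μ x))

lemma tilted_nonneg (hπ : ∀ x, 0 ≤ π x) (t : ℝ) (x : Θ) : 0 ≤ tilted π μ t x :=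
  mul_nonneg (hπ x) (Real.exp_pos _).le

lemma paramWeight_tilted (t : ℝ) (ϑ : ρ → Θ) :
    paramWeight N (tilted π μ t) μ ϑ =
      iid ρ π ϑ * ((1 + ∑ r, μ (ϑ r)) ^ N * Real.exp (-(t * ∑ r, μ (ϑ r)))) := by
  simp only [paramWeight, tilted, iid, Finset.prod_mul_distrib, ← Real.exp_sum, Finset.mul_sum,
    Finset.sum_neg_distrib]
  ring

lemma paramWeight_tilted_le (hπ : ∀ x, 0 ≤ π x) (hμ : ∀ x, 0 ≤ μ x) {y : ℝ} (hy : 0 ≤ y)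
    (ϑ : ρ → Θ) :
    paramWeight N (tilted π μ (N / (1 + y))) μ ϑ ≤
      iid ρ π ϑ * ((1 + y) ^ N * Real.exp (-(N / (1 + y) * y))) := by
  rw [paramWeight_tilted]
  exact mul_le_mul_of_nonneg_left (one_add_pow_mul_exp_le hy (Finset.sum_nonneg fun _ _ => hμ _))
    (Finset.prod_nonneg fun _ _ => hπ _)

variable [DecidableEq ρ] [Fintype Θ]

lemma le_sum_paramWeight_tilted (hπ : IsProb π) (hμ : ∀ x, 0 ≤ μ x) {y : ℝ}
    (hy : y = Fintype.card ρ * expect π μ) :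
    (1 + y) ^ N * Real.exp (-(N / (1 + y) * y)) *
        (1 - N * (Fintype.card ρ * expect π fun x => μ x ^ 2)) ≤
      ∑ ϑ : ρ → Θ, paramWeight N (tilted π μ (N / (1 + y))) μ ϑ := by
  have hy0 : 0 ≤ y := hy ▸ mul_nonneg (Nat.cast_nonneg _) (expect_nonneg hπ.nonneg hμ)
  have hvar := hπ.expect_iid_sum_sub_sq_le (ι := ρ) μ
  rw [← hy] at hvar
  simp only [paramWeight_tilted]
  calc _ ≤ expect (iid ρ π) fun ϑ => (1 + y) ^ N * Real.exp (-(N / (1 + y) * y)) *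
          (1 - N * (∑ r, μ (ϑ r) - y) ^ 2) := by
        rw [expect_const_mul, expect_sub, hπ.iid.expect_const, expect_const_mul]
        gcongr
    _ ≤ _ := expect_mono hπ.iid.nonneg fun ϑ =>
        le_one_add_pow_mul_exp hy0 (Finset.sum_nonneg fun _ _ => hμ _)

lemma le_prob_of_test [Fintype γ] {q : γ → ℝ} {κ : Θ → γ → ℝ} {y δ : ℝ} (hπ : IsProb π)
    (hμ : ∀ x, 0 ≤ μ x) (hy : y = Fintype.card ρ * expect π μ) (hq : IsProb q)
    (hκ : ∀ x, expect q (κ x) = 1) (hκ0 : ∀ x c, 0 ≤ κ x c) (hδ : δ ≤ 1 / 3)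
    (hlik : ∑ a : Fin N → Option ρ, expect (iid (Fin N) q)
        (fun c => |expect (seqWeight (tilted π μ (N / (1 + y))) μ a)
          fun ϑ => likelihood κ a ϑ c - 1|) ≤
      δ * ∑ ϑ : ρ → Θ, paramWeight N (tilted π μ (N / (1 + y))) μ ϑ)
    {β : (Fin N → Option ρ × γ) → ℝ} (hβ0 : ∀ s, 0 ≤ β s) (hβ1 : ∀ s, β s ≤ 1)
    {bad : (ρ → Θ) → Prop}
    (hnull : ∀ ϑ, 2 / 3 ≤ expect (iid (Fin N) (rowMix (rowLaw μ ϑ) q fun _ _ => 1)) β)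
    (halt : ∀ ϑ, ¬ bad ϑ →
      expect (iid (Fin N) (rowMix (rowLaw μ ϑ) q (rowDens κ ϑ))) β ≤ 1 / 3) :
    (1 / 3 - δ) * (1 - N * (Fintype.card ρ * expect π fun x => μ x ^ 2)) ≤
      prob (iid ρ π) bad := by
  classical
  set C := (1 + y) ^ N * Real.exp (-(N / (1 + y) * y)) with hC
  have hy0 : 0 ≤ y := hy ▸ mul_nonneg (Nat.cast_nonneg _) (expect_nonneg hπ.nonneg hμ)
  have hCpos : 0 < C := by positivity
  have htest := (mul_sum_paramWeight_le_of_test hq (tilted_nonneg hπ.nonneg _) hμ hβ0 hβ1 hκ hκ0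
    hnull halt).trans (add_le_add_left hlik _)
  have hmass := le_sum_paramWeight_tilted (N := N) hπ hμ hy
  rw [← hC] at hmass
  have hbad : (∑ ϑ, if bad ϑ then paramWeight N (tilted π μ (N / (1 + y))) μ ϑ else 0) ≤
      C * prob (iid ρ π) bad := by
    rw [prob, ← expect_const_mul]
    refine Finset.sum_le_sum fun ϑ _ => ?_
    by_cases h : bad ϑ
    · simpa [h] using paramWeight_tilted_le hπ.nonneg hμ hy0 ϑ
    · simp [h]
  refine le_of_mul_le_mul_left ?_ hCpos
  nlinarith

end TiltedPrior

end Mixtures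

section Signs

/-- The real sign of a bit. -/
def sgn (b : Bool) : ℝ := if b then 1 else -1

/-- The law of a fair coin. -/
def coin (_ : Bool) : ℝ := 1 / 2

/-- The uniform law. -/
def unif (γ : Type*) [Fintype γ] (_ : γ) : ℝ := 1 / Fintype.card γ

lemma sgn_mul_self (b : Bool) : sgn b * sgn b = 1 := by cases b <;> norm_num [sgn]

lemma isProb_coin : IsProb coin := ⟨fun _ => by norm_num [coin], by norm_num [coin]⟩

lemma expect_coin_sgn : expect coin sgn = 0 := by simp [expect, coin, sgn]

lemma isProb_unif (γ : Type*) [Fintype γ] [Nonempty γ] : IsProb (unif γ) where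
  nonneg _ := by unfold unif; positivity
  sum_eq := by simp [unif]

variable {J K : Type*}

/-- A perturbation of the uniform law on the columns: the columns come in pairs indexed by `J`, and
the signs `σ` decide which column of a pair gains the mass that the other one loses. The columns in
`K` have no partner. -/
def pert (σ : J → Bool) : J × Bool ⊕ K → ℝ := Sum.elim (fun x => sgn (σ x.1) * sgn x.2) fun _ => 0

lemma pert_eq (σ : J → Bool) (c : J × Bool ⊕ K) : pert σ c = -1 ∨ pert σ c = 0 ∨ pert σ c = 1 := by
  rcases c with ⟨j, b⟩ | k
  · cases h : σ j <;> cases b <;> simp [pert, sgn, h]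
  · exact Or.inr (Or.inl rfl)

lemma abs_pert_le_one (σ : J → Bool) (c : J × Bool ⊕ K) : |pert σ c| ≤ 1 := by
  rcases pert_eq σ c with h | h | h <;> simp [h]

variable [Fintype J]

lemma expect_iid_coin_sum_sgn [DecidableEq J] (x : J → ℝ) :
    expect (iid J coin) (fun σ => ∑ j, x j * sgn (σ j)) = 0 := by
  simp only [expect_sum, expect_const_mul, isProb_coin.expect_iid_eval, expect_coin_sgn, mul_zero,
    Finset.sum_const_zero]

lemma expect_iid_coin_sum_sgn_sq [DecidableEq J] (x : J → ℝ) :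
    expect (iid J coin) (fun σ => (∑ j, x j * sgn (σ j)) ^ 2) = ∑ j, x j ^ 2 := by
  have horth : ∀ i j, expect (iid J coin) (fun σ => sgn (σ i) * sgn (σ j)) =
      if i = j then 1 else 0 := fun i j => by
    split_ifs with h
    · simp only [h, sgn_mul_self, isProb_coin.iid.expect_const]
    · rw [isProb_coin.expect_iid_eval_mul h, expect_coin_sgn, mul_zero]
  simp only [sq, Finset.sum_mul_sum, mul_mul_mul_comm _ (sgn _), expect_sum, expect_const_mul,
    horth, mul_ite, mul_one, mul_zero, Finset.sum_ite_eq, Finset.mem_univ, if_true]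

variable [Fintype K]

/-- The correlation of two perturbations. -/
def corr (K : Type*) [Fintype K] (σ σ' : J → Bool) : ℝ :=
  expect (unif (J × Bool ⊕ K)) fun c => pert σ c * pert σ' c

lemma expect_unif_pert (σ : J → Bool) : expect (unif (J × Bool ⊕ K)) (pert σ) = 0 := by
  simp [expect, unif, pert, sgn, Fintype.sum_prod_type]

lemma corr_eq_sum (σ σ' : J → Bool) :
    corr K σ σ' = ∑ j, 2 / Fintype.card (J × Bool ⊕ K) * sgn (σ j) * sgn (σ' j) := by
  rw [corr, expect, Fintype.sum_sum_type, Fintype.sum_prod_type]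
  simp only [unif, pert, Sum.elim_inl, Sum.elim_inr, mul_zero, Finset.sum_const_zero, add_zero]
  refine Finset.sum_congr rfl fun j _ => ?_
  simp only [mul_mul_mul_comm _ (sgn _), sgn_mul_self, mul_one, Finset.sum_const, Finset.card_univ,
    Fintype.card_bool]
  ring

lemma card_pairs_le : 2 * (Fintype.card J : ℝ) ≤ Fintype.card (J × Bool ⊕ K) := by
  rw [Fintype.card_sum, Fintype.card_prod, Fintype.card_bool]
  push_cast
  linarith [(Nat.cast_nonneg (Fintype.card K) : (0 : ℝ) ≤ _)]

lemma expect_corr [DecidableEq J] (σ : J → Bool) : expect (iid J coin) (corr K σ) = 0 := by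
  simp only [funext fun σ' => corr_eq_sum (K := K) σ σ']
  exact expect_iid_coin_sum_sgn _

lemma expect_corr_sq_le [DecidableEq J] (σ : J → Bool) :
    expect (iid J coin) (fun σ' => corr K σ σ' ^ 2) ≤ 2 / Fintype.card (J × Bool ⊕ K) := by
  simp only [corr_eq_sum, expect_iid_coin_sum_sgn_sq, mul_pow, sq (sgn _), sgn_mul_self, mul_one,
    Finset.sum_const, Finset.card_univ, nsmul_eq_mul]
  have hcard := card_pairs_le (J := J) (K := K)
  set m := (Fintype.card (J × Bool ⊕ K) : ℝ)
  rcases (show 0 ≤ m from Nat.cast_nonneg _).eq_or_lt with hm | hm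
  · simp [← hm]
  · rw [div_pow, mul_div_assoc', div_le_div_iff₀ (by positivity) hm]
    nlinarith

lemma expect_unif_pert_sq_ge [Subsingleton K] [Nonempty J] (σ : J → Bool) :
    1 / 2 ≤ expect (unif (J × Bool ⊕ K)) fun c => pert σ c ^ 2 := by
  have hcard : (Fintype.card (J × Bool ⊕ K) : ℝ) ≤ 4 * Fintype.card J := by
    have hJ : 1 ≤ Fintype.card J := Fintype.card_pos
    have hK : Fintype.card K ≤ 1 := Fintype.card_le_one_iff_subsingleton.2 inferInstance
    rw [Fintype.card_sum, Fintype.card_prod, Fintype.card_bool]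
    exact_mod_cast (by omega)
  have hpos : (0 : ℝ) < Fintype.card (J × Bool ⊕ K) := by exact_mod_cast Fintype.card_pos
  simp only [sq]
  change _ ≤ corr K σ σ
  rw [corr_eq_sum]
  simp only [mul_assoc, sgn_mul_self, mul_one, Finset.sum_const, Finset.card_univ, nsmul_eq_mul]
  rw [mul_div_assoc', le_div_iff₀ hpos]
  linarith

lemma abs_corr_le_one [Nonempty J] (σ σ' : J → Bool) : |corr K σ σ'| ≤ 1 := by
  have hprob := isProb_unif (J × Bool ⊕ K)
  rw [← hprob.expect_const 1]
  refine (Finset.abs_sum_le_sum_abs _ _).trans (Finset.sum_le_sum fun c _ => ?_)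
  rw [abs_mul, abs_mul, abs_of_nonneg (hprob.nonneg c)]
  exact mul_le_mul_of_nonneg_left
    (mul_le_one₀ (abs_pert_le_one σ c) (abs_nonneg _) (abs_pert_le_one σ' c)) (hprob.nonneg c)

lemma two_pow_sub_one_sub_nonneg (s : ℕ) : (0 : ℝ) ≤ 2 ^ s - 1 - s := by
  have h : ((s + 1 : ℕ) : ℝ) ≤ (2 ^ s : ℕ) := by exact_mod_cast Nat.lt_two_pow_self
  push_cast at h
  linarith

lemma one_add_pow_le_of_abs_le_one {x : ℝ} (hx : |x| ≤ 1) (s : ℕ) :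
    (1 + x) ^ s ≤ 1 + s * x + x ^ 2 * (2 ^ s - 1 - s) := by
  obtain ⟨h0, h1⟩ := abs_le.1 hx
  induction s with
  | zero => simp
  | succ s ih =>
    have hstep := mul_le_mul_of_nonneg_left ih (show 0 ≤ 1 + x by linarith)
    rw [pow_succ']
    refine hstep.trans ?_
    push_cast
    rw [pow_succ (2 : ℝ)]
    nlinarith [mul_nonneg (mul_nonneg (sq_nonneg x) (two_pow_sub_one_sub_nonneg s))
      (sub_nonneg.2 h1)]

lemma expect_one_add_corr_pow_le [DecidableEq J] [Nonempty J] (σ : J → Bool) (s : ℕ) :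
    expect (iid J coin) (fun σ' => (1 + corr K σ σ') ^ s) ≤
      1 + (2 ^ s - 1 - s) * (2 / Fintype.card (J × Bool ⊕ K)) := by
  refine (expect_mono isProb_coin.iid.nonneg fun σ' =>
    one_add_pow_le_of_abs_le_one (abs_corr_le_one (K := K) σ σ') s).trans ?_
  rw [expect_add, expect_add, expect_const_mul, expect_mul_const, expect_corr,
    isProb_coin.iid.expect_const]
  linarith [mul_le_mul_of_nonneg_right (expect_corr_sq_le (K := K) σ)
    (two_pow_sub_one_sub_nonneg s)]

lemma expect_unif_one_add_pert_mul [Nonempty J] (σ σ' : J → Bool) :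
    expect (unif (J × Bool ⊕ K)) (fun c => (1 + pert σ c) * (1 + pert σ' c)) = 1 + corr K σ σ' := by
  simp only [add_mul, one_mul, mul_add, mul_one, expect_add, (isProb_unif _).expect_const, corr,
    expect_unif_pert]
  ring

end Signs

section RowPrior

variable {J K : Type*}

/-- A function of the parameter of a random row. The parameter `none` stands for a heavy row, and
`some σ` for a light row whose columns are perturbed by the signs `σ`. -/
def heavyLight (a b : ℝ) (x : Option (J → Bool)) : ℝ := x.elim a fun _ => b

/-- The density of the columns in a random row with respect to the uniform law. -/
def densOf (x : Option (J → Bool)) (c : J × Bool ⊕ K) : ℝ := x.elim 1 fun σ => 1 + pert σ c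

/-- The weight that the tilted prior gives to a row of mass `x` seen `s` times, if rows of that mass
have probability `p`. -/
def tiltedMoment (p t x : ℝ) (s : ℕ) : ℝ := p * Real.exp (-(t * x)) * x ^ s

lemma heavyLight_nonneg {a b : ℝ} (ha : 0 ≤ a) (hb : 0 ≤ b) (x : Option (J → Bool)) :
    0 ≤ heavyLight a b x := by
  cases x <;> assumption

lemma densOf_nonneg (x : Option (J → Bool)) (c : J × Bool ⊕ K) : 0 ≤ densOf x c := by
  cases x with
  | none => exact zero_le_one
  | some σ => exact neg_le_iff_add_nonneg'.1 (abs_le.1 (abs_pert_le_one σ c)).1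

lemma pow_mul_two_pow_sub_le {x : ℝ} (hx : 0 ≤ x) (hx1 : 2 * x ≤ 1) (s : ℕ) :
    x ^ s * (2 ^ s - 1 - s) ≤ 2 * x ^ 2 * ((s : ℝ) * (s - 1)) := by
  rcases Nat.lt_or_ge s 2 with hs | hs
  · interval_cases s <;> norm_num
  · have hs' : (2 : ℝ) ≤ s := by exact_mod_cast hs
    calc x ^ s * (2 ^ s - 1 - s) ≤ x ^ s * 2 ^ s :=
          mul_le_mul_of_nonneg_left (by linarith) (pow_nonneg hx s)
      _ = (2 * x) ^ s := by rw [mul_pow, mul_comm]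
      _ ≤ (2 * x) ^ 2 := pow_le_pow_of_le_one (by positivity) hx1 hs
      _ = 2 * x ^ 2 * 2 := by ring
      _ ≤ 2 * x ^ 2 * ((s : ℝ) * (s - 1)) := by gcongr; nlinarith

lemma tiltedMoment_nonneg {p x : ℝ} (hp : 0 ≤ p) (hx : 0 ≤ x) (t : ℝ) (s : ℕ) :
    0 ≤ tiltedMoment p t x s := by
  unfold tiltedMoment
  positivity

lemma tiltedMoment_le_pow {p t x : ℝ} (hp : p ≤ 1) (ht : 0 ≤ t) (hx : 0 ≤ x) (s : ℕ) :
    tiltedMoment p t x s ≤ x ^ s :=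
  mul_le_of_le_one_left (pow_nonneg hx s) (mul_le_one₀ hp (Real.exp_pos _).le
    (Real.exp_le_one_iff.2 (neg_nonpos.2 (mul_nonneg ht hx))))

lemma div_three_mul_pow_le_tiltedMoment {p t x : ℝ} (hp : 0 ≤ p) (hx : 0 ≤ x) (htx : t * x ≤ 1)
    (s : ℕ) : p / 3 * x ^ s ≤ tiltedMoment p t x s := by
  have hexp : (1 : ℝ) / 3 ≤ Real.exp (-(t * x)) := calc
    (1 : ℝ) / 3 ≤ (Real.exp 1)⁻¹ := by
      rw [one_div]
      exact inv_anti₀ (Real.exp_pos _) (by linarith [Real.exp_one_lt_d9])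
    _ = Real.exp (-1) := (Real.exp_neg 1).symm
    _ ≤ _ := Real.exp_le_exp.2 (neg_le_neg htx)
  rw [div_eq_mul_one_div]
  unfold tiltedMoment
  gcongr

variable {θ h l t : ℝ}

lemma tiltedMoment_light_mul_le {m : ℝ} (hm : 0 ≤ m) (hθ : 0 < θ) (hh : 0 < h) (hl : 0 ≤ l)
    (hlh : 2 * l ≤ h) (ht : 0 ≤ t) (hth : t * h ≤ 1) (s : ℕ) :
    tiltedMoment (1 - θ) t l s * ((2 ^ s - 1 - s) * (2 / m)) ≤
      tiltedMoment θ t h s * (3 / θ * (4 * (l / h) ^ 2) / m * ((s : ℝ) * (s - 1))) := by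
  have hs : 0 ≤ (s : ℝ) * (s - 1) := natCast_mul_sub_one_nonneg s
  have htwo := two_pow_sub_one_sub_nonneg s
  calc tiltedMoment (1 - θ) t l s * ((2 ^ s - 1 - s) * (2 / m))
      ≤ l ^ s * ((2 ^ s - 1 - s) * (2 / m)) := by
        gcongr
        exact tiltedMoment_le_pow (by linarith) ht hl s
    _ = h ^ s * ((l / h) ^ s * (2 ^ s - 1 - s) * (2 / m)) := by
        rw [div_pow]
        field_simp
    _ ≤ h ^ s * (2 * (l / h) ^ 2 * ((s : ℝ) * (s - 1)) * (2 / m)) := by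
        gcongr h ^ s * (?_ * _)
        exact pow_mul_two_pow_sub_le (by positivity) (by rwa [← mul_div_assoc, div_le_one hh]) s
    _ = θ / 3 * h ^ s * (3 / θ * (4 * (l / h) ^ 2) / m * ((s : ℝ) * (s - 1))) := by
        field_simp
        ring
    _ ≤ _ := by
        gcongr
        exact div_three_mul_pow_le_tiltedMoment hθ.le hh.le hth s

variable [Fintype J]

lemma expect_unif_densOf [Fintype K] [Nonempty J] (x : Option (J → Bool)) :
    expect (unif (J × Bool ⊕ K)) (densOf x) = 1 := by
  have hone := (isProb_unif (J × Bool ⊕ K)).expect_const 1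
  cases x with
  | none => exact hone
  | some σ =>
    change expect _ (fun c => 1 + pert σ c) = 1
    rw [expect_add, expect_unif_pert, hone, add_zero]

/-- The law of the parameter of a random row: heavy with probability `θ`, and light with uniform
signs otherwise. -/
def rowPrior (θ : ℝ) (x : Option (J → Bool)) : ℝ := x.elim θ fun σ => (1 - θ) * iid J coin σ

variable [DecidableEq J]

lemma expect_rowPrior (θ : ℝ) (f : Option (J → Bool) → ℝ) :
    expect (rowPrior θ) f = θ * f none + (1 - θ) * expect (iid J coin) fun σ => f (some σ) := by
  simp only [expect, Fintype.sum_option, rowPrior, Option.elim, Finset.mul_sum, mul_assoc]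

lemma expect_rowPrior_heavyLight (θ a b : ℝ) :
    expect (rowPrior (J := J) θ) (heavyLight a b) = θ * a + (1 - θ) * b := by
  rw [expect_rowPrior]
  exact congr_arg (θ * a + (1 - θ) * ·) (isProb_coin.iid.expect_const b)

lemma expect_rowPrior_heavyLight_sq_le (hθ : 0 ≤ θ) (a b : ℝ) :
    expect (rowPrior (J := J) θ) (fun x => heavyLight a b x ^ 2) ≤ θ * a ^ 2 + b ^ 2 := by
  have hsq : ∀ x : Option (J → Bool), heavyLight a b x ^ 2 = heavyLight (a ^ 2) (b ^ 2) x :=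
    fun x => by cases x <;> rfl
  simp only [hsq, expect_rowPrior_heavyLight]
  nlinarith [mul_nonneg hθ (sq_nonneg b)]

lemma isProb_rowPrior (h0 : 0 ≤ θ) (h1 : θ ≤ 1) : IsProb (rowPrior (J := J) θ) where
  nonneg x := by
    cases x with
    | none => exact h0
    | some σ => exact mul_nonneg (sub_nonneg.2 h1) (isProb_coin.iid.nonneg σ)
  sum_eq := by
    have hone := expect_rowPrior (J := J) θ fun _ => 1
    rw [isProb_coin.iid.expect_const] at hone
    simpa [expect] using hone

lemma expect_rowWeight_heavyLight (θ h l t : ℝ) (s : ℕ) (f : Option (J → Bool) → ℝ) :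
    expect (rowWeight (tilted (rowPrior θ) (heavyLight h l) t) (heavyLight h l) s) f =
      tiltedMoment θ t h s * f none +
        tiltedMoment (1 - θ) t l s * expect (iid J coin) fun σ => f (some σ) := by
  have hpull : expect (rowWeight (tilted (rowPrior θ) (heavyLight h l) t) (heavyLight h l) s) f =
      expect (rowPrior θ) fun x =>
        Real.exp (-(t * heavyLight h l x)) * heavyLight h l x ^ s * f x :=
    Finset.sum_congr rfl fun x _ => by rw [rowWeight, tilted]; ring
  rw [hpull, expect_rowPrior]
  simp only [heavyLight, Option.elim, expect_const_mul, tiltedMoment]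
  ring

lemma sum_rowWeight_heavyLight (θ h l t : ℝ) (s : ℕ) :
    ∑ x : Option (J → Bool),
        rowWeight (tilted (rowPrior θ) (heavyLight h l) t) (heavyLight h l) s x =
      tiltedMoment θ t h s + tiltedMoment (1 - θ) t l s := by
  have hone := expect_rowWeight_heavyLight (J := J) θ h l t s fun _ => 1
  simpa only [expect, mul_one, isProb_coin.iid.sum_eq] using hone

variable [Fintype K] [Nonempty J]

lemma rowMoment_heavyLight_le_add (θ h l t : ℝ) (s : ℕ) :
    rowMoment (tilted (rowPrior (J := J) θ) (heavyLight h l) t) (heavyLight h l) densOf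
        (unif (J × Bool ⊕ K)) s ≤
      (tiltedMoment θ t h s + tiltedMoment (1 - θ) t l s) ^ 2 + tiltedMoment (1 - θ) t l s ^ 2 *
        ((2 ^ s - 1 - s) * (2 / Fintype.card (J × Bool ⊕ K))) := by
  have hcorr := expect_mono (isProb_coin.iid (ι := J)).nonneg fun σ =>
    expect_one_add_corr_pow_le (K := K) σ s
  rw [isProb_coin.iid.expect_const] at hcorr
  have hnone : ∀ σ : J → Bool, expect (unif (J × Bool ⊕ K)) (fun c => 1 + pert σ c) = 1 :=
    fun σ => expect_unif_densOf (some σ)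
  simp only [rowMoment, expect_rowWeight_heavyLight, densOf, Option.elim, one_mul, mul_one, hnone,
    (isProb_unif _).expect_const, isProb_coin.iid.expect_const, one_pow, expect_add,
    expect_const_mul, expect_unif_one_add_pert_mul]
  nlinarith [mul_le_mul_of_nonneg_left hcorr (sq_nonneg (tiltedMoment (1 - θ) t l s))]

lemma rowMoment_heavyLight_le (hθ : 0 < θ) (hθ1 : θ ≤ 1) (hh : 0 < h) (hl : 0 ≤ l)
    (hlh : 2 * l ≤ h) (ht : 0 ≤ t) (hth : t * h ≤ 1) (s : ℕ) :
    let W := rowWeight (tilted (rowPrior (J := J) θ) (heavyLight h l) t) (heavyLight h l) s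
    rowMoment (tilted (rowPrior θ) (heavyLight h l) t) (heavyLight h l) densOf
        (unif (J × Bool ⊕ K)) s ≤
      (∑ x, W x) * (∑ x, W x + 3 / θ * (4 * (l / h) ^ 2) / Fintype.card (J × Bool ⊕ K) *
        ((s : ℝ) * (s - 1)) * expect W (heavyLight 0 1)) := by
  intro W
  have hlight : expect W (heavyLight 0 1) = tiltedMoment (1 - θ) t l s := by
    rw [expect_rowWeight_heavyLight]
    simp [heavyLight, isProb_coin.iid.expect_const]
  rw [hlight, sum_rowWeight_heavyLight]
  refine (rowMoment_heavyLight_le_add θ h l t s).trans ?_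
  have hs : 0 ≤ (s : ℝ) * (s - 1) := natCast_mul_sub_one_nonneg s
  have hL := tiltedMoment_nonneg (sub_nonneg.2 hθ1) hl t s
  have hLH := tiltedMoment_light_mul_le (Nat.cast_nonneg (Fintype.card (J × Bool ⊕ K))) hθ hh hl
    hlh ht hth s
  set b := 3 / θ * (4 * (l / h) ^ 2) / Fintype.card (J × Bool ⊕ K) * ((s : ℝ) * (s - 1))
  have hb0 : 0 ≤ b := by positivity
  nlinarith [mul_le_mul_of_nonneg_left hLH hL, mul_nonneg hb0 (mul_nonneg hL hL)]

end RowPrior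

section LowerBound

variable {ρ J K : Type*} [Fintype ρ] {θ h l : ℝ}

/-- The number of heavy rows. -/
def heavyCount (ϑ : ρ → Option (J → Bool)) : ℝ := ∑ r, heavyLight 1 0 (ϑ r)

lemma heavyCount_nonneg (ϑ : ρ → Option (J → Bool)) : 0 ≤ heavyCount ϑ :=
  Finset.sum_nonneg fun _ _ => heavyLight_nonneg zero_le_one le_rfl _

lemma sum_heavyLight (a b : ℝ) (ϑ : ρ → Option (J → Bool)) :
    ∑ r, heavyLight a b (ϑ r) =
      heavyCount ϑ * a + (Fintype.card ρ - heavyCount ϑ) * b := by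
  have hsplit : ∀ x : Option (J → Bool),
      heavyLight a b x = heavyLight 1 0 x * a + (1 - heavyLight 1 0 x) * b := fun x => by
    cases x <;> simp [heavyLight]
  rw [Finset.sum_congr rfl fun r _ => hsplit (ϑ r)]
  simp only [Finset.sum_add_distrib, ← Finset.sum_mul, Finset.sum_sub_distrib,
    Finset.sum_const, Finset.card_univ, nsmul_eq_mul, mul_one, heavyCount]

lemma prob_heavyCount_ge_le [DecidableEq ρ] [Fintype J] [DecidableEq J] (hθ : 0 ≤ θ) (hθ1 : θ ≤ 1)
    {c : ℝ} (hc : 0 < c) :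
    prob (iid ρ (rowPrior (J := J) θ)) (fun ϑ => c ≤ heavyCount ϑ) ≤ Fintype.card ρ * θ / c := by
  have hπ := isProb_rowPrior (J := J) hθ hθ1
  refine (prob_ge_le_expect_div hπ.iid.nonneg heavyCount_nonneg hc).trans_eq ?_
  have hmean : expect (iid ρ (rowPrior θ)) (heavyCount (ρ := ρ) (J := J)) = Fintype.card ρ * θ := by
    refine (hπ.expect_iid_sum (heavyLight 1 0)).trans ?_
    rw [expect_rowPrior_heavyLight]
    ring
  rw [hmean]

lemma prob_heavyCount_ge_half_or_ge_le [DecidableEq ρ] [Nonempty ρ] [Fintype J] [DecidableEq J]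
    (hθ : 0 ≤ θ) (hθ1 : θ ≤ 1) (hh : 0 < h) :
    prob (iid ρ (rowPrior (J := J) θ))
        (fun ϑ => (Fintype.card ρ : ℝ) / 2 ≤ heavyCount ϑ ∨ 1 / h ≤ heavyCount ϑ) ≤
      2 * θ + Fintype.card ρ * θ * h := by
  refine (prob_or_le (isProb_rowPrior hθ hθ1).iid.nonneg _ _).trans ((add_le_add
    (prob_heavyCount_ge_le hθ hθ1 (by positivity))
    (prob_heavyCount_ge_le hθ hθ1 (by positivity))).trans_eq ?_)
  field_simp

lemma expect_rowLaw_light (ϑ : ρ → Option (J → Bool)) :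
    expect (rowLaw (heavyLight h l) ϑ) (fun b => b.elim 0 fun r => heavyLight 0 1 (ϑ r)) =
      l * (Fintype.card ρ - heavyCount ϑ) / (1 + ∑ r, heavyLight h l (ϑ r)) := by
  have hprod : ∀ x : Option (J → Bool), heavyLight h l x * heavyLight 0 1 x = heavyLight 0 l x :=
    fun x => by cases x <;> simp [heavyLight]
  simp only [expect, rowLaw, Fintype.sum_option, rowMass, Option.elim, mul_zero, zero_add,
    div_mul_eq_mul_div, hprod, ← Finset.sum_div, sum_heavyLight 0 l]
  ring

variable [Fintype J] [Fintype K]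

lemma le_mutualInfo_rowMix_densOf [Subsingleton K] [Nonempty J] (hh : 0 ≤ h) (hl : 0 ≤ l)
    (ϑ : ρ → Option (J → Bool)) {w : ℝ}
    (hw : w = l * (Fintype.card ρ - heavyCount ϑ) / (1 + ∑ r, heavyLight h l (ϑ r))) :
    Real.log 2 / 2 * w - w ^ 2 ≤ mutualInfo
      (rowMix (rowLaw (heavyLight h l) ϑ) (unif (J × Bool ⊕ K)) (rowDens densOf ϑ)) := by
  have hq := isProb_unif (J × Bool ⊕ K)
  rw [hw, ← expect_rowLaw_light]
  refine (isProb_rowLaw (heavyLight_nonneg hh hl) ϑ).le_mutualInfo_rowMix hq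
    (hq.expect_rowDens expect_unif_densOf ϑ) ?_ ?_ ?_
  · rintro (_ | r) c
    · exact Or.inr (Or.inl rfl)
    · cases hr : ϑ r with
      | none => simp [rowDens, densOf, hr]
      | some σ => rcases pert_eq σ c with hc | hc | hc <;> norm_num [rowDens, densOf, hr, hc]
  · rintro (_ | r) c
    · simp [rowDens]
    · cases hr : ϑ r with
      | none => simp [rowDens, densOf, heavyLight, hr]
      | some σ => simpa [rowDens, densOf, heavyLight, hr] using abs_pert_le_one σ c
  · rintro (_ | r)
    · simp [rowDens, hq.expect_const]
    · cases hr : ϑ r with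
      | none => simp [rowDens, densOf, heavyLight, hr, hq.expect_const]
      | some σ =>
        have hpert := expect_unif_pert_sq_ge (K := K) σ
        simp only [rowDens, densOf, heavyLight, hr, Option.elim, add_sq, expect_add, one_pow,
          mul_one, expect_const_mul, expect_unif_pert, hq.expect_const]
        linarith

lemma le_mutualInfo_of_heavyCount_lt [Nonempty ρ] [Subsingleton K] [Nonempty J] {ε : ℝ}
    (hh : 0 < h) (hl : 0 < l) (hnl : Fintype.card ρ * l ≤ 9 / 100)
    (hε : 20 * ε ≤ Fintype.card ρ * l) (ϑ : ρ → Option (J → Bool))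
    (hhalf : heavyCount ϑ < Fintype.card ρ / 2) (hinv : heavyCount ϑ < 1 / h) :
    ε ≤ mutualInfo
      (rowMix (rowLaw (heavyLight h l) ϑ) (unif (J × Bool ⊕ K)) (rowDens densOf ϑ)) := by
  have hn : (0 : ℝ) < Fintype.card ρ := by exact_mod_cast Fintype.card_pos
  have hK := heavyCount_nonneg ϑ
  have hKh : heavyCount ϑ * h ≤ 1 := ((lt_div_iff₀ hh).1 hinv).le
  refine le_trans ?_ (le_mutualInfo_rowMix_densOf hh.le hl.le ϑ rfl)
  have hS1 := one_add_sum_pos (heavyLight_nonneg hh.le hl.le) ϑ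
  rw [sum_heavyLight] at hS1 ⊢
  set S := 1 + (heavyCount ϑ * h + (Fintype.card ρ - heavyCount ϑ) * l) with hS
  set w := l * (Fintype.card ρ - heavyCount ϑ) / S
  have hS_le : S ≤ 5 / 2 := by rw [hS]; nlinarith
  have hw_le : w ≤ 9 / 100 :=
    (div_le_self (by nlinarith) (by rw [hS]; nlinarith)).trans (by nlinarith)
  have hw_ge : Fintype.card ρ * l / 5 ≤ w := by
    rw [le_div_iff₀ hS1]
    nlinarith [mul_pos hn hl]
  have hlog : (69 : ℝ) / 100 ≤ Real.log 2 := by linarith [Real.log_two_gt_d9]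
  nlinarith [mul_pos hn hl]

lemma sum_expect_abs_likelihood_densOf_le [DecidableEq ρ] [DecidableEq J] [Nonempty J] {t : ℝ}
    {N : ℕ} (hθ : 0 < θ) (hθ1 : θ ≤ 1) (hh : 0 < h) (hl : 0 ≤ l) (hlh : 2 * l ≤ h) (ht : 0 ≤ t)
    (hth : t * h ≤ 1)
    (hTV : Fintype.card ρ * (3 / θ * (4 * (l / h) ^ 2) / Fintype.card (J × Bool ⊕ K) *
      (N ^ 2 * l ^ 2)) ≤ 1 / 50) :
    ∑ a : Fin N → Option ρ, expect (iid (Fin N) (unif (J × Bool ⊕ K)))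
        (fun c => |expect (seqWeight (tilted (rowPrior θ) (heavyLight h l) t) (heavyLight h l) a)
          fun ϑ => likelihood densOf a ϑ c - 1|) ≤
      1 / 5 * ∑ ϑ : ρ → Option (J → Bool),
        paramWeight N (tilted (rowPrior θ) (heavyLight h l) t) (heavyLight h l) ϑ := by
  have hω := tilted_nonneg (μ := heavyLight h l) (isProb_rowPrior (J := J) hθ.le hθ1).nonneg t
  have hμ := heavyLight_nonneg (J := J) hh.le hl
  refine (sum_expect_abs_likelihood_sub_one_le (isProb_unif (J × Bool ⊕ K)) expect_unif_densOf
    densOf_nonneg (l := l) hω hμ (heavyLight_nonneg le_rfl zero_le_one) (by positivity)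
    (fun x => ?_) (rowMoment_heavyLight_le hθ hθ1 hh hl hlh ht hth)).trans ?_
  · cases x <;> simp [heavyLight, sq_nonneg]
  · exact mul_le_mul_of_nonneg_right (by linarith)
      (Finset.sum_nonneg fun ϑ _ => paramWeight_nonneg hω hμ ϑ)

lemma not_mitestable_of_params {n m N : ℕ} {ε : ℝ} (hn : 0 < n) (hm : 2 ≤ m) (hθ : 0 < θ)
    (hθ1 : θ ≤ 1 / 50) (hh : h = 1 / (N + 1)) (hnθh : n * θ * h ≤ 1 / 50) (hl : 0 < l)
    (hlh : 2 * l ≤ h) (hnl : n * l ≤ 9 / 100) (hε : 20 * ε ≤ n * l)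
    (hvar : N * (n * (θ * h ^ 2 + l ^ 2)) ≤ 3 / 100)
    (hTV : n * (3 / θ * (4 * (l / h) ^ 2) / m * (N ^ 2 * l ^ 2)) ≤ 1 / 50) :
    ¬ MITestable ε (n + 1) m N := by
  intro htest
  have : NeZero n := ⟨hn.ne'⟩
  have : NeZero (m / 2) := ⟨by omega⟩
  have : Subsingleton (Fin (m % 2)) := Fin.subsingleton_iff_le_one.2 (by omega)
  have hcard : Fintype.card (Fin (m / 2) × Bool ⊕ Fin (m % 2)) = m := by simp; omega
  obtain ⟨β, hβ0, hβ1, hβ⟩ :=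
    htest.exists_test (finSuccEquiv n).symm (Fintype.equivFinOfCardEq hcard)
  have hh0 : 0 < h := hh ▸ by positivity
  have hπ := isProb_rowPrior (J := Fin (m / 2)) hθ.le (by linarith)
  have hμ := heavyLight_nonneg (J := Fin (m / 2)) hh0.le hl.le
  have hq := isProb_unif (Fin (m / 2) × Bool ⊕ Fin (m % 2))
  have hlaw : ∀ ϑ : Fin n → _, IsProb (rowLaw (heavyLight h l) ϑ) := isProb_rowLaw hμ
  set y : ℝ := Fintype.card (Fin n) * expect (rowPrior (J := Fin (m / 2)) θ) (heavyLight h l)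
  have hy : 0 ≤ y := mul_nonneg (Nat.cast_nonneg _) (expect_nonneg hπ.nonneg hμ)
  have hth : N / (1 + y) * h ≤ 1 := by
    rw [hh, mul_one_div, div_div, div_le_one (by positivity)]
    nlinarith [(Nat.cast_nonneg N : (0 : ℝ) ≤ N)]
  have hprob := le_prob_of_test hπ hμ rfl hq expect_unif_densOf densOf_nonneg (by norm_num)
    (sum_expect_abs_likelihood_densOf_le hθ (by linarith) hh0 hl.le hlh (by positivity) hth
      (by simpa only [hcard, Fintype.card_fin] using hTV)) hβ0 hβ1
    (bad := fun ϑ => (n : ℝ) / 2 ≤ heavyCount ϑ ∨ 1 / h ≤ heavyCount ϑ)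
    (fun ϑ => (hβ _ (isProb_rowMix (hlaw ϑ) hq.nonneg (fun _ => hq.expect_const 1)
      fun _ _ => zero_le_one)).1 fun x => (margProd_rowMix_one (hlaw ϑ) hq x).symm)
    (fun ϑ hgood => by
      rw [not_or, not_le, not_le] at hgood
      refine (hβ _ (isProb_rowMix (hlaw ϑ) hq.nonneg (hq.expect_rowDens expect_unif_densOf ϑ)
        (rowDens_nonneg densOf_nonneg ϑ))).2 ?_
      exact le_mutualInfo_of_heavyCount_lt hh0 hl (by simpa using hnl) (by simpa using hε) ϑ
        (by simpa using hgood.1) hgood.2)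
  have hbad := prob_heavyCount_ge_half_or_ge_le (ρ := Fin n) (J := Fin (m / 2)) hθ.le
    (by linarith) hh0
  have hmean : (N : ℝ) * (n * expect (rowPrior (J := Fin (m / 2)) θ) fun x =>
      heavyLight h l x ^ 2) ≤ 3 / 100 := by
    refine le_trans ?_ hvar
    gcongr
    exact expect_rowPrior_heavyLight_sq_le hθ.le h l
  simp only [Fintype.card_fin] at hprob hbad
  linarith

end LowerBound

section Rate

variable {n m : ℕ} {ε x : ℝ}

lemma miRate_nonneg (n m : ℕ) (hε : 0 < ε) : 0 ≤ miRate ε n m := by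
  unfold miRate
  positivity

lemma rpow_three_quarters_mul_div_mul_pow (n m : ℕ) (hε : ε ≠ 0) :
    ((n : ℝ) ^ (3 / 4 : ℝ) * (m : ℝ) ^ (1 / 4 : ℝ) / ε * ε) ^ 4 = (n : ℝ) ^ 3 * m := by
  rw [div_mul_cancel₀ _ hε, mul_pow, ← Real.rpow_mul_natCast n.cast_nonneg,
    ← Real.rpow_mul_natCast m.cast_nonneg]
  norm_num

lemma rpow_two_thirds_mul_div_pow_mul (n m : ℕ) (hε : 0 < ε) :
    ((n : ℝ) ^ (2 / 3 : ℝ) * (m : ℝ) ^ (1 / 3 : ℝ) / ε ^ (4 / 3 : ℝ)) ^ 3 * ε ^ 4 =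
      (n : ℝ) ^ 2 * m := by
  have hε4 : (ε ^ (4 / 3 : ℝ)) ^ 3 = ε ^ 4 := by
    rw [← Real.rpow_mul_natCast hε.le]
    norm_num
  rw [div_pow, hε4, div_mul_cancel₀ _ (by positivity), mul_pow,
    ← Real.rpow_mul_natCast n.cast_nonneg, ← Real.rpow_mul_natCast m.cast_nonneg]
  norm_num

lemma le_miRate_iff (hx : 0 ≤ x) (hε : 0 < ε) :
    x ≤ miRate ε n m ↔ (x * ε) ^ 4 ≤ (n : ℝ) ^ 3 * m ∧ x ^ 3 * ε ^ 4 ≤ (n : ℝ) ^ 2 * m := by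
  rw [miRate, le_min_iff, ← rpow_three_quarters_mul_div_mul_pow n m hε.ne',
    ← rpow_two_thirds_mul_div_pow_mul n m hε,
    pow_le_pow_iff_left₀ (by positivity) (by positivity) (by norm_num), mul_le_mul_iff_left₀ hε,
    mul_le_mul_iff_left₀ (by positivity),
    pow_le_pow_iff_left₀ hx (by positivity) (by norm_num)]

lemma miRate_pow_eq (n m : ℕ) (hε : 0 < ε) :
    (miRate ε n m * ε) ^ 4 = (n : ℝ) ^ 3 * m ∨ miRate ε n m ^ 3 * ε ^ 4 = (n : ℝ) ^ 2 * m := by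
  rcases min_choice ((n : ℝ) ^ (3 / 4 : ℝ) * (m : ℝ) ^ (1 / 4 : ℝ) / ε)
    ((n : ℝ) ^ (2 / 3 : ℝ) * (m : ℝ) ^ (1 / 3 : ℝ) / ε ^ (4 / 3 : ℝ)) with h | h
  · exact Or.inl (by rw [miRate, h, rpow_three_quarters_mul_div_mul_pow n m hε.ne'])
  · exact Or.inr (by rw [miRate, h, rpow_two_thirds_mul_div_pow_mul n m hε])

lemma one_div_le_miRate (hn : 1 ≤ n) (hm : 1 ≤ m) (hε : 0 < ε) (hε1 : ε ≤ 1) :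
    1 / ε ≤ miRate ε n m := by
  have hn' : (1 : ℝ) ≤ n := by exact_mod_cast hn
  have hm' : (1 : ℝ) ≤ m := by exact_mod_cast hm
  refine (le_miRate_iff (by positivity) hε).2 ⟨?_, ?_⟩
  · rw [div_mul_cancel₀ _ hε.ne', one_pow]
    exact one_le_mul_of_one_le_of_one_le (one_le_pow₀ hn') hm'
  · calc (1 / ε) ^ 3 * ε ^ 4 = ε := by field_simp
      _ ≤ 1 := hε1
      _ ≤ (n : ℝ) ^ 2 * m := one_le_mul_of_one_le_of_one_le (one_le_pow₀ hn') hm'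

lemma mul_le_of_le_miRate (hmn : m ≤ n) (hε : 0 < ε) (hx : 0 ≤ x) (h : x ≤ miRate ε n m) :
    x * ε ≤ n := by
  refine (pow_le_pow_iff_left₀ (by positivity) (by positivity) four_ne_zero).1
    (((le_miRate_iff hx hε).1 h).1.trans ?_)
  calc (n : ℝ) ^ 3 * m ≤ (n : ℝ) ^ 3 * n := by gcongr
    _ = (n : ℝ) ^ 4 := by ring

end Rate

section LowerRate

/- With masses `l = 20 ε / n` and `h = 1 / (N + 1)`, a heavy row is seen about once. Heavy rows hide
the light ones, and the probability `θ` of a heavy row is the largest that keeps their total mass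
bounded. -/

variable {n m : ℕ} {ε θ M : ℝ}

lemma light_term_le (hn : 0 < n) (hm : 0 < m) (hε : 0 < ε) (hM : 0 < M)
    (h4 : 10000 ^ 4 * (M * ε) ^ 4 ≤ 8 * n ^ 3 * m)
    (h3 : 10000 ^ 3 * (M ^ 3 * ε ^ 4) ≤ 4 * n ^ 2 * m) (hθ : θ = min 1 (M / n) / 50) :
    12 * n * M ^ 4 * (20 * ε / n) ^ 4 / (θ * m) ≤ 1 / 50 := by
  have hn' : (0 : ℝ) < n := by exact_mod_cast hn
  have hm' : (0 : ℝ) < m := by exact_mod_cast hm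
  have hnum : 12 * n * M ^ 4 * (20 * ε / n) ^ 4 = 12 * 20 ^ 4 * (M * ε) ^ 4 / n ^ 3 := by
    field_simp
  rw [hθ, hnum]
  rcases le_total 1 (M / n) with hc | hc
  · rw [min_eq_left hc, div_le_iff₀ (by positivity), div_le_iff₀ (by positivity)]
    nlinarith [mul_pos (pow_pos hn' 3) hm']
  · have hfactor : 12 * 20 ^ 4 * (M * ε) ^ 4 / n ^ 3 =
        12 * 20 ^ 4 * (M ^ 3 * ε ^ 4) / n ^ 2 * (M / n) := by field_simp
    rw [min_eq_right hc, hfactor, div_le_iff₀ (by positivity)]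
    calc _ ≤ 1 / 50 * (1 / 50 * m) * (M / n) := by
          gcongr ?_ * _
          rw [div_le_iff₀ (by positivity)]
          nlinarith [mul_pos (pow_pos hn' 2) hm']
      _ = _ := by ring

lemma spread_term_le {N : ℕ} {h l : ℝ} (hn : 0 < n) (hm : 0 < m) (hθ : 0 < θ) (hM : 0 < M)
    (hNM : N ≤ M) (hh : h = 1 / M) :
    n * (3 / θ * (4 * (l / h) ^ 2) / m * (N ^ 2 * l ^ 2)) ≤
      12 * n * M ^ 4 * l ^ 4 / (θ * m) := by
  calc _ ≤ n * (3 / θ * (4 * (l / h) ^ 2) / m * (M ^ 2 * l ^ 2)) := by gcongr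
    _ = _ := by rw [hh]; field_simp; ring

lemma sampled_mass_variance_le {N : ℕ} {h : ℝ} (hn : 0 < n) (hε : 0 ≤ ε) (hε1 : ε ≤ 1 / 20000)
    (hM : 0 < M) (hNM : N ≤ M) (hh : h = 1 / M) (hMε : 40 * (M * ε) ≤ n)
    (hnθh : n * θ * h ≤ 1 / 50) :
    N * (n * (θ * h ^ 2 + (20 * ε / n) ^ 2)) ≤ 3 / 100 := by
  have hn' : (0 : ℝ) < n := by exact_mod_cast hn
  have hheavy : n * θ * h * (N * h) ≤ 1 / 50 * 1 := by
    have hNh : N * h ≤ 1 := by rwa [hh, mul_one_div, div_le_one hM]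
    have hh0 : 0 ≤ h := by rw [hh]; positivity
    gcongr
  have hNε : N * ε / n ≤ 1 / 40 := by
    rw [div_le_iff₀ hn']
    linarith [mul_le_mul_of_nonneg_right hNM hε]
  have hlight : 400 * ε * (N * ε / n) ≤ 400 * (1 / 20000) * (1 / 40) := by gcongr
  calc _ = n * θ * h * (N * h) + 400 * ε * (N * ε / n) := by field_simp; ring
    _ ≤ 1 / 50 * 1 + 400 * (1 / 20000) * (1 / 40) := add_le_add hheavy hlight
    _ ≤ 3 / 100 := by norm_num

lemma not_mitestable_of_lt_miRate {N : ℕ} (hm : 2 ≤ m) (hmn : m ≤ n + 1) (hε : 0 < ε)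
    (hε1 : ε ≤ 1 / 20000) (hN : 10000 * ((N : ℝ) + 1) ≤ miRate ε (n + 1) m) :
    ¬ MITestable ε (n + 1) m N := by
  have hn : 0 < n := by omega
  have hn' : (1 : ℝ) ≤ n := by exact_mod_cast hn
  have hn2 : ((n + 1 : ℕ) : ℝ) ≤ 2 * n := by push_cast; linarith
  set M : ℝ := N + 1
  have hM : 0 < M := by positivity
  have hNM : (N : ℝ) ≤ M := le_add_of_nonneg_right zero_le_one
  obtain ⟨h4, h3⟩ := (le_miRate_iff (by positivity) hε).1 hN
  replace h4 : 10000 ^ 4 * (M * ε) ^ 4 ≤ 8 * n ^ 3 * m := by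
    calc _ = (10000 * M * ε) ^ 4 := by ring
      _ ≤ (2 * (n : ℝ)) ^ 3 * m := h4.trans (by gcongr)
      _ = _ := by ring
  replace h3 : 10000 ^ 3 * (M ^ 3 * ε ^ 4) ≤ 4 * n ^ 2 * m := by
    calc _ = (10000 * M) ^ 3 * ε ^ 4 := by ring
      _ ≤ (2 * (n : ℝ)) ^ 2 * m := h3.trans (by gcongr)
      _ = _ := by ring
  have hMε : 40 * (M * ε) ≤ n := by
    linarith [mul_le_of_le_miRate hmn hε (by positivity) hN, mul_pos hM hε]
  obtain ⟨θ, hθ⟩ : ∃ θ : ℝ, θ = min 1 (M / n) / 50 := ⟨_, rfl⟩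
  have hθ0 : 0 < θ := hθ ▸ div_pos (lt_min one_pos (by positivity)) (by norm_num)
  have hθ1 : θ ≤ 1 / 50 := hθ ▸ div_le_div_of_nonneg_right (min_le_left _ _) (by norm_num)
  have hnθh : n * θ * (1 / M) ≤ 1 / 50 := by
    calc n * θ * (1 / M) ≤ n * (M / n / 50) * (1 / M) := by
          rw [hθ]; gcongr; exact min_le_right _ _
      _ = 1 / 50 := by field_simp
  have hnl : n * (20 * ε / n) = 20 * ε := by field_simp
  refine not_mitestable_of_params (l := 20 * ε / n) hn hm hθ0 hθ1 rfl hnθh (by positivity) ?_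
    (by linarith) hnl.ge (sampled_mass_variance_le hn hε.le hε1 hM hNM rfl hMε hnθh)
    ((spread_term_le hn (by omega) hθ0 hM hNM rfl).trans
      (light_term_le hn (by omega) hε hM h4 h3 hθ))
  rw [← mul_div_assoc, div_le_div_iff₀ (by positivity) hM]
  linarith

lemma miRate_le_of_mitestable {N : ℕ} (hm : 2 ≤ m) (hmn : m ≤ n) (hε : 0 < ε)
    (hε1 : ε ≤ 1 / 20000) (h : MITestable ε n m N) : miRate ε n m ≤ 20000 * N := by
  obtain ⟨n, rfl⟩ : ∃ k, n = k + 1 := ⟨n - 1, by omega⟩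
  by_contra! hlt
  refine not_mitestable_of_lt_miRate hm hmn hε hε1 ?_ h
  have hrate : 20000 ≤ miRate ε (n + 1) m :=
    ((le_div_iff₀ hε).2 (by linarith)).trans
      (one_div_le_miRate (by omega) (by omega) hε (by linarith))
  linarith

end LowerRate

/-! ### Upper bound -/

section TriDisc

/-- The contribution `(x - y)² / (x + y)` of a symbol to the triangular discrimination. -/
def triDisc (x y : ℝ) : ℝ := (x - y) ^ 2 / (x + y)

lemma triDisc_nonneg {x y : ℝ} (hx : 0 ≤ x) (hy : 0 ≤ y) : 0 ≤ triDisc x y := by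
  unfold triDisc
  positivity

lemma triDisc_le_abs {x y : ℝ} (hx : 0 ≤ x) (hy : 0 ≤ y) : triDisc x y ≤ |x - y| := by
  have habs : |x - y| ≤ x + y := abs_le.2 ⟨by linarith, by linarith⟩
  refine div_le_of_le_mul₀ (by positivity) (abs_nonneg _) ?_
  rw [← sq_abs, sq]
  gcongr

lemma triDisc_le_add {x y : ℝ} (hx : 0 ≤ x) (hy : 0 ≤ y) : triDisc x y ≤ x + y :=
  (triDisc_le_abs hx hy).trans (abs_le.2 ⟨by linarith, by linarith⟩)

lemma klTerm_le_sq_div {x y : ℝ} (hx : 0 ≤ x) (hy : 0 < y) : klTerm x y ≤ (x - y) ^ 2 / y := by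
  have hlog : x * Real.log (x / y) ≤ x * (x / y - 1) := by
    rcases hx.eq_or_lt with rfl | hx
    · simp
    · exact mul_le_mul_of_nonneg_left (Real.log_le_sub_one_of_pos (by positivity)) hx.le
  calc klTerm x y ≤ x * (x / y - 1) - x + y := by unfold klTerm; gcongr
    _ = (x - y) ^ 2 / y := by field_simp; ring

lemma klTerm_le_mul_triDisc {x y M : ℝ} (hx : 0 ≤ x) (hy : 0 ≤ y) (h : y = 0 → x = 0) (hM : 0 ≤ M)
    (hlog : Real.log (x / y) ≤ M) : klTerm x y ≤ 5 * (1 + M) * triDisc x y := by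
  rcases hy.eq_or_lt with rfl | hy
  · simp [klTerm, h rfl, triDisc]
  have hxy : 0 < x + y := by linarith
  rw [triDisc, mul_div_assoc', le_div_iff₀ hxy]
  rcases le_or_gt x (4 * y) with hclose | hfar
  · calc klTerm x y * (x + y) ≤ (x - y) ^ 2 / y * (5 * y) :=
          mul_le_mul (klTerm_le_sq_div hx hy) (by linarith) hxy.le (by positivity)
      _ = 5 * (x - y) ^ 2 := by field_simp
      _ ≤ _ := by nlinarith [mul_nonneg hM (sq_nonneg (x - y))]
  · have hkl : klTerm x y ≤ x * M := by
      have := mul_le_mul_of_nonneg_left hlog hx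
      unfold klTerm
      linarith
    have hprod : klTerm x y * (x + y) ≤ x * M * (5 / 4 * x) :=
      mul_le_mul hkl (by linarith) hxy.le (by positivity)
    have hdiff : (3 / 4 * x) ^ 2 ≤ (x - y) ^ 2 :=
      pow_le_pow_left₀ (by linarith) (by linarith) 2
    nlinarith [mul_le_mul_of_nonneg_left hdiff hM]

lemma negMulLog_le_two_mul_sqrt {x : ℝ} (hx : 0 ≤ x) : Real.negMulLog x ≤ 2 * √x := by
  rcases hx.eq_or_lt with rfl | hx
  · simp
  have hlog : Real.log (√x)⁻¹ ≤ (√x)⁻¹ := Real.log_le_self (by positivity)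
  rw [Real.log_inv, Real.log_sqrt hx.le] at hlog
  calc Real.negMulLog x = x * (-(Real.log x / 2) * 2) := by rw [Real.negMulLog]; ring
    _ ≤ x * ((√x)⁻¹ * 2) := by gcongr
    _ = √x * √x * (√x)⁻¹ * 2 := by rw [Real.mul_self_sqrt hx.le]; ring
    _ = 2 * √x := by field_simp

variable {α γ : Type*} [Fintype α] [Fintype γ] {p : α × γ → ℝ}

lemma IsProb.log_div_margProd_le (hp : IsProb p) {x : α × γ} (hx : 0 < p x) :
    Real.log (p x / margProd p x) ≤ -Real.log (margA p x.1) := by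
  have hA := hx.trans_le (hp.le_margA x)
  have hC := hx.trans_le (hp.le_margC x)
  rw [← Real.log_inv]
  have hQ : 0 < margProd p x := mul_pos hA hC
  refine Real.log_le_log (div_pos hx hQ) ?_
  rw [div_le_iff₀ hQ, margProd, prodWeight, inv_mul_cancel_left₀ hA.ne']
  exact hp.le_margC x

lemma IsProb.sum_margProd_row (hp : IsProb p) (a : α) : ∑ c, margProd p (a, c) = margA p a := by
  simp only [margProd, prodWeight, ← Finset.mul_sum, hp.margC.sum_eq, mul_one]

lemma IsProb.sum_klTerm_row_le_negMulLog (hp : IsProb p) (a : α) :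
    ∑ c, klTerm (p (a, c)) (margProd p (a, c)) ≤ Real.negMulLog (margA p a) := by
  have hlog : ∀ c, p (a, c) * Real.log (p (a, c) / margProd p (a, c)) ≤
      p (a, c) * -Real.log (margA p a) := fun c => by
    rcases (hp.nonneg (a, c)).eq_or_lt with h0 | h0
    · simp [← h0]
    · exact mul_le_mul_of_nonneg_left (hp.log_div_margProd_le h0) h0.le
  calc ∑ c, klTerm (p (a, c)) (margProd p (a, c))
      = ∑ c, p (a, c) * Real.log (p (a, c) / margProd p (a, c)) := by
        simp only [klTerm, Finset.sum_add_distrib, Finset.sum_sub_distrib, hp.sum_margProd_row a]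
        exact sub_add_cancel _ _
    _ ≤ ∑ c, p (a, c) * -Real.log (margA p a) := Finset.sum_le_sum fun c _ => hlog c
    _ = Real.negMulLog (margA p a) := by
        rw [← Finset.sum_mul, Real.negMulLog, neg_mul_comm]
        rfl

lemma IsProb.klTerm_le_mul_triDisc (hp : IsProb p) {x : α × γ} {δ : ℝ} (hδ : 0 < δ) (hδ1 : δ ≤ 1)
    (hx : δ ≤ margA p x.1) :
    klTerm (p x) (margProd p x) ≤ 5 * (1 - Real.log δ) * triDisc (p x) (margProd p x) := by
  have hlogδ := Real.log_nonpos hδ.le hδ1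
  refine MITesting.klTerm_le_mul_triDisc (hp.nonneg x) (hp.margProd.nonneg x)
    hp.eq_zero_of_margProd_eq_zero (neg_nonneg.2 hlogδ) ?_
  rcases (hp.nonneg x).eq_or_lt with h0 | h0
  · simpa [← h0] using hlogδ
  · exact (hp.log_div_margProd_le h0).trans (neg_le_neg (Real.log_le_log hδ hx))

/- Rows of marginal mass below `δ` hold little mutual information; in the others the log-likelihood
ratio is at most `-log δ`. -/
lemma IsProb.mutualInfo_le_sum_triDisc (hp : IsProb p) {δ : ℝ} (hδ : 0 < δ) (hδ1 : δ ≤ 1) :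
    mutualInfo p ≤ 5 * (1 - Real.log δ) * ∑ x, triDisc (p x) (margProd p x) +
      Fintype.card α * (2 * √δ) := by
  have hlogδ : 0 ≤ 1 - Real.log δ := by linarith [Real.log_nonpos hδ.le hδ1]
  have htri : ∀ x, 0 ≤ triDisc (p x) (margProd p x) := fun x =>
    triDisc_nonneg (hp.nonneg x) (hp.margProd.nonneg x)
  have hrow : ∀ a, ∑ c, klTerm (p (a, c)) (margProd p (a, c)) ≤
      5 * (1 - Real.log δ) * ∑ c, triDisc (p (a, c)) (margProd p (a, c)) + 2 * √δ := fun a => by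
    rcases le_or_gt δ (margA p a) with ha | ha
    · rw [Finset.mul_sum]
      exact (Finset.sum_le_sum fun c _ => hp.klTerm_le_mul_triDisc hδ hδ1 ha).trans
        (le_add_of_nonneg_right (by positivity))
    · calc _ ≤ 2 * √(margA p a) := (hp.sum_klTerm_row_le_negMulLog a).trans
            (negMulLog_le_two_mul_sqrt (hp.margA.nonneg a))
        _ ≤ 2 * √δ := by gcongr
        _ ≤ _ := le_add_of_nonneg_left
            (mul_nonneg (by positivity) (Finset.sum_nonneg fun c _ => htri _))
  calc mutualInfo p = ∑ a, ∑ c, klTerm (p (a, c)) (margProd p (a, c)) := by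
        rw [hp.mutualInfo_eq_sum_klTerm, Fintype.sum_prod_type]
    _ ≤ ∑ a, (5 * (1 - Real.log δ) * ∑ c, triDisc (p (a, c)) (margProd p (a, c)) + 2 * √δ) :=
        Finset.sum_le_sum fun a _ => hrow a
    _ = _ := by
        rw [Finset.sum_add_distrib, ← Finset.mul_sum, Finset.sum_const, Finset.card_univ,
          nsmul_eq_mul, Fintype.sum_prod_type]

lemma IsProb.le_sum_triDisc (hp : IsProb p) {ε : ℝ} (hα : 0 < Fintype.card α) (hε : 0 < ε)
    (hεα : ε ≤ Fintype.card α) (h : ε ≤ mutualInfo p) :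
    3 / 4 * ε ≤ 5 * (1 + 2 * Real.log (8 * Fintype.card α / ε)) *
      ∑ x, triDisc (p x) (margProd p x) := by
  have hn : (0 : ℝ) < Fintype.card α := by exact_mod_cast hα
  set n : ℝ := (Fintype.card α : ℝ)
  set r := ε / (8 * n) with hr
  have hr0 : 0 < r := by positivity
  have hr1 : r ≤ 1 := (div_le_one (by positivity)).2 (by linarith)
  have hlog : 1 - Real.log (r ^ 2) = 1 + 2 * Real.log (8 * n / ε) := by
    rw [Real.log_pow, hr, ← inv_div, Real.log_inv]
    push_cast
    ring
  have hmain := h.trans (hp.mutualInfo_le_sum_triDisc (sq_pos_of_pos hr0) (pow_le_one₀ hr0.le hr1))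
  have hsmall : n * (2 * r) = ε / 4 := by rw [hr]; field_simp; norm_num
  rw [hlog, Real.sqrt_sq hr0.le, hsmall] at hmain
  linarith

end TriDisc

section Collision

/-- The statistic `⟨∑ᵢ φ (S i), ∑ⱼ φ (S' j)⟩` of two families of samples, for a vector-valued
observable `φ` and the scalar product on the coordinates in `B`. For indicator vectors it counts
the collisions in `B` between the two families. -/
def collStat {ι Ω X : Type*} [Fintype ι] (φ : Ω → X → ℝ) (B : Finset X) (S S' : ι → Ω) : ℝ :=
  ∑ x ∈ B, (∑ i, φ (S i) x) * ∑ j, φ (S' j) x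

section Variance

variable {ι Ω X : Type*} [Fintype ι] {q : Ω → ℝ} {φ : Ω → X → ℝ} {μ : X → ℝ} {B : Finset X}

lemma sum_sum_mul (S : ι → Ω) (v : X → ℝ) :
    ∑ x ∈ B, (∑ i, φ (S i) x) * v x = ∑ i, ∑ x ∈ B, φ (S i) x * v x := by
  simp only [Finset.sum_mul]
  exact Finset.sum_comm

variable [DecidableEq ι] [Fintype Ω]

lemma expect_sum_mul (hμ : ∀ x, expect q (φ · x) = μ x) (v : X → ℝ) :
    expect q (fun s => ∑ x ∈ B, φ s x * v x) = ∑ x ∈ B, μ x * v x := by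
  simp only [expect_sum, expect_mul_const, hμ]

lemma IsProb.expect_collStat_sub_left_sq_le (hq : IsProb q) (hμ : ∀ x, expect q (φ · x) = μ x)
    (S' : ι → Ω) :
    expect (iid ι q) (fun S => (collStat φ B S S' -
      Fintype.card ι * ∑ x ∈ B, μ x * ∑ j, φ (S' j) x) ^ 2) ≤
    Fintype.card ι * expect q (fun s => (∑ j, ∑ x ∈ B, φ (S' j) x * φ s x) ^ 2) := by
  have h := hq.expect_iid_sum_sub_sq_le (ι := ι) fun s => ∑ x ∈ B, φ s x * ∑ j, φ (S' j) x
  rw [expect_sum_mul hμ] at h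
  simpa only [collStat, sum_sum_mul, ← sum_sum_mul S', mul_comm (∑ j, φ (S' j) _)] using h

lemma IsProb.expect_collStat_sub_left_le (hq : IsProb q) (hμ : ∀ x, expect q (φ · x) = μ x) :
    expect (iid ι q) (fun S' => expect (iid ι q) fun S => (collStat φ B S S' -
      Fintype.card ι * ∑ x ∈ B, μ x * ∑ j, φ (S' j) x) ^ 2) ≤
    Fintype.card ι ^ 2 * expect q (fun s => expect q fun s' => (∑ x ∈ B, φ s' x * φ s x) ^ 2) +
      Fintype.card ι ^ 3 * expect q (fun s => (∑ x ∈ B, φ s x * μ x) ^ 2) := by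
  have hcross : ∀ s, expect (iid ι q) (fun S' => (∑ j, ∑ x ∈ B, φ (S' j) x * φ s x) ^ 2) ≤
      Fintype.card ι * expect q (fun s' => (∑ x ∈ B, φ s' x * φ s x) ^ 2) +
        Fintype.card ι ^ 2 * (∑ x ∈ B, φ s x * μ x) ^ 2 := fun s => by
    have h := hq.expect_iid_sum_sq_le (ι := ι) fun s' => ∑ x ∈ B, φ s' x * φ s x
    rw [expect_sum_mul hμ, mul_pow] at h
    simpa only [mul_comm (μ _)] using h
  calc _ ≤ expect (iid ι q) (fun S' => Fintype.card ι *
          expect q (fun s => (∑ j, ∑ x ∈ B, φ (S' j) x * φ s x) ^ 2)) :=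
        expect_mono hq.iid.nonneg fun S' => hq.expect_collStat_sub_left_sq_le hμ S'
    _ = Fintype.card ι * expect q (fun s => expect (iid ι q) fun S' =>
          (∑ j, ∑ x ∈ B, φ (S' j) x * φ s x) ^ 2) := by rw [expect_const_mul, expect_comm]
    _ ≤ Fintype.card ι * expect q (fun s => Fintype.card ι *
          expect q (fun s' => (∑ x ∈ B, φ s' x * φ s x) ^ 2) +
            Fintype.card ι ^ 2 * (∑ x ∈ B, φ s x * μ x) ^ 2) := by
        gcongr
        exact expect_mono hq.nonneg hcross
    _ = _ := by
        rw [expect_add, expect_const_mul, expect_const_mul]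
        ring

lemma IsProb.expect_mean_mul_sub_sq_le (hq : IsProb q) (hμ : ∀ x, expect q (φ · x) = μ x) :
    expect (iid ι q) (fun S' => (Fintype.card ι * ∑ x ∈ B, μ x * ∑ j, φ (S' j) x -
      Fintype.card ι ^ 2 * ∑ x ∈ B, μ x ^ 2) ^ 2) ≤
    Fintype.card ι ^ 3 * expect q (fun s => (∑ x ∈ B, φ s x * μ x) ^ 2) := by
  have h := hq.expect_iid_sum_sub_sq_le (ι := ι) fun s => ∑ x ∈ B, φ s x * μ x
  rw [expect_sum_mul hμ] at h
  calc _ = Fintype.card ι ^ 2 * expect (iid ι q) (fun S' => (∑ j, ∑ x ∈ B, φ (S' j) x * μ x -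
          Fintype.card ι * ∑ x ∈ B, μ x * μ x) ^ 2) := by
        rw [← expect_const_mul]
        congr 1
        funext S'
        rw [← sum_sum_mul]
        simp only [mul_comm (μ _), sq (μ _)]
        ring
    _ ≤ Fintype.card ι ^ 2 * (Fintype.card ι * _) := by gcongr
    _ = _ := by ring

lemma IsProb.expect_collStat_sub_sq_le (hq : IsProb q) (hμ : ∀ x, expect q (φ · x) = μ x) :
    expect (prodWeight (iid ι q) (iid ι q)) (fun ω => (collStat φ B ω.1 ω.2 -
      Fintype.card ι ^ 2 * ∑ x ∈ B, μ x ^ 2) ^ 2) ≤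
    2 * Fintype.card ι ^ 2 *
        expect q (fun s => expect q fun s' => (∑ x ∈ B, φ s' x * φ s x) ^ 2) +
      4 * Fintype.card ι ^ 3 * expect q (fun s => (∑ x ∈ B, φ s x * μ x) ^ 2) := by
  set k : ℝ := (Fintype.card ι : ℝ)
  set D : (ι → Ω) → ℝ := fun S' => k * ∑ x ∈ B, μ x * ∑ j, φ (S' j) x
  rw [expect_prodWeight, expect_comm]
  calc _ ≤ expect (iid ι q) (fun S' => expect (iid ι q) fun S =>
          2 * (collStat φ B S S' - D S') ^ 2 + 2 * (D S' - k ^ 2 * ∑ x ∈ B, μ x ^ 2) ^ 2) := by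
        refine expect_mono hq.iid.nonneg fun S' => expect_mono hq.iid.nonneg fun S => ?_
        have h := add_sq_le (a := collStat φ B S S' - D S') (b := D S' - k ^ 2 * ∑ x ∈ B, μ x ^ 2)
        rwa [sub_add_sub_cancel, mul_add] at h
    _ = 2 * expect (iid ι q) (fun S' => expect (iid ι q) fun S => (collStat φ B S S' - D S') ^ 2) +
          2 * expect (iid ι q) (fun S' => (D S' - k ^ 2 * ∑ x ∈ B, μ x ^ 2) ^ 2) := by
        simp only [expect_add, expect_const_mul, hq.iid.expect_const]
    _ ≤ _ := add_le_add (mul_le_mul_of_nonneg_left (hq.expect_collStat_sub_left_le hμ) two_pos.le)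
        (mul_le_mul_of_nonneg_left (hq.expect_mean_mul_sub_sq_le hμ) two_pos.le)
    _ = _ := by ring

end Variance

variable {α γ : Type*}

lemma IsProb.expect_iid_marginals [Fintype α] [Fintype γ] {p : α × γ → ℝ} (hp : IsProb p)
    (f : α × γ → ℝ) :
    expect (iid (Fin 3) p) (fun s => f ((s 1).1, (s 2).2)) = expect (margProd p) f := by
  classical
  have hexpand : ∀ s : Fin 3 → α × γ, f ((s 1).1, (s 2).2) =
      ∑ x : α × γ, f x * ((if (s 1).1 = x.1 then 1 else 0) * if (s 2).2 = x.2 then 1 else 0) :=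
    fun s => by simp [Fintype.sum_prod_type]
  have hA : ∀ a, expect p (fun y => if y.1 = a then 1 else 0) = margA p a := fun a => by
    simp [expect, margA, Fintype.sum_prod_type_right]
  have hC : ∀ c, expect p (fun y => if y.2 = c then 1 else 0) = margC p c := fun c => by
    simp [expect, margC, Fintype.sum_prod_type]
  simp only [hexpand]
  rw [expect_sum, expect]
  refine Finset.sum_congr rfl fun x _ => ?_
  rw [expect_const_mul, hp.expect_iid_eval_mul (by decide : (1 : Fin 3) ≠ 2)
    (fun y => if y.1 = x.1 then 1 else 0) (fun y => if y.2 = x.2 then 1 else 0), hA, hC, mul_comm]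
  rfl

section DiffVec

variable [DecidableEq α] [DecidableEq γ]

/-- The signed indicator vector of a triple of samples: the first is a sample of the joint law, and
the other two simulate a sample of the product of the marginals. -/
def diffVec (s : Fin 3 → α × γ) (x : α × γ) : ℝ :=
  (if s 0 = x then 1 else 0) - if ((s 1).1, (s 2).2) = x then 1 else 0

lemma sum_diffVec_mul (s : Fin 3 → α × γ) (B : Finset (α × γ)) (v : α × γ → ℝ) :
    ∑ x ∈ B, diffVec s x * v x =
      (if s 0 ∈ B then v (s 0) else 0) -
        if ((s 1).1, (s 2).2) ∈ B then v ((s 1).1, (s 2).2) else 0 := by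
  simp only [diffVec, sub_mul, Finset.sum_sub_distrib, ite_mul, one_mul, zero_mul,
    Finset.sum_ite_eq]

variable [Fintype α] [Fintype γ] {p : α × γ → ℝ}

lemma IsProb.expect_diffVec (hp : IsProb p) (x : α × γ) :
    expect (iid (Fin 3) p) (fun s => diffVec s x) = p x - margProd p x := by
  simp only [diffVec]
  rw [expect_sub, hp.expect_iid_eval 0 fun y => if y = x then 1 else 0,
    hp.expect_iid_marginals fun y => if y = x then 1 else 0]
  simp [expect]

lemma IsProb.expect_diffVec_sq_le (hp : IsProb p) (x : α × γ) :
    expect (iid (Fin 3) p) (fun s => diffVec s x ^ 2) ≤ p x + margProd p x := by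
  have hle : ∀ s : Fin 3 → α × γ, diffVec s x ^ 2 ≤
      (if s 0 = x then 1 else 0) + if ((s 1).1, (s 2).2) = x then 1 else 0 := fun s => by
    unfold diffVec
    split_ifs <;> norm_num
  refine (expect_mono hp.iid.nonneg hle).trans_eq ?_
  rw [expect_add, hp.expect_iid_eval 0 fun y => if y = x then 1 else 0,
    hp.expect_iid_marginals fun y => if y = x then 1 else 0]
  simp [expect]

lemma IsProb.expect_sum_diffVec_mul_sq_le (hp : IsProb p) (B : Finset (α × γ)) (v : α × γ → ℝ) :
    expect (iid (Fin 3) p) (fun s => (∑ x ∈ B, diffVec s x * v x) ^ 2) ≤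
      2 * ∑ x ∈ B, (p x + margProd p x) * v x ^ 2 := by
  let g : α × γ → ℝ := fun x => if x ∈ B then v x else 0
  have hg : ∀ q : α × γ → ℝ, expect q (fun x => g x ^ 2) = ∑ x ∈ B, q x * v x ^ 2 := fun q => by
    simp [expect, g, ite_pow]
  calc _ ≤ expect (iid (Fin 3) p)
          (fun s => 2 * g (s 0) ^ 2 + 2 * g ((s 1).1, (s 2).2) ^ 2) := by
        refine expect_mono hp.iid.nonneg fun s => ?_
        rw [sum_diffVec_mul]
        change (g (s 0) - g ((s 1).1, (s 2).2)) ^ 2 ≤ _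
        nlinarith [sq_nonneg (g (s 0) + g ((s 1).1, (s 2).2))]
    _ = 2 * ∑ x ∈ B, p x * v x ^ 2 + 2 * ∑ x ∈ B, margProd p x * v x ^ 2 := by
        rw [expect_add, expect_const_mul, expect_const_mul,
          hp.expect_iid_eval 0 fun x => g x ^ 2, hp.expect_iid_marginals fun x => g x ^ 2, hg, hg]
    _ = _ := by simp only [← mul_add, ← Finset.sum_add_distrib, ← add_mul]

lemma IsProb.expect_sum_diffVec_mul_diffVec_sq_le (hp : IsProb p) (B : Finset (α × γ)) :
    expect (iid (Fin 3) p) (fun s => expect (iid (Fin 3) p) fun s' =>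
      (∑ x ∈ B, diffVec s' x * diffVec s x) ^ 2) ≤ 2 * ∑ x ∈ B, (p x + margProd p x) ^ 2 := by
  calc _ ≤ expect (iid (Fin 3) p)
          (fun s => 2 * ∑ x ∈ B, (p x + margProd p x) * diffVec s x ^ 2) :=
        expect_mono hp.iid.nonneg fun s => hp.expect_sum_diffVec_mul_sq_le B (diffVec s)
    _ = 2 * ∑ x ∈ B, (p x + margProd p x) * expect (iid (Fin 3) p) (fun s => diffVec s x ^ 2) := by
        simp only [expect_const_mul, expect_sum]
    _ ≤ 2 * ∑ x ∈ B, (p x + margProd p x) * (p x + margProd p x) := by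
        gcongr with x
        · exact add_nonneg (hp.nonneg x) (hp.margProd.nonneg x)
        · exact hp.expect_diffVec_sq_le x
    _ = _ := by simp only [sq]

lemma sum_mul_sq_le_sqrt_mul {X : Type*} (B : Finset X) (f g : X → ℝ) :
    ∑ x ∈ B, f x * g x ^ 2 ≤ √(∑ x ∈ B, f x ^ 2) * ∑ x ∈ B, g x ^ 2 := by
  refine (Real.sum_mul_le_sqrt_mul_sqrt B _ _).trans ?_
  gcongr
  rw [Real.sqrt_le_left (Finset.sum_nonneg fun x _ => sq_nonneg _)]
  exact Finset.sum_sq_le_sq_sum_of_nonneg fun x _ => sq_nonneg _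

lemma IsProb.expect_collStat_diffVec_sub_sq_le (hp : IsProb p) (k : ℕ) (B : Finset (α × γ))
    {V S : ℝ} (hV : V = ∑ x ∈ B, (p x + margProd p x) ^ 2)
    (hS : S = ∑ x ∈ B, (p x - margProd p x) ^ 2) :
    expect (prodWeight (iid (Fin k) (iid (Fin 3) p)) (iid (Fin k) (iid (Fin 3) p)))
      (fun ω => (collStat diffVec B ω.1 ω.2 - k ^ 2 * S) ^ 2) ≤
      4 * k ^ 2 * V + 8 * k ^ 3 * (√V * S) := by
  have hvar := hp.iid.expect_collStat_sub_sq_le (ι := Fin k) (B := B)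
    (hp.expect_diffVec (α := α) (γ := γ))
  rw [Fintype.card_fin, ← hS] at hvar
  have hself := hp.expect_sum_diffVec_mul_diffVec_sq_le B
  have hmean := (hp.expect_sum_diffVec_mul_sq_le B fun x => p x - margProd p x).trans
    (mul_le_mul_of_nonneg_left (sum_mul_sq_le_sqrt_mul B _ _) two_pos.le)
  rw [← hV] at hself hmean
  rw [← hS] at hmean
  calc _ ≤ 2 * k ^ 2 * (2 * V) + 4 * k ^ 3 * (2 * (√V * S)) := hvar.trans (by gcongr)
    _ = _ := by ring

end DiffVec

end Collision

section Hits

open Classical in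
/-- The number of samples in `A`. -/
def hits {ι α : Type*} [Fintype ι] (A : α → Prop) (s : ι → α) : ℕ :=
  (Finset.univ.filter fun i => A (s i)).card

variable {ι α : Type*} [Fintype ι] {p : α → ℝ}

lemma hits_le_card (A : α → Prop) (s : ι → α) : hits A s ≤ Fintype.card ι :=
  Finset.card_le_univ _

lemma hits_eq_sum (A : α → Prop) [DecidablePred A] (s : ι → α) :
    (hits A s : ℝ) = ∑ i, if A (s i) then 1 else 0 := by
  rw [Finset.sum_boole, hits]
  congr!

lemma inv_one_add_sq_le {x t : ℝ} (hx : 0 ≤ x) (ht : 0 < t) :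
    ((1 + x) ^ 2)⁻¹ ≤ (t ^ 2)⁻¹ + Real.exp (t - x) := by
  rcases le_or_gt t x with h | h
  · have : ((1 + x) ^ 2)⁻¹ ≤ (t ^ 2)⁻¹ := by gcongr; linarith
    linarith [Real.exp_pos (t - x)]
  · have hle : ((1 + x) ^ 2)⁻¹ ≤ 1 := inv_le_one_of_one_le₀ (one_le_pow₀ (by linarith))
    have hexp : 1 ≤ Real.exp (t - x) := Real.one_le_exp (by linarith)
    have : 0 ≤ (t ^ 2)⁻¹ := by positivity
    linarith

variable [DecidableEq ι] [Fintype α]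

lemma IsProb.expect_hits (hp : IsProb p) (A : α → Prop) :
    expect (iid ι p) (fun s => (hits A s : ℝ)) = Fintype.card ι * prob p A := by
  classical
  simp only [hits_eq_sum]
  exact hp.expect_iid_sum (ι := ι) fun x => if A x then 1 else 0

lemma IsProb.expect_exp_neg_hits_le (hp : IsProb p) (A : α → Prop) :
    expect (iid ι p) (fun s => Real.exp (-(hits A s : ℝ))) ≤
      Real.exp (-(Fintype.card ι * prob p A / 2)) := by
  classical
  have hfactor : ∀ s : ι → α, Real.exp (-(hits A s : ℝ)) =
      ∏ i, Real.exp (-if A (s i) then 1 else 0) := fun s => by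
    rw [← Real.exp_sum, Finset.sum_neg_distrib, hits_eq_sum]
  have hone : ∀ x, Real.exp (-if A x then 1 else 0) ≤ 1 - (if A x then 1 else 0) * (1 / 2) :=
    fun x => by
      split_ifs
      · have : (Real.exp 1)⁻¹ ≤ 2⁻¹ := inv_anti₀ two_pos (by linarith [Real.exp_one_gt_d9])
        rw [Real.exp_neg]
        linarith
      · simp
  have hsingle : expect p (fun x => Real.exp (-if A x then 1 else 0)) ≤
      Real.exp (-(prob p A / 2)) := by
    calc _ ≤ 1 - prob p A * (1 / 2) := by
          refine (expect_mono hp.nonneg hone).trans_eq ?_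
          rw [expect_sub, hp.expect_const, expect_mul_const]
          rfl
      _ ≤ _ := by linarith [Real.add_one_le_exp (-(prob p A / 2))]
  simp only [hfactor]
  rw [expect_iid_prod fun _ x => Real.exp (-if A x then 1 else 0), Finset.prod_const,
    Finset.card_univ]
  calc _ ≤ Real.exp (-(prob p A / 2)) ^ Fintype.card ι :=
        pow_le_pow_left₀ (expect_nonneg hp.nonneg fun x => (Real.exp_pos _).le) hsingle _
    _ = _ := by
        rw [← Real.exp_nat_mul]
        congr 1
        ring

lemma IsProb.expect_inv_one_add_hits_sq_le_one (hp : IsProb p) (A : α → Prop) :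
    expect (iid ι p) (fun s => ((1 + (hits A s : ℝ)) ^ 2)⁻¹) ≤ 1 := by
  refine (expect_mono hp.iid.nonneg fun s => inv_le_one_of_one_le₀ (one_le_pow₀ ?_)).trans_eq
    (hp.iid.expect_const 1)
  linarith [(hits A s).cast_nonneg (α := ℝ)]

variable [Nonempty ι]

/- With `t` a quarter of the mean number of hits, the lower tail of `hits A` costs at most
`exp (-t) ≤ 2 / t ^ 2`. -/
lemma IsProb.sq_prob_mul_expect_inv_one_add_hits_sq_le (hp : IsProb p) (A : α → Prop) :
    prob p A ^ 2 * expect (iid ι p) (fun s => ((1 + (hits A s : ℝ)) ^ 2)⁻¹) ≤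
      48 / Fintype.card ι ^ 2 := by
  rcases (prob_nonneg hp.nonneg A).eq_or_lt with h0 | h0
  · rw [← h0, zero_pow two_ne_zero, zero_mul]
    positivity
  obtain ⟨t, ht⟩ : ∃ t : ℝ, t = Fintype.card ι * prob p A / 4 := ⟨_, rfl⟩
  have ht0 : 0 < t := ht ▸ by positivity
  have htail : expect (iid ι p) (fun s => Real.exp (t - hits A s)) ≤ 2 * (t ^ 2)⁻¹ := by
    calc _ = Real.exp t * expect (iid ι p) (fun s => Real.exp (-(hits A s : ℝ))) := by
          simp only [← expect_const_mul, ← Real.exp_add, sub_eq_add_neg]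
      _ ≤ Real.exp t * Real.exp (-(Fintype.card ι * prob p A / 2)) := by
          gcongr
          exact hp.expect_exp_neg_hits_le A
      _ = (Real.exp t)⁻¹ := by
          rw [← Real.exp_add, ← Real.exp_neg, ht]
          congr 1
          ring
      _ ≤ (t ^ 2 / 2)⁻¹ :=
          inv_anti₀ (by positivity) (by linarith [Real.quadratic_le_exp_of_nonneg ht0.le])
      _ = 2 * (t ^ 2)⁻¹ := by rw [inv_div, div_eq_mul_inv]
  have hmain : expect (iid ι p) (fun s => ((1 + (hits A s : ℝ)) ^ 2)⁻¹) ≤ 3 * (t ^ 2)⁻¹ := by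
    have h := expect_mono (hp.iid (ι := ι)).nonneg fun s =>
      inv_one_add_sq_le (hits A s).cast_nonneg ht0
    rw [expect_add, hp.iid.expect_const] at h
    linarith
  calc _ ≤ prob p A ^ 2 * (3 * (t ^ 2)⁻¹) := by gcongr
    _ = _ := by rw [ht]; field_simp; norm_num

lemma IsProb.sq_prob_mul_expect_inv_one_add_hits_sq_le_prob (hp : IsProb p) (A : α → Prop) :
    prob p A ^ 2 * expect (iid ι p) (fun s => ((1 + (hits A s : ℝ)) ^ 2)⁻¹) ≤
      48 * prob p A / Fintype.card ι := by
  have hk : (0 : ℝ) < Fintype.card ι := by exact_mod_cast Fintype.card_pos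
  have hr := prob_nonneg hp.nonneg A
  rcases le_or_gt 1 (Fintype.card ι * prob p A) with h | h
  · refine (hp.sq_prob_mul_expect_inv_one_add_hits_sq_le A).trans ?_
    rw [div_le_div_iff₀ (by positivity) hk]
    nlinarith
  · calc _ ≤ prob p A ^ 2 * 1 := by
          gcongr
          exact hp.expect_inv_one_add_hits_sq_le_one A
      _ ≤ _ := by
          rw [le_div_iff₀ hk]
          nlinarith

lemma IsProb.sum_sq_prob_mul_expect_inv_one_add_hits_sq_le {β : Type*} [Fintype β] (hp : IsProb p)
    (f : α → β) :
    ∑ b, prob p (f · = b) ^ 2 * expect (iid ι p) (fun s => ((1 + (hits (f · = b) s : ℝ)) ^ 2)⁻¹) ≤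
      48 * min (Fintype.card β : ℝ) (Fintype.card ι) / Fintype.card ι ^ 2 := by
  classical
  rcases min_cases (Fintype.card β : ℝ) (Fintype.card ι) with ⟨h, _⟩ | ⟨h, _⟩
  · rw [h]
    calc _ ≤ ∑ _b : β, (48 : ℝ) / Fintype.card ι ^ 2 :=
          Finset.sum_le_sum fun b _ => hp.sq_prob_mul_expect_inv_one_add_hits_sq_le _
      _ = _ := by
          rw [Finset.sum_const, Finset.card_univ, nsmul_eq_mul]
          ring
  · rw [h]
    have htotal : ∑ b, prob p (f · = b) = 1 := by
      simp only [prob, ← expect_sum, Finset.sum_ite_eq, Finset.mem_univ, if_true, hp.expect_const]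
    calc _ ≤ ∑ b, 48 * prob p (f · = b) / Fintype.card ι :=
          Finset.sum_le_sum fun b _ => hp.sq_prob_mul_expect_inv_one_add_hits_sq_le_prob _
      _ = _ := by
          rw [← Finset.sum_div, ← Finset.mul_sum, htotal]
          field_simp

end Hits

section CellCount

variable {ι α γ : Type*} [Fintype ι] {p : α × γ → ℝ}

/-- An estimate, up to the factor `k ^ 2` for batches of `k` samples, of the mass of a cell under
the product of the marginals: the number of hits of its row in a first batch times that of its
column in a second one, each count increased by one to keep it positive. -/
def cellCount (ω : (ι → α × γ) × (ι → α × γ)) (x : α × γ) : ℕ :=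
  (1 + hits (·.1 = x.1) ω.1) * (1 + hits (·.2 = x.2) ω.2)

lemma cellCount_pos (ω : (ι → α × γ) × (ι → α × γ)) (x : α × γ) : 0 < cellCount ω x :=
  Nat.mul_pos (by omega) (by omega)

lemma cellCount_le (ω : (ι → α × γ) × (ι → α × γ)) (x : α × γ) :
    cellCount ω x ≤ (Fintype.card ι + 1) ^ 2 := by
  rw [sq, add_comm (Fintype.card ι)]
  exact Nat.mul_le_mul (Nat.add_le_add_left (hits_le_card _ _) 1)
    (Nat.add_le_add_left (hits_le_card _ _) 1)

variable [Fintype α] [Fintype γ]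

lemma prob_fst_eq (a : α) : prob p (·.1 = a) = margA p a := by
  classical
  rw [prob, expect, Fintype.sum_prod_type_right]
  simp [margA]

lemma prob_snd_eq (c : γ) : prob p (·.2 = c) = margC p c := by
  classical
  rw [prob, expect, Fintype.sum_prod_type]
  simp [margC]

variable [DecidableEq ι]

lemma IsProb.expect_cellCount (hp : IsProb p) (x : α × γ) :
    expect (prodWeight (iid ι p) (iid ι p)) (fun ω => (cellCount ω x : ℝ)) =
      (1 + Fintype.card ι * margA p x.1) * (1 + Fintype.card ι * margC p x.2) := by
  rw [expect_prodWeight]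
  simp only [cellCount, Nat.cast_mul, Nat.cast_add, Nat.cast_one, expect_const_mul,
    expect_mul_const, expect_add, hp.iid.expect_const, hp.expect_hits, prob_fst_eq, prob_snd_eq]

lemma expect_sum_sq_div_cellCount_sq :
    expect (prodWeight (iid ι p) (iid ι p))
      (fun ω => ∑ x, margProd p x ^ 2 / (cellCount ω x : ℝ) ^ 2) =
      (∑ a, margA p a ^ 2 *
        expect (iid ι p) (fun s => ((1 + (hits (·.1 = a) s : ℝ)) ^ 2)⁻¹)) *
      ∑ c, margC p c ^ 2 *
        expect (iid ι p) (fun s => ((1 + (hits (·.2 = c) s : ℝ)) ^ 2)⁻¹) := by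
  have hfactor : ∀ (ω : (ι → α × γ) × (ι → α × γ)) a c,
      margProd p (a, c) ^ 2 / (cellCount ω (a, c) : ℝ) ^ 2 = margA p a ^ 2 * margC p c ^ 2 *
        (((1 + (hits (·.1 = a) ω.1 : ℝ)) ^ 2)⁻¹ * ((1 + (hits (·.2 = c) ω.2 : ℝ)) ^ 2)⁻¹) :=
    fun ω a c => by
      simp only [cellCount, margProd, prodWeight, Nat.cast_mul, Nat.cast_add, Nat.cast_one]
      field_simp
  rw [expect_sum, Fintype.sum_prod_type, Finset.sum_mul_sum]
  refine Finset.sum_congr rfl fun a _ => Finset.sum_congr rfl fun c _ => ?_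
  simp only [hfactor]
  rw [expect_const_mul, expect_prodWeight]
  simp only [expect_const_mul, expect_mul_const]
  ring

lemma IsProb.expect_sum_sq_div_cellCount_sq_le [Nonempty ι] (hp : IsProb p) :
    expect (prodWeight (iid ι p) (iid ι p))
      (fun ω => ∑ x, margProd p x ^ 2 / (cellCount ω x : ℝ) ^ 2) ≤
      2304 * (Fintype.card γ * min (Fintype.card α : ℝ) (Fintype.card ι) /
        Fintype.card ι ^ 4) := by
  have hrow := hp.sum_sq_prob_mul_expect_inv_one_add_hits_sq_le (ι := ι) Prod.fst
  have hcol := hp.sum_sq_prob_mul_expect_inv_one_add_hits_sq_le (ι := ι) Prod.snd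
  simp only [prob_fst_eq] at hrow
  simp only [prob_snd_eq] at hcol
  have hcol0 : 0 ≤ ∑ c, margC p c ^ 2 *
      expect (iid ι p) (fun s => ((1 + (hits (·.2 = c) s : ℝ)) ^ 2)⁻¹) :=
    Finset.sum_nonneg fun c _ =>
      mul_nonneg (sq_nonneg _) (expect_nonneg hp.iid.nonneg fun s => by positivity)
  rw [expect_sum_sq_div_cellCount_sq]
  calc _ ≤ 48 * min (Fintype.card α : ℝ) (Fintype.card ι) / Fintype.card ι ^ 2 *
          (48 * Fintype.card γ / Fintype.card ι ^ 2) := by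
        refine mul_le_mul hrow (hcol.trans ?_) hcol0 (by positivity)
        gcongr
        exact min_le_left _ _
    _ = _ := by
        field_simp
        ring

end CellCount

section DyadicLevel

variable {X : Type*} [Fintype X] {c : X → ℕ} {j : ℕ}

/-- The points at which `c` lies in the dyadic interval `[2 ^ j, 2 ^ (j + 1))`. -/
def dyadicLevel (c : X → ℕ) (j : ℕ) : Finset X := Finset.univ.filter fun x => Nat.log 2 (c x) = j

lemma two_pow_le_of_mem_dyadicLevel (hc : ∀ x, 0 < c x) {x : X} (h : x ∈ dyadicLevel c j) :
    (2 : ℝ) ^ j ≤ c x := by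
  obtain rfl := (Finset.mem_filter.1 h).2
  exact_mod_cast Nat.pow_log_le_self 2 (hc x).ne'

lemma le_two_mul_two_pow_of_mem_dyadicLevel {x : X} (h : x ∈ dyadicLevel c j) :
    (c x : ℝ) ≤ 2 * 2 ^ j := by
  obtain rfl := (Finset.mem_filter.1 h).2
  rw [← pow_succ']
  exact_mod_cast (Nat.lt_pow_succ_log_self one_lt_two (c x)).le

lemma sum_dyadicLevel_sq_le (hc : ∀ x, 0 < c x) (f : X → ℝ) :
    ∑ x ∈ dyadicLevel c j, f x ^ 2 ≤ 4 * (2 ^ j) ^ 2 * ∑ x, f x ^ 2 / (c x : ℝ) ^ 2 := by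
  rw [Finset.mul_sum]
  refine (Finset.sum_le_sum fun x hx => ?_).trans
    (Finset.sum_le_univ_sum_of_nonneg fun x => by positivity)
  have hcx : (0 : ℝ) < c x := by exact_mod_cast hc x
  calc f x ^ 2 = (c x : ℝ) ^ 2 * (f x ^ 2 / (c x : ℝ) ^ 2) := by field_simp
    _ ≤ (2 * 2 ^ j) ^ 2 * (f x ^ 2 / (c x : ℝ) ^ 2) := by
        gcongr
        exact le_two_mul_two_pow_of_mem_dyadicLevel hx
    _ = _ := by ring

lemma two_pow_mul_sum_dyadicLevel_div_le (hc : ∀ x, 0 < c x) {f : X → ℝ} (hf : ∀ x, 0 ≤ f x) :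
    2 ^ j * ∑ x ∈ dyadicLevel c j, f x / c x ≤ ∑ x ∈ dyadicLevel c j, f x := by
  rw [Finset.mul_sum]
  refine Finset.sum_le_sum fun x hx => ?_
  have hcx : (0 : ℝ) < c x := by exact_mod_cast hc x
  rw [mul_div_assoc', div_le_iff₀ hcx, mul_comm]
  exact mul_le_mul_of_nonneg_left (two_pow_le_of_mem_dyadicLevel hc hx) (hf x)

lemma exists_sum_div_le_sum_dyadicLevel [DecidableEq X] {b : ℕ} (hc : ∀ x, 0 < c x)
    (hb : ∀ x, c x < 2 ^ b) (hb0 : b ≠ 0) (Y : Finset X) (f : X → ℝ) :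
    ∃ j ∈ Finset.range b, (∑ x ∈ Y, f x) / b ≤ ∑ x ∈ Y ∩ dyadicLevel c j, f x := by
  have hmaps : ∀ x ∈ Y, Nat.log 2 (c x) ∈ Finset.range b := fun x _ =>
    Finset.mem_range.2 (Nat.log_lt_of_lt_pow (hc x).ne' (hb x))
  have hcard : (Finset.range b).card • ((∑ x ∈ Y, f x) / b) ≤ ∑ x ∈ Y, f x := by
    rw [Finset.card_range, nsmul_eq_mul, mul_div_cancel₀ _ (Nat.cast_ne_zero.2 hb0)]
  obtain ⟨j, hj, hle⟩ := Finset.exists_le_sum_fiber_of_maps_to_of_nsmul_le_sum hmaps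
    (Finset.nonempty_range_iff.2 hb0) hcard
  exact ⟨j, hj, hle.trans_eq (Finset.sum_congr (by ext x; simp [dyadicLevel]) fun _ _ => rfl)⟩

end DyadicLevel

section Tester

variable {α γ : Type*} [Fintype α] [Fintype γ] {p : α × γ → ℝ} {k b j : ℕ} {τ v : ℝ}

/-- The joint weight of two batches of `k` triples of samples. -/
def tripleWeight (k : ℕ) (p : α × γ → ℝ) :
    (Fin k → Fin 3 → α × γ) × (Fin k → Fin 3 → α × γ) → ℝ :=
  prodWeight (iid (Fin k) (iid (Fin 3) p)) (iid (Fin k) (iid (Fin 3) p))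

lemma isProb_tripleWeight (hp : IsProb p) : IsProb (tripleWeight k p) :=
  hp.iid.iid.prodWeight hp.iid.iid

variable [DecidableEq α] [DecidableEq γ] {c : α × γ → ℕ}

/-- The acceptance condition of the collision test run on two batches of triples: on none of the
first `b` dyadic levels of `c` is the estimate `collStat / k ^ 2` of the squared `ℓ²` distance to
the product of the marginals above a threshold proportional to the size `2 ^ j` of `c` there. -/
def Accepts (b : ℕ) (τ : ℝ) (c : α × γ → ℕ)
    (S : (Fin k → Fin 3 → α × γ) × (Fin k → Fin 3 → α × γ)) : Prop :=
  ∀ j ∈ Finset.range b, collStat diffVec (dyadicLevel c j) S.1 S.2 ≤ k ^ 2 * (2 ^ j * τ)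

lemma IsProb.prob_lt_collStat_le (hp : IsProb p) (hprod : ∀ x, p x = margProd p x) (hk : 0 < k)
    (hτ : 0 < τ) (hc : ∀ x, 0 < c x) (hv : ∑ x, margProd p x ^ 2 / (c x : ℝ) ^ 2 ≤ v) :
    prob (tripleWeight k p)
      (fun S => k ^ 2 * (2 ^ j * τ) < collStat diffVec (dyadicLevel c j) S.1 S.2) ≤
      64 * v / (k ^ 2 * τ ^ 2) := by
  have hV : ∑ x ∈ dyadicLevel c j, (p x + margProd p x) ^ 2 ≤ 16 * (2 ^ j) ^ 2 * v := by
    calc _ = 4 * ∑ x ∈ dyadicLevel c j, margProd p x ^ 2 := by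
          rw [Finset.mul_sum]
          exact Finset.sum_congr rfl fun x _ => by rw [hprod x]; ring
      _ ≤ 4 * (4 * (2 ^ j) ^ 2 * v) := by
          gcongr
          exact (sum_dyadicLevel_sq_le hc _).trans (by gcongr)
      _ = _ := by ring
  have hS : 0 = ∑ x ∈ dyadicLevel c j, (p x - margProd p x) ^ 2 := by simp [← hprod]
  have hvar := hp.expect_collStat_diffVec_sub_sq_le k (dyadicLevel c j) rfl hS
  have hcheb := prob_abs_sub_ge_le (isProb_tripleWeight (k := k) hp).nonneg
    (fun S => collStat diffVec (dyadicLevel c j) S.1 S.2) (k ^ 2 * 0)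
    (t := (k : ℝ) ^ 2 * (2 ^ j * τ)) (by positivity)
  refine (prob_mono (isProb_tripleWeight hp).nonneg fun S hlt => ?_).trans (hcheb.trans ?_)
  · rw [mul_zero, sub_zero]
    exact hlt.le.trans (le_abs_self _)
  · rw [div_le_iff₀ (by positivity)]
    calc _ ≤ 4 * (k : ℝ) ^ 2 * (16 * (2 ^ j) ^ 2 * v) := by
          refine hvar.trans ?_
          rw [mul_zero, mul_zero, add_zero]
          gcongr
      _ = _ := by field_simp; ring

lemma IsProb.prob_not_accepts_le (hp : IsProb p) (hprod : ∀ x, p x = margProd p x) (hk : 0 < k)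
    (hτ : 0 < τ) (hc : ∀ x, 0 < c x) (hv : ∑ x, margProd p x ^ 2 / (c x : ℝ) ^ 2 ≤ v)
    (hvτ : 640 * b * v ≤ k ^ 2 * τ ^ 2) :
    prob (tripleWeight k p) (fun S => ¬ Accepts b τ c S) ≤ 1 / 10 := by
  simp only [Accepts, not_forall, not_le, exists_prop]
  refine (prob_exists_le (isProb_tripleWeight hp).nonneg _ _).trans ?_
  calc _ ≤ ∑ _j ∈ Finset.range b, 64 * v / (k ^ 2 * τ ^ 2) :=
        Finset.sum_le_sum fun j _ => hp.prob_lt_collStat_le hprod hk hτ hc hv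
    _ ≤ 1 / 10 := by
        rw [Finset.sum_const, Finset.card_range, nsmul_eq_mul, mul_div_assoc',
          div_le_div_iff₀ (by positivity) (by norm_num)]
        linarith

lemma IsProb.prob_collStat_le_half_le (hp : IsProb p) (hk : 0 < k) (B : Finset (α × γ)) {S : ℝ}
    (hS : S = ∑ x ∈ B, (p x - margProd p x) ^ 2) (hS0 : 0 < S)
    (hV : ∑ x ∈ B, (p x + margProd p x) ^ 2 ≤ (k * S / 500) ^ 2) :
    prob (tripleWeight k p) (fun W => collStat diffVec B W.1 W.2 ≤ k ^ 2 * S / 2) ≤ 1 / 10 := by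
  have hvar := hp.expect_collStat_diffVec_sub_sq_le k B rfl hS
  have hsqrt := (Real.sqrt_le_sqrt hV).trans_eq (Real.sqrt_sq (by positivity))
  have hcheb := prob_abs_sub_ge_le (isProb_tripleWeight (k := k) hp).nonneg
    (fun W => collStat diffVec B W.1 W.2) (k ^ 2 * S) (t := (k : ℝ) ^ 2 * S / 2) (by positivity)
  refine (prob_mono (isProb_tripleWeight hp).nonneg fun W hW => ?_).trans (hcheb.trans ?_)
  · rw [abs_sub_comm]
    exact le_trans (by linarith) (le_abs_self _)
  · rw [div_le_iff₀ (by positivity)]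
    calc _ ≤ 4 * k ^ 2 * (k * S / 500) ^ 2 + 8 * k ^ 3 * (k * S / 500 * S) :=
          hvar.trans (by gcongr)
      _ = (4 / 250000 + 8 / 500) * ((k : ℝ) ^ 4 * S ^ 2) := by ring
      _ ≤ 1 / 40 * ((k : ℝ) ^ 4 * S ^ 2) := by gcongr; norm_num
      _ = _ := by ring

lemma sum_add_sq_le_add_sum_sub_sq {X : Type*} (B : Finset X) (f g : X → ℝ) :
    ∑ x ∈ B, (f x + g x) ^ 2 ≤ 8 * ∑ x ∈ B, g x ^ 2 + 2 * ∑ x ∈ B, (f x - g x) ^ 2 := by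
  rw [Finset.mul_sum, Finset.mul_sum, ← Finset.sum_add_distrib]
  exact Finset.sum_le_sum fun x _ => by nlinarith [sq_nonneg (f x - 3 * g x)]

lemma IsProb.prob_accepts_le (hp : IsProb p) (hk : 0 < k) (hτ : 0 < τ) (hc : ∀ x, 0 < c x)
    (hv : ∑ x, margProd p x ^ 2 / (c x : ℝ) ^ 2 ≤ v) (hvτ : 4000000 * v ≤ k ^ 2 * τ ^ 2)
    (hj : j ∈ Finset.range b) {S : ℝ}
    (hS : S = ∑ x ∈ dyadicLevel c j, (p x - margProd p x) ^ 2)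
    (hSτ : 2 * (2 ^ j * τ) ≤ S) (hkS : 1000000 ≤ k ^ 2 * S) :
    prob (tripleWeight k p) (fun W => Accepts b τ c W) ≤ 1 / 10 := by
  have hS0 : 0 < S := lt_of_lt_of_le (by positivity) hSτ
  have hV : ∑ x ∈ dyadicLevel c j, (p x + margProd p x) ^ 2 ≤ (k * S / 500) ^ 2 := by
    calc _ ≤ 8 * ∑ x ∈ dyadicLevel c j, margProd p x ^ 2 + 2 * S :=
          hS ▸ sum_add_sq_le_add_sum_sub_sq _ _ _
      _ ≤ 8 * (4 * (2 ^ j) ^ 2 * v) + 2 * S := by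
          gcongr
          exact (sum_dyadicLevel_sq_le hc _).trans (by gcongr)
      _ = 8 / 1000000 * (2 ^ j) ^ 2 * (4000000 * v) + 2 / 1000000 * (1000000 * S) := by ring
      _ ≤ 8 / 1000000 * (2 ^ j) ^ 2 * (k ^ 2 * τ ^ 2) + 2 / 1000000 * (k ^ 2 * S * S) := by gcongr
      _ = 2 / 1000000 * k ^ 2 * (2 * (2 ^ j * τ)) ^ 2 + 2 / 1000000 * (k ^ 2 * S * S) := by ring
      _ ≤ 2 / 1000000 * k ^ 2 * S ^ 2 + 2 / 1000000 * (k ^ 2 * S * S) := by gcongr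
      _ = _ := by ring
  refine (prob_mono (isProb_tripleWeight hp).nonneg fun W hW => (hW j hj).trans ?_).trans
    (hp.prob_collStat_le_half_le hk _ hS hS0 hV)
  rw [mul_div_assoc]
  gcongr
  linarith

end Tester

section Signal

variable {α γ : Type*} [Fintype α] [Fintype γ] {p : α × γ → ℝ}

lemma IsProb.triDisc_margProd_nonneg (hp : IsProb p) (x : α × γ) :
    0 ≤ triDisc (p x) (margProd p x) :=
  triDisc_nonneg (hp.nonneg x) (hp.margProd.nonneg x)

lemma IsProb.triDisc_margProd_sq_le (hp : IsProb p) (x : α × γ) :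
    triDisc (p x) (margProd p x) ^ 2 ≤ (p x - margProd p x) ^ 2 := by
  rw [← sq_abs (p x - margProd p x)]
  exact pow_le_pow_left₀ (hp.triDisc_margProd_nonneg x)
    (triDisc_le_abs (hp.nonneg x) (hp.margProd.nonneg x)) 2

variable [DecidableEq α] [DecidableEq γ] {k b j : ℕ} {τ v y : ℝ} {c : α × γ → ℕ}
  {X : Finset (α × γ)}

lemma IsProb.sq_le_sum_dyadicLevel_mul_card (hp : IsProb p) (hy : 0 ≤ y)
    (h : y ≤ ∑ x ∈ X ∩ dyadicLevel c j, triDisc (p x) (margProd p x)) :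
    y ^ 2 ≤ (∑ x ∈ dyadicLevel c j, (p x - margProd p x) ^ 2) *
      (Fintype.card α * Fintype.card γ) := by
  have hcauchy := Finset.sum_sq_le_sum_mul_sum_of_sq_le_mul (X ∩ dyadicLevel c j)
    (r := fun x => triDisc (p x) (margProd p x)) (f := fun x => (p x - margProd p x) ^ 2)
    (g := fun _ => (1 : ℝ)) (fun x _ => sq_nonneg _) (fun x _ => zero_le_one)
    (fun x _ => by rw [mul_one]; exact hp.triDisc_margProd_sq_le x)
  refine (pow_le_pow_left₀ hy h 2).trans (hcauchy.trans ?_)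
  refine mul_le_mul ?_ ?_ (by simp) (Finset.sum_nonneg fun x _ => sq_nonneg _)
  · exact Finset.sum_le_sum_of_subset_of_nonneg Finset.inter_subset_right fun x _ _ => sq_nonneg _
  · rw [Finset.sum_const, nsmul_eq_mul, mul_one, ← Nat.cast_mul, ← Fintype.card_prod]
    exact_mod_cast Finset.card_le_univ _

variable {g : α × γ → ℝ} {G : ℝ}

lemma two_pow_mul_sq_le_sum_dyadicLevel_mul (hc : ∀ x, 0 < c x) (hg0 : ∀ x, 0 ≤ g x)
    (hg : ∀ x, triDisc (p x) (margProd p x) ^ 2 ≤ (p x - margProd p x) ^ 2 * g x)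
    (hG : ∑ x ∈ X, c x * g x ≤ G) (hy : 0 ≤ y)
    (h : y ≤ ∑ x ∈ X ∩ dyadicLevel c j, triDisc (p x) (margProd p x)) :
    2 ^ j * y ^ 2 ≤ (∑ x ∈ dyadicLevel c j, (p x - margProd p x) ^ 2) * G := by
  have hcx : ∀ x, (0 : ℝ) < c x := fun x => by exact_mod_cast hc x
  have hdiv0 : ∀ x, 0 ≤ (p x - margProd p x) ^ 2 / c x := fun x => by positivity
  have hcg0 : ∀ x, 0 ≤ c x * g x := fun x => mul_nonneg (hcx x).le (hg0 x)
  have hcauchy := Finset.sum_sq_le_sum_mul_sum_of_sq_le_mul (X ∩ dyadicLevel c j)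
    (r := fun x => triDisc (p x) (margProd p x))
    (f := fun x => (p x - margProd p x) ^ 2 / c x) (g := fun x => c x * g x)
    (fun x _ => hdiv0 x) (fun x _ => hcg0 x)
    (fun x _ => (hg x).trans_eq (by have := hcx x; field_simp))
  calc 2 ^ j * y ^ 2
      ≤ 2 ^ j * ((∑ x ∈ X ∩ dyadicLevel c j, (p x - margProd p x) ^ 2 / c x) *
          ∑ x ∈ X ∩ dyadicLevel c j, c x * g x) := by
        gcongr
        exact (pow_le_pow_left₀ hy h 2).trans hcauchy
    _ ≤ 2 ^ j * ((∑ x ∈ dyadicLevel c j, (p x - margProd p x) ^ 2 / c x) *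
          ∑ x ∈ X, c x * g x) := by
        gcongr
        · exact Finset.sum_nonneg fun x _ => hcg0 x
        · exact Finset.inter_subset_right
        · exact fun x _ _ => hcg0 x
        · exact Finset.inter_subset_left
    _ = 2 ^ j * (∑ x ∈ dyadicLevel c j, (p x - margProd p x) ^ 2 / c x) *
          ∑ x ∈ X, c x * g x := (mul_assoc _ _ _).symm
    _ ≤ _ := by
        gcongr
        · exact Finset.sum_nonneg fun x _ => hcg0 x
        · exact two_pow_mul_sum_dyadicLevel_div_le hc fun x => sq_nonneg _

lemma IsProb.prob_accepts_le_of_sum_triDisc (hp : IsProb p) (hk : 0 < k) (hτ : 0 < τ)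
    (hb : b ≠ 0) (hc : ∀ x, 0 < c x) (hcb : ∀ x, c x < 2 ^ b)
    (hv : ∑ x, margProd p x ^ 2 / (c x : ℝ) ^ 2 ≤ v) (hvτ : 4000000 * v ≤ k ^ 2 * τ ^ 2)
    (hg0 : ∀ x, 0 ≤ g x)
    (hg : ∀ x, triDisc (p x) (margProd p x) ^ 2 ≤ (p x - margProd p x) ^ 2 * g x)
    (hG : ∑ x ∈ X, c x * g x ≤ G) (hy : 0 < y)
    (hby : b * y ≤ ∑ x ∈ X, triDisc (p x) (margProd p x))
    (hτy : 2 * τ * G ≤ y ^ 2)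
    (hky : 1000000 * (Fintype.card α * Fintype.card γ) ≤ k ^ 2 * y ^ 2) :
    prob (tripleWeight k p) (fun W => Accepts b τ c W) ≤ 1 / 10 := by
  obtain ⟨j, hj, hle⟩ := exists_sum_div_le_sum_dyadicLevel hc hcb hb X
    fun x => triDisc (p x) (margProd p x)
  have hyj : y ≤ ∑ x ∈ X ∩ dyadicLevel c j, triDisc (p x) (margProd p x) := by
    refine ((le_div_iff₀ ?_).2 ((mul_comm _ _).trans_le hby)).trans hle
    exact_mod_cast Nat.pos_of_ne_zero hb
  have hweighted := two_pow_mul_sq_le_sum_dyadicLevel_mul hc hg0 hg hG hy.le hyj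
  have hcard := hp.sq_le_sum_dyadicLevel_mul_card hy.le hyj
  have hS0 : 0 ≤ ∑ x ∈ dyadicLevel c j, (p x - margProd p x) ^ 2 :=
    Finset.sum_nonneg fun x _ => sq_nonneg _
  refine hp.prob_accepts_le hk hτ hc hv hvτ hj rfl ?_ ?_
  · have hG0 : 0 < G := pos_of_mul_pos_right (lt_of_lt_of_le (by positivity) hweighted) hS0
    refine le_of_mul_le_mul_right ?_ hG0
    calc _ = 2 ^ j * (2 * τ * G) := by ring
      _ ≤ 2 ^ j * y ^ 2 := by gcongr
      _ ≤ _ := hweighted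
  · have hcard0 : (0 : ℝ) < Fintype.card α * Fintype.card γ :=
      pos_of_mul_pos_right (lt_of_lt_of_le (by positivity) hcard) hS0
    refine le_of_mul_le_mul_right ?_ hcard0
    calc _ ≤ k ^ 2 * y ^ 2 := hky
      _ ≤ k ^ 2 * _ := by gcongr
      _ = _ := (mul_assoc _ _ _).symm

end Signal

section Test

variable {α γ : Type*} [Fintype α] [Fintype γ] {p : α × γ → ℝ} {k b : ℕ} {τ v : ℝ}

/-- The joint weight of the samples of the collision test: two batches of `k` samples, which
determine `cellCount`, and two batches of `k` triples. -/
def testWeight (k : ℕ) (p : α × γ → ℝ) :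
    ((Fin k → α × γ) × (Fin k → α × γ)) × ((Fin k → Fin 3 → α × γ) × (Fin k → Fin 3 → α × γ)) → ℝ :=
  prodWeight (prodWeight (iid (Fin k) p) (iid (Fin k) p)) (tripleWeight k p)

lemma IsProb.prob_lt_sum_sq_div_cellCount_sq_le (hp : IsProb p) (hk : 0 < k)
    (hv : 46080 * (Fintype.card γ * min (Fintype.card α : ℝ) k / k ^ 4) ≤ v) :
    prob (prodWeight (iid (Fin k) p) (iid (Fin k) p))
      (fun ω => v < ∑ x, margProd p x ^ 2 / (cellCount ω x : ℝ) ^ 2) ≤ 1 / 20 := by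
  have : NeZero k := ⟨hk.ne'⟩
  have hP := (hp.iid (ι := Fin k)).prodWeight (hp.iid (ι := Fin k))
  have hexpect := hp.expect_sum_sq_div_cellCount_sq_le (ι := Fin k)
  rw [Fintype.card_fin] at hexpect
  refine (prob_mono hP.nonneg fun ω hω => ?_).trans (prob_mul_lt_le_one_div (c := 20) hP.nonneg
    (fun ω => Finset.sum_nonneg fun x _ => by positivity) (by positivity) (by norm_num) hexpect)
  linarith

variable {X : Finset (α × γ)} {g : α × γ → ℝ} {G y : ℝ}

lemma IsProb.prob_lt_sum_cellCount_mul_le (hp : IsProb p) (hg0 : ∀ x, 0 ≤ g x)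
    (hG : ∑ x ∈ X, (1 + k * margA p x.1) * (1 + k * margC p x.2) * g x ≤ G) :
    prob (prodWeight (iid (Fin k) p) (iid (Fin k) p))
      (fun ω => 20 * G < ∑ x ∈ X, cellCount ω x * g x) ≤ 1 / 20 := by
  have hP := (hp.iid (ι := Fin k)).prodWeight (hp.iid (ι := Fin k))
  have hexpect : expect (prodWeight (iid (Fin k) p) (iid (Fin k) p))
      (fun ω => ∑ x ∈ X, cellCount ω x * g x) ≤ G := by
    simpa only [expect_sum, expect_mul_const, hp.expect_cellCount, Fintype.card_fin] using hG
  have hnonneg : ∀ ω : (Fin k → α × γ) × (Fin k → α × γ), 0 ≤ ∑ x ∈ X, cellCount ω x * g x :=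
    fun ω => Finset.sum_nonneg fun x _ => mul_nonneg (Nat.cast_nonneg _) (hg0 x)
  exact prob_mul_lt_le_one_div hP.nonneg hnonneg ((expect_nonneg hP.nonneg hnonneg).trans hexpect)
    (by norm_num) hexpect

variable [DecidableEq α] [DecidableEq γ]

lemma IsProb.prob_testWeight_not_accepts_le (hp : IsProb p) (hprod : ∀ x, p x = margProd p x)
    (hk : 0 < k) (hτ : 0 < τ)
    (hv : 46080 * (Fintype.card γ * min (Fintype.card α : ℝ) k / k ^ 4) ≤ v)
    (hvτ : 640 * b * v ≤ k ^ 2 * τ ^ 2) :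
    prob (testWeight k p) (fun ω => ¬ Accepts b τ (cellCount ω.1) ω.2) ≤ 1 / 3 := by
  have hP := (hp.iid (ι := Fin k)).prodWeight (hp.iid (ι := Fin k))
  have hcell : ∀ ω : (Fin k → α × γ) × (Fin k → α × γ),
      ¬ v < ∑ x, margProd p x ^ 2 / (cellCount ω x : ℝ) ^ 2 →
        prob (tripleWeight k p) (fun S => ¬ Accepts b τ (cellCount ω) S) ≤ 1 / 10 := fun ω hω =>
    hp.prob_not_accepts_le hprod hk hτ (cellCount_pos ω) (not_lt.1 hω) hvτ
  have h := prob_prodWeight_le (δ := 1 / 10) hP (isProb_tripleWeight (k := k) hp)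
    (A := fun ω => ¬ Accepts b τ (cellCount ω.1) ω.2) _ (by norm_num) hcell
  exact h.trans (by linarith [hp.prob_lt_sum_sq_div_cellCount_sq_le hk hv])

lemma IsProb.prob_testWeight_accepts_le (hp : IsProb p) (hk : 0 < k) (hτ : 0 < τ) (hb : b ≠ 0)
    (hkb : (k + 1) ^ 2 < 2 ^ b)
    (hv : 46080 * (Fintype.card γ * min (Fintype.card α : ℝ) k / k ^ 4) ≤ v)
    (hvτ : 4000000 * v ≤ k ^ 2 * τ ^ 2) (hg0 : ∀ x, 0 ≤ g x)
    (hg : ∀ x, triDisc (p x) (margProd p x) ^ 2 ≤ (p x - margProd p x) ^ 2 * g x)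
    (hG : ∑ x ∈ X, (1 + k * margA p x.1) * (1 + k * margC p x.2) * g x ≤ G) (hy : 0 < y)
    (hby : b * y ≤ ∑ x ∈ X, triDisc (p x) (margProd p x)) (hτy : 40 * τ * G ≤ y ^ 2)
    (hky : 1000000 * (Fintype.card α * Fintype.card γ) ≤ k ^ 2 * y ^ 2) :
    prob (testWeight k p) (fun ω => Accepts b τ (cellCount ω.1) ω.2) ≤ 1 / 3 := by
  have hP := (hp.iid (ι := Fin k)).prodWeight (hp.iid (ι := Fin k))
  have hcell : ∀ (ω : (Fin k → α × γ) × (Fin k → α × γ)) x, cellCount ω x < 2 ^ b := fun ω x =>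
    ((cellCount_le ω x).trans_eq (by rw [Fintype.card_fin])).trans_lt hkb
  have hgood : ∀ ω : (Fin k → α × γ) × (Fin k → α × γ),
      ¬ (v < ∑ x, margProd p x ^ 2 / (cellCount ω x : ℝ) ^ 2 ∨
        20 * G < ∑ x ∈ X, cellCount ω x * g x) →
      prob (tripleWeight k p) (fun S => Accepts b τ (cellCount ω) S) ≤ 1 / 10 := fun ω hω => by
    rw [not_or, not_lt, not_lt] at hω
    exact hp.prob_accepts_le_of_sum_triDisc hk hτ hb (cellCount_pos ω) (hcell ω) hω.1 hvτ hg0 hg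
      hω.2 hy hby (by linarith) hky
  have h := prob_prodWeight_le (δ := 1 / 10) hP (isProb_tripleWeight (k := k) hp)
    (A := fun ω => Accepts b τ (cellCount ω.1) ω.2) _ (by norm_num) hgood
  have hor := prob_or_le hP.nonneg (fun ω => v < ∑ x, margProd p x ^ 2 / (cellCount ω x : ℝ) ^ 2)
    (fun ω => 20 * G < ∑ x ∈ X, cellCount ω x * g x)
  exact h.trans (by linarith [hp.prob_lt_sum_sq_div_cellCount_sq_le hk hv,
    hp.prob_lt_sum_cellCount_mul_le hg0 hG])

end Test

section Regimes

variable {α γ : Type*} [Fintype α] [Fintype γ] {p : α × γ → ℝ} {k : ℝ} {X : Finset (α × γ)}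

lemma IsProb.sum_triDisc_filter_margC_lt_le (hp : IsProb p) {δ : ℝ} (hδ : 0 ≤ δ) :
    ∑ x with margC p x.2 < δ, triDisc (p x) (margProd p x) ≤ 2 * Fintype.card γ * δ := by
  calc _ ≤ ∑ x with margC p x.2 < δ, (p x + margProd p x) :=
        Finset.sum_le_sum fun x _ => triDisc_le_add (hp.nonneg x) (hp.margProd.nonneg x)
    _ = ∑ c, if margC p c < δ then 2 * margC p c else 0 := by
        rw [Finset.sum_filter, Fintype.sum_prod_type_right]
        refine Finset.sum_congr rfl fun c _ => ?_
        have hcol : ∑ a, margProd p (a, c) = margC p c := by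
          simp only [margProd, prodWeight]
          rw [← Finset.sum_mul, hp.margA.sum_eq, one_mul]
        split_ifs
        · rw [Finset.sum_add_distrib, hcol, two_mul]
          rfl
        · exact Finset.sum_const_zero
    _ ≤ ∑ _c : γ, 2 * δ := by
        refine Finset.sum_le_sum fun c _ => ?_
        split_ifs <;> linarith
    _ = _ := by
        rw [Finset.sum_const, Finset.card_univ, nsmul_eq_mul]
        ring

lemma triDisc_sq_eq (x y : ℝ) : triDisc x y ^ 2 = (x - y) ^ 2 * (triDisc x y / (x + y)) := by
  simp only [triDisc]
  ring

lemma IsProb.sum_mul_triDisc_div_le_of_heavy (hp : IsProb p) (hk : 0 < k)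
    (hA : ∀ x ∈ X, 1 ≤ k * margA p x.1) (hC : ∀ x ∈ X, 1 ≤ k * margC p x.2) :
    ∑ x ∈ X, (1 + k * margA p x.1) * (1 + k * margC p x.2) *
      (triDisc (p x) (margProd p x) / (p x + margProd p x)) ≤
      4 * k ^ 2 * ∑ x ∈ X, triDisc (p x) (margProd p x) := by
  rw [Finset.mul_sum]
  refine Finset.sum_le_sum fun x hx => ?_
  have hA0 : 0 < margA p x.1 := pos_of_mul_pos_right (one_pos.trans_le (hA x hx)) hk.le
  have hC0 : 0 < margC p x.2 := pos_of_mul_pos_right (one_pos.trans_le (hC x hx)) hk.le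
  have hQ0 : 0 < margProd p x := mul_pos hA0 hC0
  have hle : (1 + k * margA p x.1) * (1 + k * margC p x.2) ≤ 4 * k ^ 2 * (p x + margProd p x) := by
    calc _ ≤ (2 * (k * margA p x.1)) * (2 * (k * margC p x.2)) :=
          mul_le_mul (by linarith [hA x hx]) (by linarith [hC x hx]) (by positivity) (by positivity)
      _ = 4 * k ^ 2 * margProd p x := by
          rw [margProd, prodWeight]
          ring
      _ ≤ _ := by
          gcongr
          linarith [hp.nonneg x]
  rw [mul_div_assoc', div_le_iff₀ (add_pos_of_nonneg_of_pos (hp.nonneg x) hQ0)]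
  exact (mul_le_mul_of_nonneg_right hle (hp.triDisc_margProd_nonneg x)).trans_eq (by ring)

lemma IsProb.sum_mul_le_of_light (hp : IsProb p) (hγk : Fintype.card γ ≤ k)
    (hA : ∀ x ∈ X, k * margA p x.1 ≤ 1) :
    ∑ x ∈ X, (1 + k * margA p x.1) * (1 + k * margC p x.2) ≤ 4 * (Fintype.card α * k) := by
  have hk : 0 ≤ k := (Nat.cast_nonneg _).trans hγk
  have hC : ∀ c, 0 ≤ 1 + k * margC p c := fun c => by
    linarith [mul_nonneg hk (hp.margC.nonneg c)]
  calc _ ≤ ∑ x ∈ X, 2 * (1 + k * margC p x.2) :=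
        Finset.sum_le_sum fun x hx =>
          mul_le_mul_of_nonneg_right (by linarith [hA x hx]) (hC x.2)
    _ ≤ ∑ x : α × γ, 2 * (1 + k * margC p x.2) :=
        Finset.sum_le_univ_sum_of_nonneg fun x => mul_nonneg two_pos.le (hC x.2)
    _ = 2 * Fintype.card α * (Fintype.card γ + k) := by
        rw [Fintype.sum_prod_type]
        simp only [← Finset.mul_sum, Finset.sum_add_distrib, hp.margC.sum_eq, Finset.sum_const,
          Finset.card_univ, nsmul_eq_mul]
        ring
    _ ≤ 2 * Fintype.card α * (k + k) := by gcongr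
    _ = _ := by ring

lemma IsProb.le_sum_triDisc_heavy_or_le_sum_triDisc_light (hp : IsProb p) {η : ℝ} (hk : 0 < k)
    (hη : 3 * η ≤ ∑ x, triDisc (p x) (margProd p x)) (hγ : 2 * Fintype.card γ ≤ η * k) :
    (∃ X : Finset (α × γ), (∀ x ∈ X, 1 ≤ k * margA p x.1) ∧ (∀ x ∈ X, 1 ≤ k * margC p x.2) ∧
        η ≤ ∑ x ∈ X, triDisc (p x) (margProd p x)) ∨
      ∃ X : Finset (α × γ), (∀ x ∈ X, k * margA p x.1 ≤ 1) ∧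
        η ≤ ∑ x ∈ X, triDisc (p x) (margProd p x) := by
  classical
  have hcol : ∑ x with margC p x.2 < 1 / k, triDisc (p x) (margProd p x) ≤ η :=
    (hp.sum_triDisc_filter_margC_lt_le (by positivity)).trans (by
      rwa [mul_one_div, div_le_iff₀ hk])
  rw [← Finset.sum_filter_add_sum_filter_not Finset.univ fun x => margC p x.2 < 1 / k] at hη
  have hrow := Finset.sum_filter_add_sum_filter_not
    (Finset.univ.filter fun x : α × γ => ¬ margC p x.2 < 1 / k) (fun x => margA p x.1 < 1 / k)
    (fun x => triDisc (p x) (margProd p x))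
  rcases le_or_gt η (∑ x ∈ (Finset.univ.filter fun x => ¬ margC p x.2 < 1 / k) with
    ¬ margA p x.1 < 1 / k, triDisc (p x) (margProd p x)) with h | h
  · refine Or.inl ⟨_, fun x hx => ?_, fun x hx => ?_, h⟩
    all_goals
      simp only [Finset.mem_filter, Finset.mem_univ, not_lt, true_and, div_le_iff₀' hk] at hx
    exacts [hx.2, hx.1]
  · refine Or.inr ⟨(Finset.univ.filter fun x => ¬ margC p x.2 < 1 / k).filter
      fun x => margA p x.1 < 1 / k, fun x hx => ?_, by linarith⟩
    exact (lt_div_iff₀' hk).1 (Finset.mem_filter.1 hx).2 |>.le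

end Regimes

section Samples

variable {α γ : Type*} {p : α × γ → ℝ} {k : ℕ}

/-- The index set of the `8 * k` samples of the collision test: two batches of `k` samples and two
batches of `k` triples. -/
abbrev TestIndex (k : ℕ) : Type := (Fin k ⊕ Fin k) ⊕ (Fin k × Fin 3 ⊕ Fin k × Fin 3)

lemma card_testIndex (k : ℕ) : Fintype.card (TestIndex k) = 8 * k := by
  simp only [Fintype.card_sum, Fintype.card_prod, Fintype.card_fin]
  ring

/-- The splitting of the samples of the collision test into its batches. -/
def splitSamples (k : ℕ) (β : Type*) : (TestIndex k → β) ≃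
    ((Fin k → β) × (Fin k → β)) × ((Fin k → Fin 3 → β) × (Fin k → Fin 3 → β)) :=
  (Equiv.sumArrowEquivProdArrow _ _ _).trans
    (Equiv.prodCongr (Equiv.sumArrowEquivProdArrow _ _ _)
      ((Equiv.sumArrowEquivProdArrow _ _ _).trans
        (Equiv.prodCongr (Equiv.curry _ _ _) (Equiv.curry _ _ _))))

lemma testWeight_splitSamples (p : α × γ → ℝ) (s : TestIndex k → α × γ) :
    testWeight k p (splitSamples k (α × γ) s) = iid (TestIndex k) p s := by
  simp only [iid, testWeight, prodWeight, tripleWeight, Fintype.prod_sum_type,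
    Fintype.prod_prod_type]
  rfl

variable [Fintype α] [Fintype γ]

lemma prob_splitSamples (p : α × γ → ℝ)
    (A : ((Fin k → α × γ) × (Fin k → α × γ)) ×
      ((Fin k → Fin 3 → α × γ) × (Fin k → Fin 3 → α × γ)) → Prop) :
    prob (iid (TestIndex k) p) (fun s => A (splitSamples k (α × γ) s)) =
      prob (testWeight k p) A := by
  classical
  rw [prob, prob, ← expect_comp_equiv (splitSamples k (α × γ))]
  exact congrArg (expect · _) (funext fun s => (testWeight_splitSamples p s).symm)

lemma isProb_testWeight (hp : IsProb p) : IsProb (testWeight k p) :=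
  (hp.iid.prodWeight hp.iid).prodWeight (isProb_tripleWeight hp)

end Samples

section Parameters

lemma ne_zero_of_succ_sq_lt_two_pow {k b : ℕ} (h : (k + 1) ^ 2 < 2 ^ b) : b ≠ 0 := by
  rintro rfl
  exact h.not_ge (Nat.one_le_pow _ _ k.succ_pos)

variable {α γ : Type*} [Fintype α] [Fintype γ] [DecidableEq α] [DecidableEq γ] {p : α × γ → ℝ}
  {k b : ℕ} {τ v η : ℝ}

lemma IsProb.prob_testWeight_accepts_le_of_sum_triDisc (hp : IsProb p) (hk : 0 < k) (hb : b ≠ 0)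
    (hkb : (k + 1) ^ 2 < 2 ^ b) (hη0 : 0 < η) (hτ : 0 < τ)
    (hη : 3 * η ≤ ∑ x, triDisc (p x) (margProd p x))
    (hv : 46080 * (Fintype.card γ * min (Fintype.card α : ℝ) k / k ^ 4) ≤ v)
    (hvτ : 4000000 * v ≤ k ^ 2 * τ ^ 2) (hγ : 2 * Fintype.card γ ≤ η * k)
    (hγk : Fintype.card γ ≤ k) (hheavy : 160 * τ * b ^ 2 * k ^ 2 ≤ η)
    (hlight : 160 * τ * b ^ 2 * (Fintype.card α * k) ≤ η ^ 2)
    (hkη : 1000000 * (b ^ 2 * ((Fintype.card α : ℝ) * Fintype.card γ)) ≤ k ^ 2 * η ^ 2) :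
    prob (testWeight k p) (fun ω => Accepts b τ (cellCount ω.1) ω.2) ≤ 1 / 3 := by
  have hb' : (0 : ℝ) < b := by exact_mod_cast Nat.pos_of_ne_zero hb
  have hk' : (0 : ℝ) < k := by exact_mod_cast hk
  rcases hp.le_sum_triDisc_heavy_or_le_sum_triDisc_light hk' hη hγ with
    ⟨X, hA, hC, hX⟩ | ⟨X, hA, hX⟩
  · set Y := ∑ x ∈ X, triDisc (p x) (margProd p x)
    have hY : 0 < Y := hη0.trans_le hX
    refine hp.prob_testWeight_accepts_le hk hτ hb hkb hv hvτ (X := X) (y := Y / b)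
      (fun x => div_nonneg (hp.triDisc_margProd_nonneg x)
        (add_nonneg (hp.nonneg x) (hp.margProd.nonneg x))) (fun x => (triDisc_sq_eq _ _).le)
      (hp.sum_mul_triDisc_div_le_of_heavy hk' hA hC) (div_pos hY hb')
      (mul_div_cancel₀ _ hb'.ne').le ?_ ?_
    · rw [div_pow, le_div_iff₀ (by positivity)]
      calc _ = 160 * τ * b ^ 2 * k ^ 2 * Y := by ring
        _ ≤ Y * Y := by gcongr; exact hheavy.trans hX
        _ = _ := by ring
    · rw [div_pow, mul_div_assoc', le_div_iff₀ (by positivity)]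
      calc _ ≤ k ^ 2 * η ^ 2 := le_of_eq_of_le (by ring) hkη
        _ ≤ _ := by gcongr
  · refine hp.prob_testWeight_accepts_le hk hτ hb hkb hv hvτ (X := X) (g := fun _ => 1)
      (y := η / b) (fun _ => zero_le_one)
      (fun x => (hp.triDisc_margProd_sq_le x).trans_eq (mul_one _).symm)
      (by simpa only [mul_one] using hp.sum_mul_le_of_light (mod_cast hγk) hA) (div_pos hη0 hb')
      ((mul_div_cancel₀ _ hb'.ne').trans_le hX) ?_ ?_
    · rw [div_pow, le_div_iff₀ (by positivity)]
      exact le_of_eq_of_le (by ring) hlight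
    · rw [div_pow, mul_div_assoc', le_div_iff₀ (by positivity)]
      exact le_of_eq_of_le (by ring) hkη

lemma mitestable_of_threshold_le {n m : ℕ} {ε : ℝ} (hk : 0 < k)
    (hkb : (k + 1) ^ 2 < 2 ^ b) (hη0 : 0 < η) (hτ : 0 < τ)
    (hη : ∀ p : Fin n × Fin m → ℝ, IsProb p → ε ≤ mutualInfo p →
      3 * η ≤ ∑ x, triDisc (p x) (margProd p x))
    (hτ2 : 4000000 * b * (46080 * (m * min (n : ℝ) k / k ^ 4)) ≤ k ^ 2 * τ ^ 2)
    (hmη : 2 * m ≤ η * k) (hmk : m ≤ k) (hheavy : 160 * τ * b ^ 2 * k ^ 2 ≤ η)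
    (hlight : 160 * τ * b ^ 2 * (n * k) ≤ η ^ 2)
    (hkη : 1000000 * (b ^ 2 * ((n : ℝ) * m)) ≤ k ^ 2 * η ^ 2) :
    MITestable ε n m (8 * k) := by
  have hb := ne_zero_of_succ_sq_lt_two_pow hkb
  have hb1 : (1 : ℝ) ≤ b := by exact_mod_cast Nat.one_le_iff_ne_zero.2 hb
  set v : ℝ := 46080 * (m * min (n : ℝ) k / k ^ 4) with hv
  have hv0 : 0 ≤ v := by positivity
  rw [← card_testIndex]
  refine mitestable_card (TestIndex k) (fun s => Accepts b τ (cellCount (splitSamples k _ s).1)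
    (splitSamples k _ s).2) (fun p hp hprod => ?_) fun p hp hI => ?_
  · rw [prob_splitSamples p fun ω => Accepts b τ (cellCount ω.1) ω.2]
    have h := hp.prob_testWeight_not_accepts_le hprod hk hτ (b := b) (v := v)
      (by simp only [Fintype.card_fin, hv, le_refl])
      ((mul_le_mul_of_nonneg_right (by linarith) hv0).trans hτ2)
    linarith [(isProb_testWeight (k := k) hp).prob_not
      fun ω => Accepts b τ (cellCount ω.1) ω.2]
  · rw [prob_splitSamples p fun ω => Accepts b τ (cellCount ω.1) ω.2]
    refine hp.prob_testWeight_accepts_le_of_sum_triDisc hk hb hkb hη0 hτ (hη p hp hI) (v := v)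
      (by simp only [Fintype.card_fin, hv, le_refl])
      ((mul_le_mul_of_nonneg_right (by linarith) hv0).trans hτ2) ?_ ?_ hheavy ?_ ?_
    all_goals simpa only [Fintype.card_fin]

lemma le_sq_mul_min_sq {n m k b η : ℝ} (hn : 0 < n) (hk : 0 < k) (hb : 0 < b) (hm : 0 ≤ m)
    (h2 : 5 * 10 ^ 15 * (b ^ 5 * (n * m)) ≤ (k * η) ^ 2)
    (h4 : 5 * 10 ^ 15 * (b ^ 5 * (n ^ 2 * (m * min n k))) ≤ (k * η) ^ 4) :
    4000000 * b * (46080 * (m * min n k / k ^ 4)) ≤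
      k ^ 2 * min (η / (160 * b ^ 2 * k ^ 2)) (η ^ 2 / (160 * b ^ 2 * (n * k))) ^ 2 := by
  rcases min_choice (η / (160 * b ^ 2 * k ^ 2)) (η ^ 2 / (160 * b ^ 2 * (n * k))) with h | h
  all_goals rw [h, div_pow, mul_div_assoc', mul_div_assoc', mul_div_assoc',
    div_le_div_iff₀ (by positivity) (by positivity)]
  · calc _ = 4718592000000000 * (b ^ 5 * (min n k * m)) * k ^ 4 := by ring
      _ ≤ 5000000000000000 * (b ^ 5 * (n * m)) * k ^ 4 := by
          gcongr
          exacts [by norm_num, min_le_left _ _]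
      _ = 5 * 10 ^ 15 * (b ^ 5 * (n * m)) * k ^ 4 := by norm_num
      _ ≤ (k * η) ^ 2 * k ^ 4 := by gcongr
      _ = _ := by ring
  · calc _ = 4718592000000000 * (b ^ 5 * (n ^ 2 * (m * min n k))) * k ^ 2 := by ring
      _ ≤ 5000000000000000 * (b ^ 5 * (n ^ 2 * (m * min n k))) * k ^ 2 := by
          gcongr
          norm_num
      _ = 5 * 10 ^ 15 * (b ^ 5 * (n ^ 2 * (m * min n k))) * k ^ 2 := by norm_num
      _ ≤ (k * η) ^ 4 * k ^ 2 := by gcongr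
      _ = _ := by ring

lemma mitestable_of_le_pow {n m k b : ℕ} {ε η : ℝ} (hn : 0 < n) (hmn : m ≤ n) (hk : 0 < k)
    (hkb : (k + 1) ^ 2 < 2 ^ b) (hη0 : 0 < η) (hη2 : η ≤ 2)
    (hη : ∀ p : Fin n × Fin m → ℝ, IsProb p → ε ≤ mutualInfo p →
      3 * η ≤ ∑ x, triDisc (p x) (margProd p x))
    (h2 : 5 * 10 ^ 15 * (b ^ 5 * ((n : ℝ) * m)) ≤ (k * η) ^ 2)
    (h4 : 5 * 10 ^ 15 * (b ^ 5 * ((n : ℝ) ^ 2 * (m * min (n : ℝ) k))) ≤ (k * η) ^ 4) :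
    MITestable ε n m (8 * k) := by
  have hb : (1 : ℝ) ≤ b :=
    Nat.one_le_cast.2 (Nat.one_le_iff_ne_zero.2 (ne_zero_of_succ_sq_lt_two_pow hkb))
  have hmn' : (m : ℝ) ≤ n := by exact_mod_cast hmn
  have hmη : 2 * m ≤ η * k := by
    refine le_of_sq_le_sq ?_ (by positivity)
    calc (2 * (m : ℝ)) ^ 2 = 4 * (1 * (m * m)) := by ring
      _ ≤ 5 * 10 ^ 15 * (b ^ 5 * (n * m)) := by
          gcongr
          exacts [by norm_num, one_le_pow₀ hb]
      _ ≤ _ := h2.trans_eq (by ring)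
  have hmk : (m : ℝ) ≤ k := by nlinarith [(Nat.cast_nonneg k : (0 : ℝ) ≤ k)]
  set τ := min (η / (160 * b ^ 2 * k ^ 2)) (η ^ 2 / (160 * b ^ 2 * (n * k)))
  refine mitestable_of_threshold_le (τ := τ) hk hkb hη0 (lt_min (by positivity) (by positivity)) hη
    (le_sq_mul_min_sq (by positivity) (by positivity) (by positivity) (by positivity) h2 h4) hmη
    (mod_cast hmk) ?_ ?_ ?_
  · calc _ = τ * (160 * b ^ 2 * k ^ 2) := by ring
      _ ≤ _ := (le_div_iff₀ (by positivity)).1 (min_le_left _ _)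
  · calc _ = τ * (160 * b ^ 2 * (n * k)) := by ring
      _ ≤ _ := (le_div_iff₀ (by positivity)).1 (min_le_right _ _)
  · rw [← mul_pow]
    refine le_trans ?_ h2
    gcongr ?_ * (?_ * _)
    exacts [by norm_num, pow_le_pow_right₀ hb (by norm_num)]

end Parameters

section UpperRate

variable {n m k : ℕ} {ε Q x : ℝ}

/-- The logarithmic factor `L`. -/
def logFactor (ε : ℝ) (n m : ℕ) : ℝ := Real.log (2 + n * m / ε)

lemma two_add_div_le (hm : 1 ≤ m) (hε : 0 < ε) : 2 + n / ε ≤ Real.exp (logFactor ε n m) := by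
  have hm' : (1 : ℝ) ≤ m := by exact_mod_cast hm
  rw [logFactor, Real.exp_log (by positivity)]
  gcongr
  exact le_mul_of_one_le_right n.cast_nonneg hm'

lemma log_two_add_le_logFactor (hε : 0 < ε) (hεm : ε ≤ m) : Real.log (2 + n) ≤ logFactor ε n m := by
  refine Real.log_le_log (by positivity) (add_le_add_right ?_ _)
  rw [le_div_iff₀ hε]
  gcongr

lemma one_le_logFactor (hn : 1 ≤ n) (hε : 0 < ε) (hεm : ε ≤ m) : 1 ≤ logFactor ε n m := by
  refine le_trans ?_ (log_two_add_le_logFactor hε hεm)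
  have hn' : (1 : ℝ) ≤ n := by exact_mod_cast hn
  rw [Real.le_log_iff_exp_le (by positivity)]
  linarith [Real.exp_one_lt_d9]

lemma le_logFactor (hm : 1 ≤ m) (hmn : m ≤ n) (hε : 0 < ε) (hεm : ε ≤ Real.log m) :
    ε ≤ logFactor ε n m := by
  have hmn' : (m : ℝ) ≤ n := by exact_mod_cast hmn
  exact hεm.trans ((Real.log_le_log (by positivity) (by linarith)).trans
    (log_two_add_le_logFactor hε (hεm.trans (Real.log_le_self m.cast_nonneg))))

lemma one_add_two_mul_log_le (hn : 0 < n) (hm : 1 ≤ m) (hε : 0 < ε) (hL : 1 ≤ logFactor ε n m) :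
    1 + 2 * Real.log (8 * n / ε) ≤ 8 * logFactor ε n m := by
  have hexp : (8 : ℝ) ≤ Real.exp 2.5 := by
    rw [← Real.log_le_iff_le_exp (by norm_num), show (8 : ℝ) = 2 ^ 3 by norm_num, Real.log_pow]
    norm_num
    linarith [Real.log_two_lt_d9]
  have hlog : Real.log (8 * n / ε) ≤ 2.5 + logFactor ε n m := by
    rw [Real.log_le_iff_le_exp (by positivity), Real.exp_add, mul_div_assoc]
    gcongr
    linarith [two_add_div_le (n := n) hm hε]
  linarith

lemma mul_le_miRate_mul_sq {L : ℝ} (hmn : m ≤ n) (hε : 0 < ε) (hL : 1 ≤ L) (hεL : ε ≤ L) :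
    (n : ℝ) * m ≤ (miRate ε n m * ε * L) ^ 2 := by
  have := mul_nonneg (miRate_nonneg n m hε) hε.le
  have hmn' : (m : ℝ) ≤ n := by exact_mod_cast hmn
  rcases miRate_pow_eq n m hε with h | h
  · refine le_of_sq_le_sq ?_ (sq_nonneg _)
    calc ((n : ℝ) * m) ^ 2 = (n : ℝ) ^ 2 * m * m := by ring
      _ ≤ (n : ℝ) ^ 2 * m * n := by gcongr
      _ = (miRate ε n m * ε) ^ 4 * 1 := by rw [h]; ring
      _ ≤ (miRate ε n m * ε) ^ 4 * L ^ 4 := by gcongr; exact one_le_pow₀ hL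
      _ = _ := by ring
  · refine le_of_pow_le_pow_left₀ (n := 3) three_ne_zero (sq_nonneg _) ?_
    calc ((n : ℝ) * m) ^ 3 = (n : ℝ) ^ 3 * m ^ 2 * m := by ring
      _ ≤ (n : ℝ) ^ 3 * m ^ 2 * n := by gcongr
      _ = ((n : ℝ) ^ 2 * m) ^ 2 * 1 := by ring
      _ = (miRate ε n m * ε) ^ 6 * ε ^ 2 * 1 := by rw [← h]; ring
      _ ≤ (miRate ε n m * ε) ^ 6 * L ^ 2 * L ^ 4 := by gcongr; exact one_le_pow₀ hL
      _ = _ := by ring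

lemma pow_three_mul_le_of_mul_miRate_le (hε : 0 < ε) (hQ : 1 ≤ Q) (hx : Q * miRate ε n m ≤ x) :
    Q ^ 3 * ((n : ℝ) ^ 2 * (m * min (n : ℝ) x)) ≤ (x * ε) ^ 4 := by
  have hR := miRate_nonneg n m hε
  have hx0 : 0 ≤ x := le_trans (by positivity) hx
  rcases miRate_pow_eq n m hε with h | h
  · calc _ ≤ Q ^ 4 * ((n : ℝ) ^ 2 * (m * n)) := by
          gcongr
          exacts [by norm_num, min_le_left _ _]
      _ = (Q * miRate ε n m * ε) ^ 4 := by rw [mul_assoc Q, mul_pow Q, h]; ring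
      _ ≤ (x * ε) ^ 4 := by gcongr
  · calc _ ≤ Q ^ 3 * ((n : ℝ) ^ 2 * (m * x)) := by
          gcongr
          exact min_le_right _ _
      _ = (Q * miRate ε n m) ^ 3 * x * ε ^ 4 := by linear_combination -(Q ^ 3 * x) * h
      _ ≤ x ^ 3 * x * ε ^ 4 := by gcongr
      _ = (x * ε) ^ 4 := by ring

lemma le_exp_of_le_mul_pow {L R y : ℝ} (hL : 1 ≤ L) (hR0 : 0 ≤ R) (hR : R ≤ Real.exp L)
    (hy : y ≤ 3 * (10 ^ 20 * L ^ 5 * R)) : y ≤ Real.exp (56 * L) := by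
  have hconst : (3 * 10 ^ 20 : ℝ) ≤ Real.exp (50 * L) := by
    calc (3 * 10 ^ 20 : ℝ) ≤ 2.7 ^ 50 := by norm_num
      _ ≤ Real.exp 1 ^ 50 := by
          gcongr
          linarith [Real.exp_one_gt_d9]
      _ = Real.exp 50 := by rw [← Real.exp_nat_mul]; norm_num
      _ ≤ _ := Real.exp_le_exp.2 (by linarith)
  have hpow : L ^ 5 ≤ Real.exp (5 * L) := by
    calc L ^ 5 ≤ Real.exp L ^ 5 := by
          gcongr
          linarith [Real.add_one_le_exp L]
      _ = _ := by rw [← Real.exp_nat_mul]; norm_num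
  calc y ≤ 3 * 10 ^ 20 * L ^ 5 * R := hy.trans_eq (by ring)
    _ ≤ Real.exp (50 * L) * Real.exp (5 * L) * Real.exp L := by gcongr
    _ = Real.exp (56 * L) := by
        rw [← Real.exp_add, ← Real.exp_add]
        ring_nf

lemma natLog_succ_sq_le {y : ℝ} (hk : (k : ℝ) + 1 ≤ Real.exp y) :
    (Nat.log 2 ((k + 1) ^ 2) : ℝ) ≤ 3 * y := by
  have hy : 0 ≤ y := Real.one_le_exp_iff.1 (by linarith [k.cast_nonneg (α := ℝ)])
  have hlog : Real.log (k + 1) ≤ y := (Real.log_le_iff_le_exp (by positivity)).2 hk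
  refine (Real.natLog_le_logb _ _).trans ?_
  rw [Real.logb, div_le_iff₀ (by positivity)]
  push_cast
  rw [Real.log_pow]
  push_cast
  nlinarith [Real.log_two_gt_d9]

lemma three_mul_le_sum_triDisc {p : Fin n × Fin m → ℝ} (hp : IsProb p) (hn : 0 < n) (hm : 1 ≤ m)
    (hε : 0 < ε) (hεn : ε ≤ n) (hL : 1 ≤ logFactor ε n m) (h : ε ≤ mutualInfo p) :
    3 * (ε / (160 * logFactor ε n m)) ≤ ∑ x, triDisc (p x) (margProd p x) := by
  have hS : 0 ≤ ∑ x, triDisc (p x) (margProd p x) :=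
    Finset.sum_nonneg fun x _ => triDisc_nonneg (hp.nonneg x) (hp.margProd.nonneg x)
  have hle := hp.le_sum_triDisc (ε := ε) (by simpa using hn) hε (by simpa using hεn) h
  rw [Fintype.card_fin] at hle
  have hlog := mul_le_mul_of_nonneg_right (one_add_two_mul_log_le hn hm hε hL) hS
  rw [mul_div_assoc', div_le_iff₀ (by positivity)]
  linarith

lemma mitestable_of_mul_miRate_le {b : ℕ} (hm : 1 ≤ m) (hmn : m ≤ n) (hε : 0 < ε)
    (hεm : ε ≤ Real.log m) (hk : 0 < k) (hkb : (k + 1) ^ 2 < 2 ^ b)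
    (hb : b ≤ 200 * logFactor ε n m)
    (hR : 10 ^ 20 * logFactor ε n m ^ 5 * miRate ε n m ≤ k) : MITestable ε n m (8 * k) := by
  have hmn' : (m : ℝ) ≤ n := by exact_mod_cast hmn
  have hεm' : ε ≤ m := hεm.trans (Real.log_le_self m.cast_nonneg)
  have hL := one_le_logFactor (hm.trans hmn) hε hεm'
  have hεL := le_logFactor hm hmn hε hεm
  have hR0 := miRate_nonneg n m hε
  set L := logFactor ε n m
  refine mitestable_of_le_pow (η := ε / (160 * L)) (by omega) hmn hk hkb (by positivity) ?_
    (fun p hp h => three_mul_le_sum_triDisc hp (by omega) hm hε (hεm'.trans hmn') hL h) ?_ ?_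
  · rw [div_le_iff₀ (by positivity)]
    linarith
  · rw [mul_div_assoc', div_pow, le_div_iff₀ (by positivity)]
    calc 5 * 10 ^ 15 * (b ^ 5 * ((n : ℝ) * m)) * (160 * L) ^ 2
        ≤ 5 * 10 ^ 15 * ((200 * L) ^ 5 * (miRate ε n m * ε * L) ^ 2) * (160 * L) ^ 2 := by
          gcongr
          exact mul_le_miRate_mul_sq hmn hε hL hεL
      _ = 5 * 10 ^ 15 * 200 ^ 5 * 160 ^ 2 * L ^ 9 * (miRate ε n m * ε) ^ 2 := by ring
      _ ≤ (10 ^ 20) ^ 2 * L ^ 10 * (miRate ε n m * ε) ^ 2 := by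
          gcongr ?_ * ?_ * _
          exacts [by norm_num, pow_le_pow_right₀ hL (by norm_num)]
      _ = (10 ^ 20 * L ^ 5 * miRate ε n m * ε) ^ 2 := by ring
      _ ≤ (k * ε) ^ 2 := by gcongr
  · rw [mul_div_assoc', div_pow, le_div_iff₀ (by positivity)]
    calc 5 * 10 ^ 15 * (b ^ 5 * ((n : ℝ) ^ 2 * (m * min (n : ℝ) k))) * (160 * L) ^ 4
        ≤ 5 * 10 ^ 15 * ((200 * L) ^ 5 * ((n : ℝ) ^ 2 * (m * min (n : ℝ) k))) * (160 * L) ^ 4 := by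
          gcongr
      _ = 5 * 10 ^ 15 * 200 ^ 5 * 160 ^ 4 * L ^ 9 * ((n : ℝ) ^ 2 * (m * min (n : ℝ) k)) := by ring
      _ ≤ (10 ^ 20) ^ 3 * L ^ 15 * ((n : ℝ) ^ 2 * (m * min (n : ℝ) k)) := by
          gcongr ?_ * ?_ * _
          exacts [by norm_num, pow_le_pow_right₀ hL (by norm_num)]
      _ = (10 ^ 20 * L ^ 5) ^ 3 * ((n : ℝ) ^ 2 * (m * min (n : ℝ) k)) := by ring
      _ ≤ (k * ε) ^ 4 := pow_three_mul_le_of_mul_miRate_le hε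
          (by linarith [one_le_pow₀ hL (n := 5)]) hR

lemma mitestable_zero (h : Real.log m < ε) : MITestable ε n m 0 := by
  rw [← Fintype.card_fin 0]
  refine mitestable_card (Fin 0) (fun _ => True) (fun p hp _ => ?_) fun p hp hI => ?_
  · simp only [prob, if_true, hp.iid.expect_const]
    norm_num
  · have hmi := hp.mutualInfo_le_log_card
    rw [Fintype.card_fin] at hmi
    linarith

lemma miRate_le_exp_logFactor (hm : 1 ≤ m) (hmn : m ≤ n) (hε : 0 < ε) :
    miRate ε n m ≤ Real.exp (logFactor ε n m) := by
  have hle := mul_le_of_le_miRate hmn hε (miRate_nonneg n m hε) le_rfl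
  rw [← le_div_iff₀ hε] at hle
  linarith [two_add_div_le (n := n) hm hε]

lemma one_le_mul_miRate (hm : 1 ≤ m) (hmn : m ≤ n) (hε : 0 < ε) (hL : 1 ≤ logFactor ε n m)
    (hεL : ε ≤ logFactor ε n m) : 1 ≤ 10 ^ 20 * logFactor ε n m ^ 5 * miRate ε n m := by
  have hR := miRate_nonneg n m hε
  set L := logFactor ε n m
  have hnm : (1 : ℝ) ≤ n * m := by exact_mod_cast Nat.mul_pos (by omega) hm
  calc 1 ≤ miRate ε n m * ε * L :=
        (one_le_sq_iff₀ (by positivity)).1 (hnm.trans (mul_le_miRate_mul_sq hmn hε hL hεL))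
    _ ≤ miRate ε n m * L * L := by gcongr
    _ = 1 * L ^ 2 * miRate ε n m := by ring
    _ ≤ 10 ^ 20 * L ^ 5 * miRate ε n m := by
        gcongr
        all_goals norm_num

lemma natLog_succ_sq_add_one_le (hm : 1 ≤ m) (hmn : m ≤ n) (hε : 0 < ε) (hL : 1 ≤ logFactor ε n m)
    (hk : (k : ℝ) + 1 ≤ 3 * (10 ^ 20 * logFactor ε n m ^ 5 * miRate ε n m)) :
    (Nat.log 2 ((k + 1) ^ 2) + 1 : ℕ) ≤ 200 * logFactor ε n m := by
  have := natLog_succ_sq_le (le_exp_of_le_mul_pow hL (miRate_nonneg n m hε)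
    (miRate_le_exp_logFactor hm hmn hε) hk)
  push_cast
  linarith

lemma exists_mitestable_le_miRate (hm : 1 ≤ m) (hmn : m ≤ n) (hε : 0 < ε) :
    ∃ N : ℕ, MITestable ε n m N ∧
      (N : ℝ) ≤ 16 * 10 ^ 20 * logFactor ε n m ^ 5 * miRate ε n m := by
  have hR := miRate_nonneg n m hε
  rcases lt_or_ge (Real.log m) ε with hlt | hεm
  · have hL : 0 ≤ logFactor ε n m :=
      Real.log_nonneg (by linarith [show (0 : ℝ) ≤ n * m / ε by positivity])
    exact ⟨0, mitestable_zero hlt, by rw [Nat.cast_zero]; positivity⟩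
  have hεm' := hεm.trans (Real.log_le_self m.cast_nonneg)
  have hL := one_le_logFactor (hm.trans hmn) hε hεm'
  have hone := one_le_mul_miRate hm hmn hε hL (le_logFactor hm hmn hε hεm)
  set x := 10 ^ 20 * logFactor ε n m ^ 5 * miRate ε n m
  have hceil : (⌈x⌉₊ : ℝ) < x + 1 := Nat.ceil_lt_add_one (by linarith)
  refine ⟨8 * ⌈x⌉₊, mitestable_of_mul_miRate_le hm hmn hε hεm (Nat.ceil_pos.2 (by linarith))
    (Nat.lt_pow_succ_log_self one_lt_two _)
    (natLog_succ_sq_add_one_le hm hmn hε hL (by linarith)) (Nat.le_ceil x), ?_⟩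
  push_cast
  linarith

end UpperRate

end MITesting

end

theorem mainTheorem1 :
    ∃ (ε₀ K : ℝ) (k : ℕ), 0 < ε₀ ∧ 0 < K ∧
      ∀ (dA dC : ℕ) (ε : ℝ), 1 ≤ dC → dC ≤ dA → 0 < ε →
        -- some number of samples suffices, so the sample complexity is a genuine minimum
        (∃ N : ℕ, MITesting.MITestable ε dA dC N) ∧
        -- upper bound
        (MITesting.miSampleComplexity ε dA dC : ℝ) ≤
          K * Real.log (2 + (dA : ℝ) * (dC : ℝ) / ε) ^ k * MITesting.miRate ε dA dC ∧
        -- lower bound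
        (2 ≤ dC → ε ≤ ε₀ →
          MITesting.miRate ε dA dC ≤
            K * Real.log (2 + (dA : ℝ) * (dC : ℝ) / ε) ^ k *
              (MITesting.miSampleComplexity ε dA dC : ℝ)) := by
  refine ⟨1 / 20000, 16 * 10 ^ 20, 5, by norm_num, by norm_num, fun n m ε hm hmn hε => ?_⟩
  obtain ⟨N, hN, hle⟩ := MITesting.exists_mitestable_le_miRate hm hmn hε
  refine ⟨⟨N, hN⟩, le_trans ?_ hle, fun hm2 hε1 => ?_⟩
  · exact_mod_cast Nat.sInf_le hN
  · have hmin : MITesting.MITestable ε n m (MITesting.miSampleComplexity ε n m) :=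
      Nat.sInf_mem (s := {N | MITesting.MITestable ε n m N}) ⟨N, hN⟩
    have hm' : (2 : ℝ) ≤ m := by exact_mod_cast hm2
    have hL : 1 ≤ Real.log (2 + n * m / ε) ^ 5 := one_le_pow₀
      (MITesting.one_le_logFactor (n := n) (m := m) (by omega) hε (by linarith))
    refine (MITesting.miRate_le_of_mitestable hm2 hmn hε hε1 hmin).trans ?_
    exact mul_le_mul_of_nonneg_right (by linarith) (Nat.cast_nonneg _)
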